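/- Let $\Bbbk$ be a field; $\otimes=\otimes_{\Bbbk}$ and Sweedler notation is used throughout. **Weak quasitriangular pair.** For algebras and coalgebras $C,B$ a *weak bialgebra pairing* is a linear map $\operatorname{ev}\colon C\otimes B\to\Bbbk$ with $$\operatorname{ev}(cc',b)=\operatorname{ev}(c,b_{(2)})\operatorname{ev}(c',b_{(1)}),\quad \operatorname{ev}(c,bb')=\operatorname{ev}(c_{(1)},b')\operatorname{ev}(c_{(2)},b),\quad \operatorname{ev}(1,b)=\varepsilon(b),\quad \operatorname{ev}(c,1)=\varepsilon(c).$$ Let $A,H$ be Hopf algebras over $\Bbbk$ with a weak bialgebra pairing $\langle\,,\rangle\colon H\otimes A\to\Bbbk$ satisfying $\langle Sh,a\rangle=\langle h,Sa\rangle$, and let $R,\overline R\colon A\to H$ be anti-algebra and coalgebra maps which, as maps $A\to H^{\operatorname{op}}$, have convolution inverses $R^{-\ast},\overline R^{-\ast}$ (so $R^{-\ast}(a_{(2)})R(a_{(1)})=\varepsilon(a)1=R(a_{(2)})R^{-\ast}(a_{(1)})$, and likewise for $\overline R$), such that for all $a,b\in A$, $h\in H$ $$\langle\overline R(a),b\rangle=\langle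 R^{-\ast}(b),a\rangle,$$ $$R(a_{(2)})h_{(2)}\langle h_{(1)},a_{(1)}\rangle=h_{(1)}R(a_{(1)})\langle h_{(2)},a_{(2)}\rangle,\qquad \overline R(a_{(2)})h_{(2)}\langle h_{(1)},a_{(1)}\rangle=h_{(1)}\overline R(a_{(1)})\langle h_{(2)},a_{(2)}\rangle .$$ **Comodules.** For a left $A$-comodule $V$ write $v\mapsto v^{(-1)}\otimes v^{(0)}\in A\otimes V$ for the coaction and $h\triangleright v=\langle h,v^{(-1)}\rangle v^{(0)}$ for $h\in H$. On left $A$-comodules use the tensor product with coaction $v\otimes w\mapsto v^{(-1)}w^{(-1)}\otimes(v^{(0)}\otimes w^{(0)})$ and the braiding $\Psi(v\otimes w)=\langle R(w^{(-1)}),v^{(-1)}\rangle\,w^{(0)}\otimes v^{(0)}$; algebras, bialgebras, etc. "in left $A$-comodules" are meant with respect to these structures, so all their structure maps are $A$-colinear. Let $B,C$ be bialgebras in left $A$-comodules, weakly dual via an $A$-colinear weak bialgebra pairing $\operatorname{ev}\colon C\otimes B\to\Bbbk$. Let $D$ be a left $B$-comodule algebra in left $A$-comodules, that is, an algebra in left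 $A$-comodules with an $A$-colinear left $B$-coaction $\delta_B(d)=d^{\overline{(-1)}}\otimes d^{\overline{(0)}}$ such that $\delta_B(1)=1\otimes 1$ and $\delta_B m_D=(m_B\otimes m_D)(\operatorname{Id}_B\otimes\Psi_{D,B}\otimes\operatorname{Id}_D)(\delta_B\otimes\delta_B)$. **The algebras.** $\operatorname{Drin}_H(C,B)$ is the $\Bbbk$-algebra generated by $C,H,B$ (with their given products and units) subject to $$\bigl(R^{-\ast}({c_{(1)}}^{(-1)})\triangleright b_{(2)}\bigr){c_{(1)}}^{(0)}\operatorname{ev}(c_{(2)},b_{(1)})=R^{-\ast}({c_{(1)}}^{(-1)})\,c_{(2)}\,b_{(1)}\,\overline R^{-\ast}({b_{(2)}}^{(-1)})\operatorname{ev}({c_{(1)}}^{(0)},{b_{(2)}}^{(0)}),$$ $$hb=(h_{(2)}\triangleright b)h_{(1)},\qquad hc=(h_{(2)}\triangleright c)h_{(1)}.$$ $D\rtimes{}^{\operatorname{cop}}C$ is the algebra generated by $D,C$ (with their given products and units) subject to $$cd=\bigl(R^{-\ast}({c_{(1)}}^{(-1)})\triangleright d^{\overline{(0)}}\bigr){c_{(1)}}^{(0)}\operatorname{ev}(c_{(2)},d^{\overline{(-1)}}),$$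 and $D\rtimes{}^{\operatorname{cop}}C\rtimes H$ is the algebra generated by $D,C,H$ (with their given products and units) subject to this relation and $hd=(h_{(2)}\triangleright d)h_{(1)}$, $hc=(h_{(2)}\triangleright c)h_{(1)}$. **Claim.** 1. The maps $D\otimes C\to D\rtimes{}^{\operatorname{cop}}C$, $d\otimes c\mapsto dc$, and $D\otimes C\otimes H\to D\rtimes{}^{\operatorname{cop}}C\rtimes H$, $d\otimes c\otimes h\mapsto dch$, are bijective, so these are the cross product algebras on $D\otimes C$ and $D\otimes C\otimes H$. 2. $\operatorname{Drin}_H(C,B)$ is a $\Bbbk$-bialgebra with coproduct determined by $$\Delta(h)=h_{(2)}\otimes h_{(1)},\quad \Delta(b)=b_{(1)}\overline R^{-\ast}({b_{(2)}}^{(-1)})\otimes{b_{(2)}}^{(0)},\quad \Delta(c)=R^{-\ast}({c_{(1)}}^{(-1)})c_{(2)}\otimes{c_{(1)}}^{(0)}$$ and counit extending those of $H$, $B$ and $C$. 3. $D\rtimes{}^{\operatorname{cop}}C\rtimes H$ is a left $\operatorname{Drin}_H(C,B)$-comodule algebra: there is an algebra homomorphism $\delta_{\operatorname{Drin}}\colon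 D\rtimes{}^{\operatorname{cop}}C\rtimes H\to\operatorname{Drin}_H(C,B)\otimes(D\rtimes{}^{\operatorname{cop}}C\rtimes H)$ which is a coassociative and counital left coaction and is given by $$\delta_{\operatorname{Drin}}(d)=d^{\overline{(-1)}}\,\overline R^{-\ast}(d^{\overline{(0)}(-1)})\otimes d^{\overline{(0)}(0)},\quad \delta_{\operatorname{Drin}}(c)=R^{-\ast}({c_{(1)}}^{(-1)})c_{(2)}\otimes{c_{(1)}}^{(0)},\quad \delta_{\operatorname{Drin}}(h)=h_{(2)}\otimes h_{(1)}.$$ 4. $D\rtimes{}^{\operatorname{cop}}C$ is a comodule subalgebra: the algebra homomorphism $D\rtimes{}^{\operatorname{cop}}C\to D\rtimes{}^{\operatorname{cop}}C\rtimes H$ that is the identity on $D$ and $C$ is injective, and $\delta_{\operatorname{Drin}}$ restricts along it to a left $\operatorname{Drin}_H(C,B)$-coaction on $D\rtimes{}^{\operatorname{cop}}C$ which is an algebra homomorphism. -/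

import Mathlib

open scoped TensorProduct

noncomputable section

namespace BraidedDouble

/-! ## Linear algebra of coactions and braidings over a field `k` -/

section Linear

variable {k : Type*} [Field k]

/-- A linear map `δ : V → E ⊗ V` is a left coaction of the coalgebra `E` on `V`. -/
structure IsLeftCoaction {E V : Type*} [AddCommGroup E] [Module k E] [Coalgebra k E]
    [AddCommGroup V] [Module k V] (δ : V →ₗ[k] E ⊗[k] V) : Prop where
  coassoc : (TensorProduct.assoc k E E V).toLinearMap ∘ₗ
      (Coalgebra.comul (R := k) (A := E)).rTensor V ∘ₗ δ = δ.lTensor E ∘ₗ δ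
  counit : (TensorProduct.lid k V).toLinearMap ∘ₗ
      (Coalgebra.counit (R := k) (A := E)).rTensor V ∘ₗ δ = LinearMap.id

/-- For `f : U → T` and `g : V → T` with values in an algebra, the map
`u ⊗ v ↦ f u * g v`. -/
def mulMap {U V T : Type*} [AddCommGroup U] [Module k U] [AddCommGroup V] [Module k V]
    [Ring T] [Algebra k T] (f : U →ₗ[k] T) (g : V →ₗ[k] T) : U ⊗[k] V →ₗ[k] T :=
  LinearMap.mul' k T ∘ₗ TensorProduct.map f g

/-- The codiagonal coaction on a tensor product of left comodules over a bialgebra,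
`v ⊗ w ↦ v⁽⁻¹⁾ w⁽⁻¹⁾ ⊗ (v⁽⁰⁾ ⊗ w⁽⁰⁾)`. -/
def tensorCoaction {A V W : Type*} [Ring A] [Algebra k A] [AddCommGroup V] [Module k V]
    [AddCommGroup W] [Module k W] (δV : V →ₗ[k] A ⊗[k] V) (δW : W →ₗ[k] A ⊗[k] W) :
    V ⊗[k] W →ₗ[k] A ⊗[k] (V ⊗[k] W) :=
  (LinearMap.mul' k A).rTensor (V ⊗[k] W) ∘ₗ
    (TensorProduct.tensorTensorTensorComm k A V A W).toLinearMap ∘ₗ TensorProduct.map δV δW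

/-- The map `v ⊗ w ↦ s(v⁽⁻¹⁾ ⊗ w⁽⁻¹⁾) w⁽⁰⁾ ⊗ v⁽⁰⁾` attached to a bilinear form `s`
on `A`. -/
def twistedSwap {A V W : Type*} [AddCommGroup A] [Module k A] [AddCommGroup V] [Module k V]
    [AddCommGroup W] [Module k W] (s : A ⊗[k] A →ₗ[k] k)
    (δV : V →ₗ[k] A ⊗[k] V) (δW : W →ₗ[k] A ⊗[k] W) : V ⊗[k] W →ₗ[k] W ⊗[k] V :=
  (TensorProduct.lid k (W ⊗[k] V)).toLinearMap ∘ₗ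
    TensorProduct.map s (TensorProduct.comm k V W).toLinearMap ∘ₗ
    (TensorProduct.tensorTensorTensorComm k A V A W).toLinearMap ∘ₗ TensorProduct.map δV δW

/-- `Id ⊗ Ψ ⊗ Id` for a map `Ψ : W ⊗ V' → V' ⊗ W`. -/
def middle {V W V' W' : Type*} [AddCommGroup V] [Module k V] [AddCommGroup W] [Module k W]
    [AddCommGroup V'] [Module k V'] [AddCommGroup W'] [Module k W']
    (Ψ : W ⊗[k] V' →ₗ[k] V' ⊗[k] W) :
    (V ⊗[k] W) ⊗[k] (V' ⊗[k] W') →ₗ[k] (V ⊗[k] V') ⊗[k] (W ⊗[k] W') :=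
  (TensorProduct.assoc k V V' (W ⊗[k] W')).symm.toLinearMap ∘ₗ
    ((TensorProduct.assoc k V' W W').toLinearMap ∘ₗ Ψ.rTensor W' ∘ₗ
      (TensorProduct.assoc k W V' W').symm.toLinearMap).lTensor V ∘ₗ
    (TensorProduct.assoc k V W (V' ⊗[k] W')).toLinearMap

/-- `ev (Id ⊗ ev ⊗ Id)`, that is `(c ⊗ c') ⊗ (b ⊗ b') ↦ ev(c' ⊗ b) ev(c ⊗ b')`. -/
def evSquare {C B : Type*} [AddCommGroup C] [Module k C] [AddCommGroup B] [Module k B]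
    (ev : C ⊗[k] B →ₗ[k] k) : (C ⊗[k] C) ⊗[k] (B ⊗[k] B) →ₗ[k] k :=
  LinearMap.mul' k k ∘ₗ TensorProduct.map ev ev ∘ₗ
    (TensorProduct.tensorTensorTensorComm k C C B B).toLinearMap ∘ₗ
    (TensorProduct.comm k B B).toLinearMap.lTensor (C ⊗[k] C)

/-- `Id ⊗ ev ⊗ Id`, that is `(c ⊗ c') ⊗ (b ⊗ d) ↦ ev(c' ⊗ b) c ⊗ d`. -/
def evMiddle {C B D : Type*} [AddCommGroup C] [Module k C] [AddCommGroup B] [Module k B]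
    [AddCommGroup D] [Module k D] (ev : C ⊗[k] B →ₗ[k] k) :
    (C ⊗[k] C) ⊗[k] (B ⊗[k] D) →ₗ[k] C ⊗[k] D :=
  ((TensorProduct.lid k D).toLinearMap ∘ₗ ev.rTensor D ∘ₗ
      (TensorProduct.assoc k C B D).symm.toLinearMap).lTensor C ∘ₗ
    (TensorProduct.assoc k C C (B ⊗[k] D)).toLinearMap

/-- A weak bialgebra pairing `ev : C ⊗ B → k`:
`ev(c c', b) = ev(c, b₂) ev(c', b₁)`, `ev(c, b b') = ev(c₁, b') ev(c₂, b)`,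
`ev(1, b) = ε(b)`, `ev(c, 1) = ε(c)`. -/
structure IsWeakPairing {C B : Type*} [Ring C] [Algebra k C] [Coalgebra k C]
    [Ring B] [Algebra k B] [Coalgebra k B] (ev : C ⊗[k] B →ₗ[k] k) : Prop where
  mul_left : ∀ (c c' : C) (b : B),
    ev ((c * c') ⊗ₜ b) = evSquare ev ((c ⊗ₜ c') ⊗ₜ Coalgebra.comul (R := k) b)
  mul_right : ∀ (c : C) (b b' : B),
    ev (c ⊗ₜ (b * b')) = evSquare ev (Coalgebra.comul (R := k) c ⊗ₜ (b ⊗ₜ b'))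
  one_left : ∀ b : B, ev (1 ⊗ₜ b) = Coalgebra.counit (R := k) b
  one_right : ∀ c : C, ev (c ⊗ₜ 1) = Coalgebra.counit (R := k) c

end Linear

/-! ## Weak quasitriangular pairs -/

/-- A weak quasitriangular pair of Hopf algebras `A`, `H`, with pairing `⟨h, a⟩ = pair (h ⊗ a)`.
The maps `Rinv` and `Rbarinv` are the convolution inverses of `R` and `Rbar` regarded as maps
`A → Hᵒᵖ`, so their products below are taken in `Hᵒᵖ`. -/
structure WeakQuasitriangularPair (k A H : Type*) [Field k] [Ring A] [HopfAlgebra k A]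
    [Ring H] [HopfAlgebra k H] where
  pair : H ⊗[k] A →ₗ[k] k
  isWeakPairing : IsWeakPairing pair
  pair_antipode : ∀ (h : H) (a : A),
    pair (HopfAlgebra.antipode k h ⊗ₜ a) = pair (h ⊗ₜ HopfAlgebra.antipode k a)
  R : A →ₗc[k] H
  R_mul : ∀ a b : A, R (a * b) = R b * R a
  R_one : R 1 = 1
  Rbar : A →ₗc[k] H
  Rbar_mul : ∀ a b : A, Rbar (a * b) = Rbar b * Rbar a
  Rbar_one : Rbar 1 = 1
  Rinv : A →ₗ[k] H
  /-- `Rinv(a₂) R(a₁) = ε(a) 1`. -/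
  Rinv_R : mulMap Rinv R.toLinearMap ∘ₗ (TensorProduct.comm k A A).toLinearMap ∘ₗ
    Coalgebra.comul = Algebra.linearMap k H ∘ₗ Coalgebra.counit
  /-- `R(a₂) Rinv(a₁) = ε(a) 1`. -/
  R_Rinv : mulMap R.toLinearMap Rinv ∘ₗ (TensorProduct.comm k A A).toLinearMap ∘ₗ
    Coalgebra.comul = Algebra.linearMap k H ∘ₗ Coalgebra.counit
  Rbarinv : A →ₗ[k] H
  /-- `Rbarinv(a₂) Rbar(a₁) = ε(a) 1`. -/
  Rbarinv_Rbar : mulMap Rbarinv Rbar.toLinearMap ∘ₗ (TensorProduct.comm k A A).toLinearMap ∘ₗ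
    Coalgebra.comul = Algebra.linearMap k H ∘ₗ Coalgebra.counit
  /-- `Rbar(a₂) Rbarinv(a₁) = ε(a) 1`. -/
  Rbar_Rbarinv : mulMap Rbar.toLinearMap Rbarinv ∘ₗ (TensorProduct.comm k A A).toLinearMap ∘ₗ
    Coalgebra.comul = Algebra.linearMap k H ∘ₗ Coalgebra.counit
  pair_Rbar : ∀ a b : A, pair (Rbar a ⊗ₜ b) = pair (Rinv b ⊗ₜ a)
  /-- `⟨h₁, a₁⟩ R(a₂) h₂ = h₁ R(a₁) ⟨h₂, a₂⟩`. -/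
  R_comm : (TensorProduct.lid k H).toLinearMap ∘ₗ
      TensorProduct.map pair
        (mulMap R.toLinearMap LinearMap.id ∘ₗ (TensorProduct.comm k H A).toLinearMap) ∘ₗ
      (TensorProduct.tensorTensorTensorComm k H H A A).toLinearMap ∘ₗ
      TensorProduct.map Coalgebra.comul Coalgebra.comul =
    (TensorProduct.rid k H).toLinearMap ∘ₗ
      TensorProduct.map (mulMap LinearMap.id R.toLinearMap) pair ∘ₗ
      (TensorProduct.tensorTensorTensorComm k H H A A).toLinearMap ∘ₗ
      TensorProduct.map Coalgebra.comul Coalgebra.comul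
  /-- `⟨h₁, a₁⟩ Rbar(a₂) h₂ = h₁ Rbar(a₁) ⟨h₂, a₂⟩`. -/
  Rbar_comm : (TensorProduct.lid k H).toLinearMap ∘ₗ
      TensorProduct.map pair
        (mulMap Rbar.toLinearMap LinearMap.id ∘ₗ (TensorProduct.comm k H A).toLinearMap) ∘ₗ
      (TensorProduct.tensorTensorTensorComm k H H A A).toLinearMap ∘ₗ
      TensorProduct.map Coalgebra.comul Coalgebra.comul =
    (TensorProduct.rid k H).toLinearMap ∘ₗ
      TensorProduct.map (mulMap LinearMap.id Rbar.toLinearMap) pair ∘ₗ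
      (TensorProduct.tensorTensorTensorComm k H H A A).toLinearMap ∘ₗ
      TensorProduct.map Coalgebra.comul Coalgebra.comul

section Pair

variable {k A H : Type*} [Field k] [Ring A] [HopfAlgebra k A] [Ring H] [HopfAlgebra k H]

namespace WeakQuasitriangularPair

/-- The braiding `Ψ(v ⊗ w) = ⟨R(w⁽⁻¹⁾), v⁽⁻¹⁾⟩ w⁽⁰⁾ ⊗ v⁽⁰⁾` of left `A`-comodules. -/
def braiding (P : WeakQuasitriangularPair k A H) {V W : Type*} [AddCommGroup V] [Module k V]
    [AddCommGroup W] [Module k W] (δV : V →ₗ[k] A ⊗[k] V) (δW : W →ₗ[k] A ⊗[k] W) :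
    V ⊗[k] W →ₗ[k] W ⊗[k] V :=
  twistedSwap (P.pair ∘ₗ P.R.toLinearMap.rTensor A ∘ₗ (TensorProduct.comm k A A).toLinearMap)
    δV δW

/-- The left action of `H` on a left `A`-comodule, `h ▷ v = ⟨h, v⁽⁻¹⁾⟩ v⁽⁰⁾`. -/
def act (P : WeakQuasitriangularPair k A H) {V : Type*} [AddCommGroup V] [Module k V]
    (δV : V →ₗ[k] A ⊗[k] V) : H ⊗[k] V →ₗ[k] V :=
  (TensorProduct.lid k V).toLinearMap ∘ₗ P.pair.rTensor V ∘ₗ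
    (TensorProduct.assoc k H A V).symm.toLinearMap ∘ₗ δV.lTensor H

/-- The inverse braiding `w ⊗ v ↦ (R⁻*(w⁽⁻¹⁾) ▷ v) ⊗ w⁽⁰⁾`. -/
def invBraiding (P : WeakQuasitriangularPair k A H) {W V : Type*} [AddCommGroup W] [Module k W]
    [AddCommGroup V] [Module k V] (δW : W →ₗ[k] A ⊗[k] W) (δV : V →ₗ[k] A ⊗[k] V) :
    W ⊗[k] V →ₗ[k] V ⊗[k] W :=
  (P.act δV).rTensor W ∘ₗ (TensorProduct.rightComm k H W V).toLinearMap ∘ₗ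
    (P.Rinv.rTensor W ∘ₗ δW).rTensor V

/-- The map `h ⊗ v ↦ (h₂ ▷ v) ⊗ h₁`. -/
def actSwap (P : WeakQuasitriangularPair k A H) {V : Type*} [AddCommGroup V] [Module k V]
    (δV : V →ₗ[k] A ⊗[k] V) : H ⊗[k] V →ₗ[k] V ⊗[k] H :=
  (TensorProduct.comm k H V).toLinearMap ∘ₗ (P.act δV).lTensor H ∘ₗ
    (TensorProduct.assoc k H H V).toLinearMap ∘ₗ
    (Coalgebra.comul (R := k) (A := H)).rTensor V

/-- For a coaction `γ` of `B` on `D`, written `d ↦ d₋₁ ⊗ d₀`, and an `A`-coaction `δD`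
on `D`, the map `d ↦ (d₋₁ ⊗ Rbar⁻*(d₀⁽⁻¹⁾)) ⊗ d₀⁽⁰⁾`. -/
def twistCoaction (P : WeakQuasitriangularPair k A H) {B D : Type*} [AddCommGroup B] [Module k B]
    [AddCommGroup D] [Module k D] (δD : D →ₗ[k] A ⊗[k] D) (γ : D →ₗ[k] B ⊗[k] D) :
    D →ₗ[k] (B ⊗[k] H) ⊗[k] D :=
  (TensorProduct.assoc k B H D).symm.toLinearMap ∘ₗ
    (P.Rbarinv.rTensor D ∘ₗ δD).lTensor B ∘ₗ γ

/-- The map `c ↦ (R⁻*(c₁⁽⁻¹⁾) ⊗ c₂) ⊗ c₁⁽⁰⁾`. -/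
def twistComul (P : WeakQuasitriangularPair k A H) {C : Type*} [AddCommGroup C] [Module k C]
    [Coalgebra k C] (δC : C →ₗ[k] A ⊗[k] C) : C →ₗ[k] (H ⊗[k] C) ⊗[k] C :=
  (TensorProduct.rightComm k H C C).toLinearMap ∘ₗ
    (P.Rinv.rTensor C ∘ₗ δC).rTensor C ∘ₗ Coalgebra.comul

end WeakQuasitriangularPair

/-! ## Algebras, bialgebras, pairings and comodule algebras in left `A`-comodules -/

/-- `D` with the map `δ` is an algebra object in left `A`-comodules. -/
structure IsComoduleAlgebra {D : Type*} [Ring D] [Algebra k D] (δ : D →ₗ[k] A ⊗[k] D) :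
    Prop where
  isLeftCoaction : IsLeftCoaction δ
  map_mul : ∀ x y : D, δ (x * y) = δ x * δ y
  map_one : δ 1 = 1

/-- `B` with the `A`-coaction `δ` is a bialgebra object in left `A`-comodules, with respect to
the braiding given by the weak quasitriangular pair. -/
structure IsBraidedBialgebra (P : WeakQuasitriangularPair k A H) {B : Type*} [Ring B]
    [Algebra k B] [Coalgebra k B] (δ : B →ₗ[k] A ⊗[k] B) : Prop where
  isComoduleAlgebra : IsComoduleAlgebra δ
  comul_colinear : (Coalgebra.comul (R := k) (A := B)).lTensor A ∘ₗ δ =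
    tensorCoaction δ δ ∘ₗ Coalgebra.comul
  counit_colinear : (Coalgebra.counit (R := k) (A := B)).lTensor A ∘ₗ δ =
    TensorProduct.mk k A k 1 ∘ₗ Coalgebra.counit
  comul_mul : Coalgebra.comul (R := k) (A := B) ∘ₗ LinearMap.mul' k B =
    TensorProduct.map (LinearMap.mul' k B) (LinearMap.mul' k B) ∘ₗ middle (P.braiding δ δ) ∘ₗ
      TensorProduct.map Coalgebra.comul Coalgebra.comul
  comul_one : Coalgebra.comul (R := k) (1 : B) = 1 ⊗ₜ 1
  counit_mul : ∀ x y : B, Coalgebra.counit (R := k) (x * y) =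
    Coalgebra.counit (R := k) x * Coalgebra.counit (R := k) y
  counit_one : Coalgebra.counit (R := k) (1 : B) = 1

/-- `ev : C ⊗ B → k` is a weak bialgebra pairing in left `A`-comodules. -/
structure IsBraidedWeakPairing {C B : Type*} [Ring C] [Algebra k C] [Coalgebra k C]
    [Ring B] [Algebra k B] [Coalgebra k B] (δC : C →ₗ[k] A ⊗[k] C) (δB : B →ₗ[k] A ⊗[k] B)
    (ev : C ⊗[k] B →ₗ[k] k) : Prop where
  isWeakPairing : IsWeakPairing ev
  colinear : ev.lTensor A ∘ₗ tensorCoaction δC δB = TensorProduct.mk k A k 1 ∘ₗ ev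

/-- `D`, with `A`-coaction `δD` and `B`-coaction `γ`, is a left `B`-comodule algebra in left
`A`-comodules. -/
structure IsBraidedComoduleAlgebra (P : WeakQuasitriangularPair k A H) {B D : Type*} [Ring B]
    [Algebra k B] [Coalgebra k B] [Ring D] [Algebra k D] (δB : B →ₗ[k] A ⊗[k] B)
    (δD : D →ₗ[k] A ⊗[k] D) (γ : D →ₗ[k] B ⊗[k] D) : Prop where
  isComoduleAlgebra : IsComoduleAlgebra δD
  isLeftCoaction : IsLeftCoaction γ
  colinear : γ.lTensor A ∘ₗ δD = tensorCoaction δB δD ∘ₗ γ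
  coaction_mul : γ ∘ₗ LinearMap.mul' k D =
    TensorProduct.map (LinearMap.mul' k B) (LinearMap.mul' k D) ∘ₗ middle (P.braiding δD δB) ∘ₗ
      TensorProduct.map γ γ
  coaction_one : γ 1 = 1 ⊗ₜ 1

end Pair

/-! ## Algebras presented by generators and relations -/

/-- The relations stating that a linear map `f` is a homomorphism of unital algebras. -/
inductive AlgRel {k U T : Type*} [Field k] [Ring U] [Algebra k U] [Ring T] [Algebra k T]
    (f : U →ₗ[k] T) : T → T → Prop
  | mul (u v : U) : AlgRel f (f (u * v)) (f u * f v)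
  | one : AlgRel f (f 1) 1

/-- The tensor algebra on `U ⊕ V ⊕ W`, with the inclusions of its three summands. -/
abbrev Free₃ (k U V W : Type*) [Field k] [AddCommGroup U] [Module k U] [AddCommGroup V]
    [Module k V] [AddCommGroup W] [Module k W] : Type _ :=
  TensorAlgebra k (U × V × W)

section Free

variable (k U V W : Type*) [Field k] [AddCommGroup U] [Module k U] [AddCommGroup V]
    [Module k V] [AddCommGroup W] [Module k W]

def gen₁ : U →ₗ[k] Free₃ k U V W := TensorAlgebra.ι k ∘ₗ LinearMap.inl k U (V × W)

def gen₂ : V →ₗ[k] Free₃ k U V W :=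
  TensorAlgebra.ι k ∘ₗ LinearMap.inr k U (V × W) ∘ₗ LinearMap.inl k V W

def gen₃ : W →ₗ[k] Free₃ k U V W :=
  TensorAlgebra.ι k ∘ₗ LinearMap.inr k U (V × W) ∘ₗ LinearMap.inr k V W

end Free

section Presented

variable {k A H B C D : Type*} [Field k] [Ring A] [HopfAlgebra k A] [Ring H] [HopfAlgebra k H]
  [Ring B] [Algebra k B] [Coalgebra k B] [Ring C] [Algebra k C] [Coalgebra k C]
  [Ring D] [Algebra k D]

/-- The map `c ⊗ d ↦ Ψ⁻¹(c₁ ⊗ d₀) ev(c₂, d₋₁) = (R⁻*(c₁⁽⁻¹⁾) ▷ d₀) ⊗ c₁⁽⁰⁾ ev(c₂, d₋₁)`, where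
`γ(d) = d₋₁ ⊗ d₀` is the coaction of `B`. -/
def crossMap (P : WeakQuasitriangularPair k A H) (δC : C →ₗ[k] A ⊗[k] C)
    (δD : D →ₗ[k] A ⊗[k] D) (γ : D →ₗ[k] B ⊗[k] D) (ev : C ⊗[k] B →ₗ[k] k) :
    C ⊗[k] D →ₗ[k] D ⊗[k] C :=
  P.invBraiding δC δD ∘ₗ evMiddle ev ∘ₗ TensorProduct.map Coalgebra.comul γ

/-- The map
`c ⊗ b ↦ f(R⁻*(c₁⁽⁻¹⁾)) e(c₂) g(b₁) f(Rbar⁻*(b₂⁽⁻¹⁾)) ev(c₁⁽⁰⁾, b₂⁽⁰⁾)`. -/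
def doubleCross (P : WeakQuasitriangularPair k A H) (δC : C →ₗ[k] A ⊗[k] C)
    (δB : B →ₗ[k] A ⊗[k] B) (ev : C ⊗[k] B →ₗ[k] k) {T : Type*} [Ring T] [Algebra k T]
    (e : C →ₗ[k] T) (f : H →ₗ[k] T) (g : B →ₗ[k] T) : C ⊗[k] B →ₗ[k] T :=
  (TensorProduct.rid k T).toLinearMap ∘ₗ
    TensorProduct.map (mulMap (mulMap f e) (mulMap g f)) ev ∘ₗ
    (TensorProduct.tensorTensorTensorComm k (H ⊗[k] C) C (B ⊗[k] H) B).toLinearMap ∘ₗ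
    TensorProduct.map (P.twistComul δC) (P.twistCoaction δB Coalgebra.comul)

variable (P : WeakQuasitriangularPair k A H) (δB : B →ₗ[k] A ⊗[k] B) (δC : C →ₗ[k] A ⊗[k] C)
  (δD : D →ₗ[k] A ⊗[k] D) (γ : D →ₗ[k] B ⊗[k] D) (ev : C ⊗[k] B →ₗ[k] k)

/-- The defining relations of the braided Drinfeld double:
`C`, `H`, `B` are mapped by algebra homomorphisms, and
`(R⁻*(c₁⁽⁻¹⁾) ▷ b₂) c₁⁽⁰⁾ ev(c₂, b₁)
  = R⁻*(c₁⁽⁻¹⁾) c₂ b₁ Rbar⁻*(b₂⁽⁻¹⁾) ev(c₁⁽⁰⁾, b₂⁽⁰⁾)`,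
`h b = (h₂ ▷ b) h₁`, `h c = (h₂ ▷ c) h₁`. -/
inductive DrinRel : Free₃ k C H B → Free₃ k C H B → Prop
  | algC {x y} : AlgRel (gen₁ k C H B) x y → DrinRel x y
  | algH {x y} : AlgRel (gen₂ k C H B) x y → DrinRel x y
  | algB {x y} : AlgRel (gen₃ k C H B) x y → DrinRel x y
  | cross (t : C ⊗[k] B) : DrinRel
      (mulMap (gen₃ k C H B) (gen₁ k C H B) (crossMap P δC δB Coalgebra.comul ev t))
      (doubleCross P δC δB ev (gen₁ k C H B) (gen₂ k C H B) (gen₃ k C H B) t)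
  | actB (t : H ⊗[k] B) : DrinRel (mulMap (gen₂ k C H B) (gen₃ k C H B) t)
      (mulMap (gen₃ k C H B) (gen₂ k C H B) (P.actSwap δB t))
  | actC (t : H ⊗[k] C) : DrinRel (mulMap (gen₂ k C H B) (gen₁ k C H B) t)
      (mulMap (gen₁ k C H B) (gen₂ k C H B) (P.actSwap δC t))

/-- The algebra underlying the braided Drinfeld double `Drin_H(C, B)`. -/
abbrev Drin : Type _ := RingQuot (DrinRel P δB δC ev)

/-- The quotient map onto `Drin`. -/
def Drin.mk : Free₃ k C H B →ₐ[k] Drin P δB δC ev :=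
  RingQuot.mkAlgHom k (DrinRel P δB δC ev)

namespace Drin

def ofC : C →ₗ[k] Drin P δB δC ev :=
  (Drin.mk P δB δC ev).toLinearMap ∘ₗ gen₁ k C H B

def ofH : H →ₗ[k] Drin P δB δC ev :=
  (Drin.mk P δB δC ev).toLinearMap ∘ₗ gen₂ k C H B

def ofB : B →ₗ[k] Drin P δB δC ev :=
  (Drin.mk P δB δC ev).toLinearMap ∘ₗ gen₃ k C H B

end Drin

/-- The defining relations of `D ⋊ ᶜᵒᵖC`: `D` and `C` are mapped by algebra homomorphisms, and
`c d = (R⁻*(c₁⁽⁻¹⁾) ▷ d₀) c₁⁽⁰⁾ ev(c₂, d₋₁)`. -/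
inductive CrossRel : TensorAlgebra k (D × C) → TensorAlgebra k (D × C) → Prop
  | algD {x y} : AlgRel (TensorAlgebra.ι k ∘ₗ LinearMap.inl k D C) x y → CrossRel x y
  | algC {x y} : AlgRel (TensorAlgebra.ι k ∘ₗ LinearMap.inr k D C) x y → CrossRel x y
  | cross (t : C ⊗[k] D) : CrossRel
      (mulMap (TensorAlgebra.ι k ∘ₗ LinearMap.inr k D C)
        (TensorAlgebra.ι k ∘ₗ LinearMap.inl k D C) t)
      (mulMap (TensorAlgebra.ι k ∘ₗ LinearMap.inl k D C)
        (TensorAlgebra.ι k ∘ₗ LinearMap.inr k D C) (crossMap P δC δD γ ev t))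

/-- The braided cross product algebra `D ⋊ ᶜᵒᵖC`. -/
abbrev Cross : Type _ := RingQuot (CrossRel P δC δD γ ev)

/-- The quotient map onto `Cross`. -/
def Cross.mk : TensorAlgebra k (D × C) →ₐ[k] Cross P δC δD γ ev :=
  RingQuot.mkAlgHom k (CrossRel P δC δD γ ev)

namespace Cross

def ofD : D →ₗ[k] Cross P δC δD γ ev :=
  (Cross.mk P δC δD γ ev).toLinearMap ∘ₗ
    TensorAlgebra.ι k ∘ₗ LinearMap.inl k D C

def ofC : C →ₗ[k] Cross P δC δD γ ev :=
  (Cross.mk P δC δD γ ev).toLinearMap ∘ₗ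
    TensorAlgebra.ι k ∘ₗ LinearMap.inr k D C

end Cross

/-- The defining relations of `D ⋊ ᶜᵒᵖC ⋊ H`: those of `D ⋊ ᶜᵒᵖC`, together with
`H` being mapped by an algebra homomorphism, `h d = (h₂ ▷ d) h₁` and `h c = (h₂ ▷ c) h₁`. -/
inductive IterCrossRel : Free₃ k D C H → Free₃ k D C H → Prop
  | algD {x y} : AlgRel (gen₁ k D C H) x y → IterCrossRel x y
  | algC {x y} : AlgRel (gen₂ k D C H) x y → IterCrossRel x y
  | algH {x y} : AlgRel (gen₃ k D C H) x y → IterCrossRel x y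
  | cross (t : C ⊗[k] D) : IterCrossRel (mulMap (gen₂ k D C H) (gen₁ k D C H) t)
      (mulMap (gen₁ k D C H) (gen₂ k D C H) (crossMap P δC δD γ ev t))
  | actD (t : H ⊗[k] D) : IterCrossRel (mulMap (gen₃ k D C H) (gen₁ k D C H) t)
      (mulMap (gen₁ k D C H) (gen₃ k D C H) (P.actSwap δD t))
  | actC (t : H ⊗[k] C) : IterCrossRel (mulMap (gen₃ k D C H) (gen₂ k D C H) t)
      (mulMap (gen₂ k D C H) (gen₃ k D C H) (P.actSwap δC t))

/-- The iterated braided cross product algebra `D ⋊ ᶜᵒᵖC ⋊ H`. -/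
abbrev IterCross : Type _ := RingQuot (IterCrossRel P δC δD γ ev)

/-- The quotient map onto `IterCross`. -/
def IterCross.mk : Free₃ k D C H →ₐ[k] IterCross P δC δD γ ev :=
  RingQuot.mkAlgHom k (IterCrossRel P δC δD γ ev)

namespace IterCross

def ofD : D →ₗ[k] IterCross P δC δD γ ev :=
  (IterCross.mk P δC δD γ ev).toLinearMap ∘ₗ gen₁ k D C H

def ofC : C →ₗ[k] IterCross P δC δD γ ev :=
  (IterCross.mk P δC δD γ ev).toLinearMap ∘ₗ gen₂ k D C H

def ofH : H →ₗ[k] IterCross P δC δD γ ev :=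
  (IterCross.mk P δC δD γ ev).toLinearMap ∘ₗ gen₃ k D C H

end IterCross

/-- A coalgebra structure on `Drin_H(C, B)` makes it a bialgebra, and it is the one prescribed
on generators: `Δ(h) = h₂ ⊗ h₁`, `Δ(b) = b₁ Rbar⁻*(b₂⁽⁻¹⁾) ⊗ b₂⁽⁰⁾`,
`Δ(c) = R⁻*(c₁⁽⁻¹⁾) c₂ ⊗ c₁⁽⁰⁾`, with the counits of `H`, `B`, `C`. -/
structure IsDrinBialgebra [Coalgebra k (Drin P δB δC ev)] : Prop where
  comul_mul : ∀ x y : Drin P δB δC ev, Coalgebra.comul (R := k) (x * y) =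
    Coalgebra.comul (R := k) x * Coalgebra.comul (R := k) y
  comul_one : Coalgebra.comul (R := k) (1 : Drin P δB δC ev) = 1
  counit_mul : ∀ x y : Drin P δB δC ev, Coalgebra.counit (R := k) (x * y) =
    Coalgebra.counit (R := k) x * Coalgebra.counit (R := k) y
  counit_one : Coalgebra.counit (R := k) (1 : Drin P δB δC ev) = 1
  comul_ofH : ∀ h : H, Coalgebra.comul (R := k) (Drin.ofH P δB δC ev h) =
    TensorProduct.map (Drin.ofH P δB δC ev) (Drin.ofH P δB δC ev)
      (TensorProduct.comm k H H (Coalgebra.comul (R := k) h))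
  comul_ofB : ∀ b : B, Coalgebra.comul (R := k) (Drin.ofB P δB δC ev b) =
    TensorProduct.map (mulMap (Drin.ofB P δB δC ev) (Drin.ofH P δB δC ev)) (Drin.ofB P δB δC ev)
      (P.twistCoaction δB Coalgebra.comul b)
  comul_ofC : ∀ c : C, Coalgebra.comul (R := k) (Drin.ofC P δB δC ev c) =
    TensorProduct.map (mulMap (Drin.ofH P δB δC ev) (Drin.ofC P δB δC ev)) (Drin.ofC P δB δC ev)
      (P.twistComul δC c)
  counit_ofH : ∀ h : H, Coalgebra.counit (R := k) (Drin.ofH P δB δC ev h) =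
    Coalgebra.counit (R := k) h
  counit_ofB : ∀ b : B, Coalgebra.counit (R := k) (Drin.ofB P δB δC ev b) =
    Coalgebra.counit (R := k) b
  counit_ofC : ∀ c : C, Coalgebra.counit (R := k) (Drin.ofC P δB δC ev c) =
    Coalgebra.counit (R := k) c

end Presented

end BraidedDouble

end

/-! All the structure maps come from three formulas that make sense with values in an arbitrary
algebra `T` receiving linear maps `e`, `f`, `g` from `C`, `H`, `B`. `comulIn` sends `c` to
`f(R⁻*(c₁⁽⁻¹⁾)) e(c₂) ⊗ c₁⁽⁰⁾` in `T ⊗ C`, `coactIn` sends `d` to `g(d₋₁) f(Rbar⁻*(d₀⁽⁻¹⁾)) ⊗ d₀⁽⁰⁾`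
in `T ⊗ D`, and `comulH` sends `h` to `f(h₂) ⊗ f'(h₁)`. For `T` the double, these are the prescribed
coproduct and coaction before the last leg is mapped to its target. For `T = k` they give the counit
axioms. For `T = End D`, with `H` acting by `▷` and `C` by `c · d = ev(c, d₋₁) d₀`, `comulIn`
encodes the cross relation: if `comulIn c = Σ u ⊗ c'`, then `c d = Σ u(d) c'` (`crossMap_tmul`). The
other side of the relation of the double is `Σ ev(c', b') t s` for `comulIn c = Σ t ⊗ c'` and
`coactIn b = Σ s ⊗ b'` (`doubleCross_tmul`).

The heart of the proof is that representations can be tensored: if `T` satisfies the relations of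
the double, and `X` those of the double or of a cross product, then `T ⊗ X` with the twisted maps
satisfies the relations of `X` (`IsDrinRep.tensor`, `IsCrossRep.tensor`, `IsIterRep.tensor`). Three
things have to be seen. Multiplicativity (`comulIn_mul`, `coactIn_mul`): the twists by `R⁻*` and
`Rbar⁻*` cancel the braiding in the braided bialgebra axiom. This uses that `R⁻* = R ∘ S` is an
algebra map reversing coproducts, likewise for `Rbar`, and that `⟨R a, b⟩ = ⟨Rbar⁻* b, a⟩`.
Commutation with `H` (`comulIn_act`, `coactIn_act`): a Yetter–Drinfeld type condition, which follows
from the commutation of `R` and `Rbar` with `H`. The cross relation (`coactIn_crossMap`): both sides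
are values of `comulIn`, one with target `End D ⊗ T`, the other with target `T ⊗ End D`. They are
compared by an intertwining condition that is closed under products, so only the factors coming from
`H` and from `C` have to be examined. The latter is `coactIn_pairEnd`, where the defining relation
of the double enters.

The coproduct, the counit and the two coactions are then the homomorphisms given by the universal
properties, and their axioms need checking on generators only. There coassociativity is
`sw_comulIn_coassoc` and `sw_coactIn_coassoc`: iterating the formula with targets `T` and `T'` is
the same formula with target `T ⊗ T'`.

For the bases, the image of the multiplication map contains `1` and is stable under left
multiplication by the generators, so it is everything. Injectivity comes from regular
representations in `End D ⊗ E`: `d` acts by left multiplication and `c` by `comulIn`, and evaluating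
the operators at `1` recovers `d ⊗ c`. That this is a representation is the twisted Leibniz rule
`pairEnd_mul`. For the triple product, `E` is itself the regular representation of `C` and `H`. -/

open scoped TensorProduct

noncomputable section

namespace BraidedDouble

set_option linter.unusedSectionVars false

/-! ## Sweedler sums -/

section Sweedler

variable {k : Type*} [Field k]

/-- Linearity of a function over `k`, as a predicate open to `fun_prop`. -/
@[fun_prop]
def Lin (k : Type*) [Field k] {V W : Type*} [AddCommGroup V] [Module k V] [AddCommGroup W]
    [Module k W] (f : V → W) : Prop := IsLinearMap k f

variable {U V W T T' : Type*} [AddCommGroup U] [Module k U] [AddCommGroup V] [Module k V]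
  [AddCommGroup W] [Module k W] [AddCommGroup T] [Module k T] [AddCommGroup T'] [Module k T']

/-- The linear map with a given underlying function. -/
def Lin.map {f : V → W} (h : Lin k f) : V →ₗ[k] W := IsLinearMap.mk' f h

@[simp] theorem Lin.map_apply {f : V → W} (h : Lin k f) (v : V) : h.map v = f v := rfl

@[fun_prop] theorem Lin.id : Lin k (fun x : V => x) := ⟨fun _ _ => rfl, fun _ _ => rfl⟩

@[fun_prop] theorem Lin.comp {g : V → W} {f : U → V} (hg : Lin k g) (hf : Lin k f) :
    Lin k (fun x => g (f x)) := (hg.map ∘ₗ hf.map).isLinear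

@[fun_prop] theorem Lin.coe (L : V →ₗ[k] W) {f : U → V} (hf : Lin k f) :
    Lin k (fun x => L (f x)) := (L ∘ₗ hf.map).isLinear

@[fun_prop] theorem Lin.coe_coalgHom [Coalgebra k V] [Coalgebra k W]
    (L : V →ₗc[k] W) {f : U → V} (hf : Lin k f) :
    Lin k (fun x => L (f x)) := (L.toLinearMap ∘ₗ hf.map).isLinear

@[fun_prop] theorem Lin.coe_algHom {R S : Type*} [Ring R] [Algebra k R] [Ring S] [Algebra k S]
    (L : R →ₐ[k] S) {f : U → R} (hf : Lin k f) :
    Lin k (fun x => L (f x)) := (L.toLinearMap ∘ₗ hf.map).isLinear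

@[fun_prop] theorem Lin.coe_left (v : V) {f : U → V →ₗ[k] W} (hf : Lin k f) :
    Lin k (fun x => f x v) := (LinearMap.applyₗ v ∘ₗ hf.map).isLinear

@[fun_prop] theorem Lin.tmul_left {f : U → V} (hf : Lin k f) (w : W) :
    Lin k (fun x => f x ⊗ₜ[k] w) := ((TensorProduct.mk k V W).flip w ∘ₗ hf.map).isLinear

@[fun_prop] theorem Lin.tmul_right {f : U → W} (hf : Lin k f) (v : V) :
    Lin k (fun x => v ⊗ₜ[k] f x) := (TensorProduct.mk k V W v ∘ₗ hf.map).isLinear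

@[fun_prop] theorem Lin.mul_left {R : Type*} [Ring R] [Algebra k R] {f : U → R} (hf : Lin k f)
    (r : R) : Lin k (fun x => f x * r) := (LinearMap.mulRight k r ∘ₗ hf.map).isLinear

@[fun_prop] theorem Lin.mul_right {R : Type*} [Ring R] [Algebra k R] {f : U → R} (hf : Lin k f)
    (r : R) : Lin k (fun x => r * f x) := (LinearMap.mulLeft k r ∘ₗ hf.map).isLinear

@[fun_prop] theorem Lin.smul_left {f : U → k} (hf : Lin k f) (v : V) :
    Lin k (fun x => f x • v) := (LinearMap.toSpanSingleton k V v ∘ₗ hf.map).isLinear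

@[fun_prop] theorem Lin.smul_right {f : U → V} (hf : Lin k f) (c : k) :
    Lin k (fun x => c • f x) := (c • hf.map).isLinear

/-- The Sweedler sum `∑ F t₁ t₂` over a chosen expression of `t` as a sum of pure tensors. -/
def sw (t : U ⊗[k] W) (F : U → W → T) : T :=
  ∑ p ∈ (TensorProduct.exists_finset t).choose, F p.1 p.2

theorem sw_tmul (t : U ⊗[k] W) : sw t (fun u w => u ⊗ₜ[k] w) = t :=
  (TensorProduct.exists_finset t).choose_spec.symm

theorem map_sw {L T T' : Type*} [AddCommGroup T] [AddCommGroup T'] [FunLike L T T']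
    [AddMonoidHomClass L T T'] (L : L) (t : U ⊗[k] W) (F : U → W → T) :
    L (sw t F) = sw t fun u w => L (F u w) := map_sum _ _ _

theorem map_eq_sw (L : U ⊗[k] W →ₗ[k] T) (t : U ⊗[k] W) :
    L t = sw t fun u w => L (u ⊗ₜ w) := by
  conv_lhs => rw [← sw_tmul t, map_sw]

theorem Lin.map_sw {L : T → T'} (hL : Lin k L) (t : U ⊗[k] W) (F : U → W → T) :
    L (sw t F) = sw t fun u w => L (F u w) := BraidedDouble.map_sw hL.map t F

/-- For bilinear `F` the chosen expression of `t` does not matter, because the sum is the value at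
`t` of the induced linear map. Without bilinearity the sum is only formal. Hence lemmas that merely
reorder or distribute sums need no hypothesis, while those that evaluate or re-expand a tensor ask
for linearity in each variable. -/
theorem sw_eq_lift (t : U ⊗[k] W) {F : U → W → T} (h₁ : ∀ w, Lin k fun u => F u w)
    (h₂ : ∀ u, Lin k fun w => F u w) :
    sw t F = TensorProduct.lift (LinearMap.mk₂ k F (fun a b w => (h₁ w).1 a b)
      (fun c a w => (h₁ w).2 c a) (fun u => (h₂ u).1) fun c u w => (h₂ u).2 c w) t := by
  rw [map_eq_sw]; rfl

theorem sw_pure (u : U) (w : W) {F : U → W → T} (h₁ : ∀ w, Lin k fun u => F u w)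
    (h₂ : ∀ u, Lin k fun w => F u w) : sw (u ⊗ₜ[k] w) F = F u w := by
  rw [sw_eq_lift _ h₁ h₂]; rfl

@[fun_prop] theorem Lin.sw_left {t : V → U ⊗[k] W} (ht : Lin k t) {F : U → W → T}
    (h₁ : ∀ w, Lin k fun u => F u w) (h₂ : ∀ u, Lin k fun w => F u w) :
    Lin k (fun x => sw (t x) F) := by
  simp_rw [sw_eq_lift _ h₁ h₂]
  fun_prop

@[fun_prop] theorem Lin.sw_right (t : U ⊗[k] W) {F : V → U → W → T}
    (hF : ∀ u w, Lin k fun v => F v u w) : Lin k (fun x => sw t (F x)) :=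
  ⟨fun x y => by simp [sw, (hF _ _).1, Finset.sum_add_distrib],
   fun c x => by simp [sw, (hF _ _).2, Finset.smul_sum]⟩

theorem sw_sw {U' W' : Type*} [AddCommGroup U'] [Module k U'] [AddCommGroup W'] [Module k W']
    (t : U' ⊗[k] W') (G : U' → W' → U ⊗[k] W) {F : U → W → T}
    (h₁ : ∀ w, Lin k fun u => F u w) (h₂ : ∀ u, Lin k fun w => F u w) :
    sw (sw t G) F = sw t fun u w => sw (G u w) F := by
  have h : Lin k (fun x : U ⊗[k] W => sw x F) := by fun_prop
  exact h.map_sw t G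

theorem sw_congr {T : Type*} [AddCommGroup T] {t : U ⊗[k] W} {F G : U → W → T} (h : ∀ u w, F u w = G u w) :
    sw t F = sw t G := by
  congr; ext; apply h

theorem sw_comm {U' W' T : Type*} [AddCommGroup T] [AddCommGroup U'] [Module k U'] [AddCommGroup W'] [Module k W']
    (t : U ⊗[k] W) (s : U' ⊗[k] W') (F : U → W → U' → W' → T) :
    (sw t fun u w => sw s fun u' w' => F u w u' w') = sw s fun u' w' => sw t fun u w =>
      F u w u' w' := Finset.sum_comm

theorem sw_mul {R : Type*} [Ring R] [Algebra k R] (t : U ⊗[k] W) (F : U → W → R) (r : R) :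
    sw t F * r = sw t fun u w => F u w * r := Finset.sum_mul _ _ _

theorem mul_sw {R : Type*} [Ring R] [Algebra k R] (t : U ⊗[k] W) (F : U → W → R) (r : R) :
    r * sw t F = sw t fun u w => r * F u w := Finset.mul_sum _ _ _

theorem sw_tmul_left (t : U ⊗[k] W) (F : U → W → T) (x : T') :
    sw t F ⊗ₜ[k] x = sw t fun u w => F u w ⊗ₜ[k] x := TensorProduct.sum_tmul _ _ _

theorem tmul_sw (t : U ⊗[k] W) (F : U → W → T) (x : T') :
    x ⊗ₜ[k] sw t F = sw t fun u w => x ⊗ₜ[k] F u w := TensorProduct.tmul_sum _ _ _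

theorem smul_sw (c : k) (t : U ⊗[k] W) (F : U → W → T) :
    c • sw t F = sw t fun u w => c • F u w := Finset.smul_sum

theorem sw_smul (t : U ⊗[k] W) (F : U → W → k) (x : T) :
    sw t F • x = sw t fun u w => F u w • x := Finset.sum_smul

end Sweedler

/-! ### Coassociativity, counitality and colinearity in Sweedler form. -/

section Coactions

open Coalgebra

variable {k : Type*} [Field k]

theorem map_tmul_eq_sw {U W U' W' T : Type*} [AddCommGroup U] [Module k U] [AddCommGroup W]
    [Module k W] [AddCommGroup U'] [Module k U'] [AddCommGroup W'] [Module k W']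
    [AddCommGroup T] [Module k T] (L : (U ⊗[k] W) ⊗[k] (U' ⊗[k] W') →ₗ[k] T)
    (s : U ⊗[k] W) (t : U' ⊗[k] W') :
    L (s ⊗ₜ t) = sw s fun u w => sw t fun u' w' => L ((u ⊗ₜ w) ⊗ₜ (u' ⊗ₜ w')) := by
  conv_lhs => rw [← sw_tmul s, ← sw_tmul t]
  simp only [sw_tmul_left, tmul_sw, map_sw]
  exact sw_comm _ _ _

/-- Lift of a trilinear function. -/
theorem exists_lift₃ {U V W T : Type*} [AddCommGroup U] [Module k U] [AddCommGroup V]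
    [Module k V] [AddCommGroup W] [Module k W] [AddCommGroup T] [Module k T]
    {F : U → V → W → T} (h₁ : ∀ v w, Lin k fun u => F u v w)
    (h₂ : ∀ u w, Lin k fun v => F u v w) (h₃ : ∀ u v, Lin k fun w => F u v w) :
    ∃ L : U ⊗[k] (V ⊗[k] W) →ₗ[k] T, ∀ u v w, L (u ⊗ₜ (v ⊗ₜ w)) = F u v w := by
  have hL : Lin k fun t : U ⊗[k] (V ⊗[k] W) => sw t fun u s => sw s fun v w => F u v w := by
    fun_prop
  refine ⟨hL.map, fun u v w => ?_⟩
  rw [Lin.map_apply, sw_pure _ _ (by fun_prop) (by fun_prop),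
    sw_pure _ _ (by fun_prop) (by fun_prop)]

variable {E V T : Type*} [AddCommGroup E] [Module k E] [Coalgebra k E]
  [AddCommGroup V] [Module k V] [AddCommGroup T] [Module k T]

namespace IsLeftCoaction

/-- Coassociativity tested against a trilinear function, which is how Sweedler calculations use it;
`exists_lift₃` turns the function into a linear map applied to both sides of the axiom. -/
theorem sw_coassoc {δ : V →ₗ[k] E ⊗[k] V} (hδ : IsLeftCoaction δ) (v : V) {F : E → E → V → T}
    (h₁ : ∀ v w, Lin k fun u => F u v w)
    (h₂ : ∀ u w, Lin k fun v => F u v w) (h₃ : ∀ u v, Lin k fun w => F u v w) :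
    (sw (δ v) fun e w => sw (comul (R := k) e) fun e₁ e₂ => F e₁ e₂ w) =
      sw (δ v) fun e w => sw (δ w) fun e' w' => F e e' w' := by
  obtain ⟨L, hL⟩ := exists_lift₃ h₁ h₂ h₃
  have := congrArg L (LinearMap.congr_fun hδ.coassoc v)
  simp only [LinearMap.comp_apply, LinearEquiv.coe_coe] at this
  rw [← sw_tmul (δ v)] at this
  simp only [map_sw, LinearMap.rTensor_tmul, LinearMap.lTensor_tmul] at this
  convert this using 3 with e e
  · ext w
    rw [← sw_tmul (comul e)]
    simp only [map_sw, sw_tmul_left, TensorProduct.assoc_tmul, hL]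
    rw [sw_tmul]
  · ext w
    rw [← sw_tmul (δ w)]
    simp only [map_sw, tmul_sw, hL]
    rw [sw_tmul]

theorem sw_counit {δ : V →ₗ[k] E ⊗[k] V} (hδ : IsLeftCoaction δ) (v : V) {F : V → T}
    (h : Lin k F) : (sw (δ v) fun e w => Coalgebra.counit (R := k) e • F w) = F v := by
  have := congrArg h.map (LinearMap.congr_fun hδ.counit v)
  simp only [LinearMap.comp_apply, LinearEquiv.coe_coe] at this
  rw [← sw_tmul (δ v)] at this
  simpa only [map_sw, LinearMap.rTensor_tmul, TensorProduct.lid_tmul, map_smul,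
    Lin.map_apply, LinearMap.id_apply] using this

end IsLeftCoaction

/-- The regular comodule, so that every statement about coactions also covers coproducts. -/
theorem isLeftCoaction_comul : IsLeftCoaction (comul (R := k) (A := E)) where
  coassoc := coassoc
  counit := by ext x; simp

theorem sw_comul_coassoc (x : E) {F : E → E → E → T} (h₁ : ∀ v w, Lin k fun u => F u v w)
    (h₂ : ∀ u w, Lin k fun v => F u v w) (h₃ : ∀ u v, Lin k fun w => F u v w) :
    (sw (comul (R := k) x) fun a b => sw (comul (R := k) a) fun a₁ a₂ => F a₁ a₂ b) =
      sw (comul (R := k) x) fun a b => sw (comul (R := k) b) fun b₁ b₂ => F a b₁ b₂ :=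
  isLeftCoaction_comul.sw_coassoc x h₁ h₂ h₃

theorem sw_counit_left (x : E) {F : E → T} (h : Lin k F) :
    (sw (comul (R := k) x) fun a b => counit (R := k) a • F b) = F x :=
  isLeftCoaction_comul.sw_counit x h

theorem sw_counit_right (x : E) {F : E → T} (h : Lin k F) :
    (sw (comul (R := k) x) fun a b => counit (R := k) b • F a) = F x := by
  have := congrArg (fun y => h.map (TensorProduct.rid k E y)) (lTensor_counit_comul (R := k) x)
  beta_reduce at this
  rw [← sw_tmul (comul x)] at this
  simpa only [map_sw, LinearMap.lTensor_tmul, TensorProduct.rid_tmul, map_smul,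
    Lin.map_apply, one_smul] using this

theorem tensorCoaction_tmul {A V W : Type*} [Ring A] [Algebra k A] [AddCommGroup V] [Module k V]
    [AddCommGroup W] [Module k W] (δV : V →ₗ[k] A ⊗[k] V) (δW : W →ₗ[k] A ⊗[k] W) (v : V)
    (w : W) : tensorCoaction δV δW (v ⊗ₜ w) =
      sw (δV v) fun a v' => sw (δW w) fun b w' => (a * b) ⊗ₜ (v' ⊗ₜ w') := by
  simp only [tensorCoaction, LinearMap.comp_apply, TensorProduct.map_tmul, LinearEquiv.coe_coe]
  rw [← LinearEquiv.coe_coe, ← LinearMap.comp_apply, map_tmul_eq_sw]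
  simp

/-- Sweedler form of the colinearity of a map `V → U ⊗ W`. -/
theorem sw_colinear {A U W : Type*} [Ring A] [Algebra k A] [AddCommGroup U] [Module k U]
    [AddCommGroup W] [Module k W] {δV : V →ₗ[k] A ⊗[k] V} {δU : U →ₗ[k] A ⊗[k] U}
    {δW : W →ₗ[k] A ⊗[k] W} {φ : V →ₗ[k] U ⊗[k] W}
    (hφ : φ.lTensor A ∘ₗ δV = tensorCoaction δU δW ∘ₗ φ) (v : V) {F : A → U → W → T}
    (h₁ : ∀ v w, Lin k fun u => F u v w)
    (h₂ : ∀ u w, Lin k fun v => F u v w) (h₃ : ∀ u v, Lin k fun w => F u v w) :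
    (sw (δV v) fun a v' => sw (φ v') fun u w => F a u w) =
      sw (φ v) fun u w => sw (δU u) fun a u' => sw (δW w) fun b w' => F (a * b) u' w' := by
  obtain ⟨L, hL⟩ := exists_lift₃ h₁ h₂ h₃
  have := congrArg L (LinearMap.congr_fun hφ v)
  simp only [LinearMap.comp_apply] at this
  rw [← sw_tmul (δV v), ← sw_tmul (φ v)] at this
  simp only [map_sw, tensorCoaction_tmul, LinearMap.lTensor_tmul, hL] at this
  rw [← this]
  refine sw_congr fun a v' => ?_
  conv_rhs => rw [← sw_tmul (φ v')]
  simp only [map_sw, tmul_sw, hL]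

end Coactions

/-! ### Convolution inverses of anti-algebra coalgebra maps into a Hopf algebra. -/

section Hopf

open Coalgebra HopfAlgebra

variable {k A H : Type*} [Field k] [Ring A] [HopfAlgebra k A] [Ring H] [HopfAlgebra k H]

theorem sw_antipode_mul (a : A) :
    (sw (comul (R := k) a) fun x y => antipode k x * y) = counit (R := k) a • 1 := by
  have := mul_antipode_rTensor_comul_apply (R := k) a
  rw [← sw_tmul (comul a)] at this
  simpa [map_sw, Algebra.algebraMap_eq_smul_one] using this

theorem sw_mul_antipode (a : A) :
    (sw (comul (R := k) a) fun x y => x * antipode k y) = counit (R := k) a • 1 := by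
  have := mul_antipode_lTensor_comul_apply (R := k) a
  rw [← sw_tmul (comul a)] at this
  simpa [map_sw, Algebra.algebraMap_eq_smul_one] using this

/-- Uniqueness of convolution inverses in `Hom(A, A ⊗ A)`: `Δ ∘ S` is a left inverse of `Δ` (`h`),
and the right-hand side is a right inverse (`g`). -/
theorem comul_antipode (a : A) : comul (R := k) (antipode k a) =
    sw (comul (R := k) a) fun x y => antipode k y ⊗ₜ antipode k x := by
  have h (a : A) : (sw (comul (R := k) a) fun x y => comul (R := k) (antipode k x) *
      comul (R := k) y) = counit (R := k) a • 1 := by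
    simp only [← Bialgebra.comul_mul, ← map_sw, sw_antipode_mul, map_smul, Bialgebra.comul_one]
  have g (a : A) : (sw (comul (R := k) a) fun x y => comul (R := k) x *
      (sw (comul (R := k) y) fun u v => antipode k v ⊗ₜ antipode k u)) =
      counit (R := k) a • 1 := by
    calc _ = sw (comul (R := k) a) fun x y => sw (comul (R := k) x) fun x₁ x₂ =>
          sw (comul (R := k) y) fun u v => (x₁ * antipode k v) ⊗ₜ[k] (x₂ * antipode k u) := by
          refine sw_congr fun x y => ?_
          conv_lhs => rw [← sw_tmul (comul x)]
          simp only [sw_mul, mul_sw, Algebra.TensorProduct.tmul_mul_tmul]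
          exact sw_comm _ _ _
      _ = sw (comul (R := k) a) fun x₁ b => sw (comul (R := k) b) fun x₂ y =>
          sw (comul (R := k) y) fun u v => (x₁ * antipode k v) ⊗ₜ[k] (x₂ * antipode k u) := by
          rw [sw_comul_coassoc a (by fun_prop) (by fun_prop) (by fun_prop)]
      _ = sw (comul (R := k) a) fun x₁ b => sw (comul (R := k) b) fun c v =>
          sw (comul (R := k) c) fun x₂ u => (x₁ * antipode k v) ⊗ₜ[k] (x₂ * antipode k u) := by
          refine sw_congr fun x₁ b => ?_
          rw [sw_comul_coassoc b (by fun_prop) (by fun_prop) (by fun_prop)]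
      _ = sw (comul (R := k) a) fun x₁ v => (x₁ * antipode k v) ⊗ₜ[k] 1 := by
          refine sw_congr fun x₁ b => ?_
          simp only [← tmul_sw, sw_mul_antipode, TensorProduct.tmul_smul]
          rw [sw_counit_left b (by fun_prop)]
      _ = _ := by
          rw [← sw_tmul_left, sw_mul_antipode, ← TensorProduct.smul_tmul',
            Algebra.TensorProduct.one_def]
  calc comul (R := k) (antipode k a)
      = sw (comul (R := k) a) fun x y => counit (R := k) y • comul (R := k) (antipode k x) := by
        rw [sw_counit_right a (by fun_prop)]
    _ = sw (comul (R := k) a) fun x y => sw (comul (R := k) y) fun u v =>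
          comul (R := k) (antipode k x) * (comul (R := k) u *
            (sw (comul (R := k) v) fun u v => antipode k v ⊗ₜ antipode k u)) := by
        simp only [← mul_sw, g, mul_smul_comm, mul_one]
    _ = sw (comul (R := k) a) fun x v => counit (R := k) x •
            (sw (comul (R := k) v) fun u v => antipode k v ⊗ₜ antipode k u) := by
        rw [← sw_comul_coassoc a (by fun_prop) (by fun_prop) (by fun_prop)]
        simp only [← mul_assoc, ← sw_mul, h, smul_mul_assoc, one_mul]
    _ = _ := sw_counit_left a (by fun_prop)

/-- A bilinear form `⟨h, a⟩`, an anti-algebra and coalgebra map `R : A → H`, and its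
convolution inverse as a map `A → Hᵒᵖ`, satisfying `⟨h₁, a₁⟩ R(a₂) h₂ = h₁ R(a₁) ⟨h₂, a₂⟩`. -/
structure IsRMap (pair : H ⊗[k] A →ₗ[k] k) (R : A →ₗc[k] H) (Rinv : A →ₗ[k] H) : Prop where
  mul : ∀ a b : A, R (a * b) = R b * R a
  one : R 1 = 1
  inv_mul : ∀ a : A, (sw (comul (R := k) a) fun x y => Rinv y * R x) = counit (R := k) a • 1
  mul_inv : ∀ a : A, (sw (comul (R := k) a) fun x y => R y * Rinv x) = counit (R := k) a • 1
  comm : ∀ (h : H) (a : A), (sw (comul (R := k) h) fun h₁ h₂ => sw (comul (R := k) a) fun a₁ a₂ =>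
      pair (h₁ ⊗ₜ a₁) • (R a₂ * h₂)) =
    sw (comul (R := k) h) fun h₁ h₂ => sw (comul (R := k) a) fun a₁ a₂ =>
      pair (h₂ ⊗ₜ a₂) • (h₁ * R a₁)

namespace IsRMap

variable {pair : H ⊗[k] A →ₗ[k] k} {R : A →ₗc[k] H} {Rinv : A →ₗ[k] H}

/-- Since `R` reverses products and respects coproducts, `R ∘ S` is also a convolution inverse of
`R` in `Hom(A, Hᵒᵖ)`. Everything below about `Rinv` follows: it is multiplicative because two
reversals compose, and it reverses coproducts because `S` does. -/
theorem inv_eq (h : IsRMap pair R Rinv) (a : A) : Rinv a = R (antipode k a) := by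
  symm
  calc R (antipode k a)
      = sw (comul (R := k) a) fun x y => counit (R := k) y • R (antipode k x) := by
        rw [sw_counit_right a (by fun_prop)]
    _ = sw (comul (R := k) a) fun x y => sw (comul (R := k) y) fun u v =>
          Rinv v * (R u * R (antipode k x)) := by
        simp only [← mul_assoc, ← sw_mul, h.inv_mul, smul_mul_assoc, one_mul]
    _ = sw (comul (R := k) a) fun x v => sw (comul (R := k) x) fun x u =>
          Rinv v * R (antipode k x * u) := by
        rw [← sw_comul_coassoc a (by fun_prop) (by fun_prop) (by fun_prop)]
        simp only [h.mul]
    _ = sw (comul (R := k) a) fun x v => counit (R := k) x • Rinv v := by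
        simp only [← mul_sw, ← map_sw, sw_antipode_mul, map_smul, h.one, mul_smul_comm, mul_one]
    _ = Rinv a := sw_counit_left a (by fun_prop)

theorem inv_map_mul (h : IsRMap pair R Rinv) (a b : A) : Rinv (a * b) = Rinv a * Rinv b := by
  simp only [h.inv_eq, antipode_mul_antidistrib, h.mul]

theorem inv_map_one (h : IsRMap pair R Rinv) : Rinv 1 = 1 := by
  simp only [h.inv_eq, antipode_one, h.one]

theorem counit_inv (h : IsRMap pair R Rinv) (a : A) :
    counit (R := k) (Rinv a) = counit (R := k) a := by
  simp only [h.inv_eq, CoalgHomClass.counit_comp_apply, counit_antipode]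

theorem comul_inv (h : IsRMap pair R Rinv) (a : A) : comul (R := k) (Rinv a) =
    sw (comul (R := k) a) fun x y => Rinv y ⊗ₜ Rinv x := by
  simp only [h.inv_eq, ← CoalgHomClass.map_comp_comul_apply, comul_antipode, map_sw,
    TensorProduct.map_tmul, LinearMap.coe_coe]

theorem sw_comul_inv {T : Type*} [AddCommGroup T] [Module k T] (h : IsRMap pair R Rinv) (a : A)
    {F : H → H → T} (h₁ : ∀ y, Lin k fun x => F x y) (h₂ : ∀ x, Lin k fun y => F x y) :
    sw (comul (R := k) (Rinv a)) F = sw (comul (R := k) a) fun x y => F (Rinv y) (Rinv x) := by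
  rw [h.comul_inv, sw_sw _ _ h₁ h₂]
  exact sw_congr fun x y => sw_pure _ _ h₁ h₂

/-- Both sides are convolution inverses of `Rinv` in `Hom(A, Hᵒᵖ)`: `R` by hypothesis, and `S ∘
Rinv` because `Rinv` reverses coproducts. No invertibility of the antipodes is involved. -/
theorem antipode_inv (h : IsRMap pair R Rinv) (a : A) : antipode k (Rinv a) = R a := by
  have key (a : A) : (sw (comul (R := k) a) fun x y => antipode k (Rinv y) * Rinv x) =
      counit (R := k) a • 1 := by
    rw [← h.counit_inv, ← sw_antipode_mul, h.sw_comul_inv a (by fun_prop) (by fun_prop)]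
  calc antipode k (Rinv a)
      = sw (comul (R := k) a) fun x y => counit (R := k) x • antipode k (Rinv y) := by
        rw [sw_counit_left a (by fun_prop)]
    _ = sw (comul (R := k) a) fun x y => sw (comul (R := k) x) fun u v =>
          (antipode k (Rinv y) * Rinv v) * R u := by
        simp only [mul_assoc, ← mul_sw, h.inv_mul, mul_smul_comm, mul_one]
    _ = sw (comul (R := k) a) fun x y => counit (R := k) y • R x := by
        rw [sw_comul_coassoc a (by fun_prop) (by fun_prop) (by fun_prop)]
        simp only [← sw_mul, key, smul_mul_assoc, one_mul]
    _ = R a := sw_counit_right a (by fun_prop)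

/-- `h₂ R⁻*(a₁) ⟨h₁, a₂⟩ = R⁻*(a₂) h₁ ⟨h₂, a₁⟩`. -/
theorem inv_comm (h : IsRMap pair R Rinv) (x : H) (a : A) :
    (sw (comul (R := k) x) fun x₁ x₂ => sw (comul (R := k) a) fun a₁ a₂ =>
      pair (x₁ ⊗ₜ a₂) • (x₂ * Rinv a₁)) =
    sw (comul (R := k) x) fun x₁ x₂ => sw (comul (R := k) a) fun a₁ a₂ =>
      pair (x₂ ⊗ₜ a₁) • (Rinv a₂ * x₁) := by
  symm
  -- The commutation relation is conjugated by `Rinv`. A counit is inserted on the right and written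
  -- as `R c₂ * Rinv c₁`, which produces the side `x₁ * R c₂` of `comm`; after `comm` is applied,
  -- `Rinv e₂ * R e₁` cancels on the left.
  calc (sw (comul (R := k) x) fun x₁ x₂ => sw (comul (R := k) a) fun a₁ a₂ =>
      pair (x₂ ⊗ₜ a₁) • (Rinv a₂ * x₁)) =
      sw (comul (R := k) a) fun a₁ a₂ => sw (comul (R := k) a₁) fun c d =>
        sw (comul (R := k) x) fun x₁ x₂ => counit (R := k) c • (pair (x₂ ⊗ₜ d) • (Rinv a₂ * x₁)) := by
        rw [sw_comm]
        refine sw_congr fun a₁ a₂ => ?_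
        simp only [← smul_sw]
        rw [sw_counit_left a₁ (by fun_prop)]
    _ = sw (comul (R := k) a) fun a₁ a₂ => sw (comul (R := k) a₁) fun c d =>
        sw (comul (R := k) c) fun c₁ c₂ => Rinv a₂ * (sw (comul (R := k) x) fun x₁ x₂ =>
        pair (x₂ ⊗ₜ d) • (x₁ * R c₂)) * Rinv c₁ := by
        refine sw_congr fun a₁ a₂ => sw_congr fun c d => ?_
        simp only [mul_sw, sw_mul]
        rw [sw_comm]
        refine sw_congr fun x₁ x₂ => ?_
        simp only [mul_smul_comm, smul_mul_assoc, mul_assoc, ← mul_sw, ← smul_sw, h.mul_inv,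
          mul_one]
        exact smul_comm _ _ _
    _ = sw (comul (R := k) a) fun a₁ a₂ => sw (comul (R := k) a₁) fun c d =>
        Rinv a₂ * (sw (comul (R := k) x) fun x₁ x₂ => sw (comul (R := k) d) fun d₁ d₂ =>
        (pair (x₁ ⊗ₜ d₁) • (R d₂ * x₂))) * Rinv c := by
        refine sw_congr fun a₁ a₂ => ?_
        rw [sw_comul_coassoc a₁ (by fun_prop) (by fun_prop) (by fun_prop)]
        simp only [← mul_sw, ← sw_mul, h.comm]
        refine sw_congr fun c d => ?_
        rw [sw_comm]
    _ = sw (comul (R := k) a) fun c b => sw (comul (R := k) b) fun d e =>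
        sw (comul (R := k) e) fun e₁ e₂ => sw (comul (R := k) x) fun x₁ x₂ =>
        pair (x₁ ⊗ₜ d) • ((Rinv e₂ * R e₁) * x₂ * Rinv c) := by
        rw [sw_comul_coassoc a (by fun_prop) (by fun_prop) (by fun_prop)]
        refine sw_congr fun c b => ?_
        rw [← sw_comul_coassoc b (by fun_prop) (by fun_prop) (by fun_prop)]
        refine sw_congr fun d e => ?_
        simp only [mul_sw, sw_mul, mul_smul_comm, smul_mul_assoc, mul_assoc]
        rw [sw_comm]
    _ = sw (comul (R := k) a) fun c b => sw (comul (R := k) b) fun d e =>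
        counit (R := k) e • sw (comul (R := k) x) fun x₁ x₂ =>
        pair (x₁ ⊗ₜ d) • (x₂ * Rinv c) := by
        refine sw_congr fun c b => sw_congr fun d e => ?_
        rw [sw_comm, smul_sw]
        refine sw_congr fun x₁ x₂ => ?_
        simp only [← smul_sw, ← sw_mul, h.inv_mul, smul_mul_assoc, one_mul]
        exact smul_comm _ _ _
    _ = _ := by
        rw [sw_comm]
        refine sw_congr fun c b => ?_
        rw [sw_counit_right b (by fun_prop)]

end IsRMap

end Hopf

/-! ### Pairings and the axioms of a weak quasitriangular pair in Sweedler form. -/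

section Pairings

open Coalgebra

variable {k : Type*} [Field k]

theorem mulMap_tmul {U V T : Type*} [AddCommGroup U] [Module k U] [AddCommGroup V] [Module k V]
    [Ring T] [Algebra k T] (f : U →ₗ[k] T) (g : V →ₗ[k] T) (u : U) (v : V) :
    mulMap f g (u ⊗ₜ v) = f u * g v := by
  simp [mulMap]

namespace IsWeakPairing

variable {C B : Type*} [Ring C] [Algebra k C] [Coalgebra k C] [Ring B] [Algebra k B]
  [Coalgebra k B] {ev : C ⊗[k] B →ₗ[k] k}

theorem mul_left_eq (h : IsWeakPairing ev) (c c' : C) (b : B) : ev ((c * c') ⊗ₜ b) =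
    sw (comul (R := k) b) fun b₁ b₂ => ev (c' ⊗ₜ b₁) * ev (c ⊗ₜ b₂) := by
  rw [h.mul_left, ← sw_tmul (comul b)]
  simp only [tmul_sw, map_sw]
  rw [sw_tmul]
  refine sw_congr fun b₁ b₂ => ?_
  simp [evSquare, mul_comm]

theorem mul_right_eq (h : IsWeakPairing ev) (c : C) (b b' : B) : ev (c ⊗ₜ (b * b')) =
    sw (comul (R := k) c) fun c₁ c₂ => ev (c₁ ⊗ₜ b') * ev (c₂ ⊗ₜ b) := by
  rw [h.mul_right, ← sw_tmul (comul c)]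
  simp only [sw_tmul_left, map_sw]
  rw [sw_tmul]
  refine sw_congr fun b₁ b₂ => ?_
  simp [evSquare]

end IsWeakPairing

variable {A H : Type*} [Ring A] [HopfAlgebra k A] [Ring H] [HopfAlgebra k H]

theorem isRMap_of_eq {pair : H ⊗[k] A →ₗ[k] k} {R : A →ₗc[k] H} {Rinv : A →ₗ[k] H}
    (mul : ∀ a b : A, R (a * b) = R b * R a) (one : R 1 = 1)
    (inv_mul : mulMap Rinv R.toLinearMap ∘ₗ (TensorProduct.comm k A A).toLinearMap ∘ₗ
      comul = Algebra.linearMap k H ∘ₗ counit)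
    (mul_inv : mulMap R.toLinearMap Rinv ∘ₗ (TensorProduct.comm k A A).toLinearMap ∘ₗ
      comul = Algebra.linearMap k H ∘ₗ counit)
    (comm : (TensorProduct.lid k H).toLinearMap ∘ₗ
      TensorProduct.map pair
        (mulMap R.toLinearMap LinearMap.id ∘ₗ (TensorProduct.comm k H A).toLinearMap) ∘ₗ
      (TensorProduct.tensorTensorTensorComm k H H A A).toLinearMap ∘ₗ
      TensorProduct.map comul comul =
    (TensorProduct.rid k H).toLinearMap ∘ₗ
      TensorProduct.map (mulMap LinearMap.id R.toLinearMap) pair ∘ₗ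
      (TensorProduct.tensorTensorTensorComm k H H A A).toLinearMap ∘ₗ
      TensorProduct.map comul comul) : IsRMap pair R Rinv where
  mul := mul
  one := one
  inv_mul a := by
    have := LinearMap.congr_fun inv_mul a
    simp only [LinearMap.comp_apply] at this
    rw [← sw_tmul (comul a)] at this
    simpa [map_sw, mulMap_tmul, Algebra.algebraMap_eq_smul_one] using this
  mul_inv a := by
    have := LinearMap.congr_fun mul_inv a
    simp only [LinearMap.comp_apply] at this
    rw [← sw_tmul (comul a)] at this
    simpa [map_sw, mulMap_tmul, Algebra.algebraMap_eq_smul_one] using this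
  comm h a := by
    have := LinearMap.congr_fun comm (h ⊗ₜ a)
    simp only [LinearMap.comp_apply, TensorProduct.map_tmul] at this
    rw [← sw_tmul (comul h), ← sw_tmul (comul a)] at this
    simp only [sw_tmul_left, tmul_sw, map_sw] at this
    rw [sw_comm (comul h), sw_comm (comul h)]
    simpa [mulMap_tmul] using this

end Pairings

theorem sw_mul_of_bilinear {k R S T : Type*} [Field k] [Ring R] [Algebra k R] [Ring S]
    [Algebra k S] [AddCommGroup T] [Module k T] (s t : R ⊗[k] S) {F : R → S → T}
    (h₁ : ∀ w, Lin k fun a => F a w) (h₂ : ∀ a, Lin k fun w => F a w) :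
    sw (s * t) F = sw s fun a x => sw t fun b y => F (a * b) (x * y) := by
  conv_lhs => rw [← sw_tmul s, ← sw_tmul t]
  simp only [sw_mul, mul_sw, Algebra.TensorProduct.tmul_mul_tmul]
  rw [sw_sw _ _ h₁ h₂, sw_comm]
  refine sw_congr fun a x => ?_
  rw [sw_sw _ _ h₁ h₂]
  exact sw_congr fun b y => sw_pure _ _ h₁ h₂

/-! ### The action of `H` on `A`-comodules and the braiding. -/

namespace WeakQuasitriangularPair

open Coalgebra HopfAlgebra

variable {k A H : Type*} [Field k] [Ring A] [HopfAlgebra k A] [Ring H] [HopfAlgebra k H]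
  (P : WeakQuasitriangularPair k A H)

theorem isRMap : IsRMap P.pair P.R P.Rinv :=
  isRMap_of_eq P.R_mul P.R_one P.Rinv_R P.R_Rinv P.R_comm

theorem isRMap_bar : IsRMap P.pair P.Rbar P.Rbarinv :=
  isRMap_of_eq P.Rbar_mul P.Rbar_one P.Rbarinv_Rbar P.Rbar_Rbarinv P.Rbar_comm

/-- The companion of `pair_Rbar` with the roles of `R` and `Rbar` exchanged: `⟨Rbar⁻* b, a⟩ =
⟨Rbar(S b), a⟩ = ⟨R⁻* a, S b⟩ = ⟨S(R⁻* a), b⟩`, and `S ∘ R⁻* = R`. -/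
theorem pair_R (a b : A) : P.pair (P.R a ⊗ₜ b) = P.pair (P.Rbarinv b ⊗ₜ a) := by
  rw [P.isRMap_bar.inv_eq, P.pair_Rbar, ← P.pair_antipode, P.isRMap.antipode_inv]

section Formulas

variable {U V W : Type*} [AddCommGroup U] [Module k U] [AddCommGroup V] [Module k V]
  [AddCommGroup W] [Module k W] (δU : U →ₗ[k] A ⊗[k] U) (δV : V →ₗ[k] A ⊗[k] V)
  (δW : W →ₗ[k] A ⊗[k] W)

theorem act_tmul (h : H) (v : V) :
    P.act δV (h ⊗ₜ v) = sw (δV v) fun a w => P.pair (h ⊗ₜ a) • w := by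
  simp only [act, LinearMap.comp_apply, LinearMap.lTensor_tmul]
  rw [← sw_tmul (δV v)]
  simp only [tmul_sw, map_sw]
  rw [sw_tmul]
  simp

theorem braiding_tmul (v : V) (w : W) : P.braiding δV δW (v ⊗ₜ w) =
    sw (δV v) fun a v' => sw (δW w) fun b w' => P.pair (P.R b ⊗ₜ a) • (w' ⊗ₜ v') := by
  simp only [braiding, twistedSwap, LinearMap.comp_apply, TensorProduct.map_tmul]
  rw [← sw_tmul (δV v), ← sw_tmul (δW w)]
  simp only [tmul_sw, sw_tmul_left, map_sw]
  rw [sw_tmul, sw_tmul, sw_comm]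
  simp

theorem invBraiding_tmul (w : W) (v : V) : P.invBraiding δW δV (w ⊗ₜ v) =
    sw (δW w) fun a w' => P.act δV (P.Rinv a ⊗ₜ v) ⊗ₜ w' := by
  simp only [invBraiding, LinearMap.comp_apply, LinearMap.rTensor_tmul]
  rw [← sw_tmul (δW w)]
  simp only [sw_tmul_left, map_sw]
  rw [sw_tmul]
  simp

theorem actSwap_tmul (h : H) (v : V) : P.actSwap δV (h ⊗ₜ v) =
    sw (comul (R := k) h) fun h₁ h₂ => P.act δV (h₂ ⊗ₜ v) ⊗ₜ h₁ := by
  simp only [actSwap, LinearMap.comp_apply, LinearMap.rTensor_tmul]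
  rw [← sw_tmul (comul h)]
  simp only [sw_tmul_left, map_sw]
  rw [sw_tmul]
  simp

theorem twistCoaction_apply {B D : Type*} [AddCommGroup B] [Module k B] [AddCommGroup D]
    [Module k D] (δD : D →ₗ[k] A ⊗[k] D) (γ : D →ₗ[k] B ⊗[k] D) (d : D) :
    P.twistCoaction δD γ d = sw (γ d) fun b d' => sw (δD d') fun a d'' =>
      (b ⊗ₜ P.Rbarinv a) ⊗ₜ d'' := by
  simp only [twistCoaction, LinearMap.comp_apply]
  rw [← sw_tmul (γ d)]
  simp only [map_sw]
  rw [sw_tmul]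
  refine sw_congr fun b d' => ?_
  simp only [LinearMap.lTensor_tmul, LinearMap.comp_apply]
  rw [← sw_tmul (δD d')]
  simp only [tmul_sw, map_sw]
  rw [sw_tmul]
  simp

theorem twistComul_apply {C : Type*} [AddCommGroup C] [Module k C] [Coalgebra k C]
    (δC : C →ₗ[k] A ⊗[k] C) (c : C) :
    P.twistComul δC c = sw (comul (R := k) c) fun c₁ c₂ => sw (δC c₁) fun a c' =>
      (P.Rinv a ⊗ₜ c₂) ⊗ₜ c' := by
  simp only [twistComul, LinearMap.comp_apply]
  rw [← sw_tmul (comul c)]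
  simp only [map_sw]
  rw [sw_tmul]
  refine sw_congr fun c₁ c₂ => ?_
  simp only [LinearMap.rTensor_tmul, LinearMap.comp_apply]
  rw [← sw_tmul (δC c₁)]
  simp only [sw_tmul_left, map_sw]
  rw [sw_tmul]
  simp

end Formulas

section Action

variable {U V W T : Type*} [AddCommGroup U] [Module k U] [AddCommGroup V] [Module k V]
  [AddCommGroup W] [Module k W] [AddCommGroup T] [Module k T]
  {δU : U →ₗ[k] A ⊗[k] U} {δV : V →ₗ[k] A ⊗[k] V} {δW : W →ₗ[k] A ⊗[k] W}

/-- The coaction on `h ▷ v`. -/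
theorem sw_coaction_act (hδ : IsLeftCoaction δV) (h : H) (v : V) {F : A → V → T}
    (h₁ : ∀ w, Lin k fun a => F a w) (h₂ : ∀ a, Lin k fun w => F a w) :
    sw (δV (P.act δV (h ⊗ₜ v))) F =
      sw (δV v) fun a w => sw (comul (R := k) a) fun a₁ a₂ => P.pair (h ⊗ₜ a₁) • F a₂ w := by
  rw [hδ.sw_coassoc v (by fun_prop) (by fun_prop) (by fun_prop), act_tmul]
  simp only [map_sw, map_smul, ← smul_sw]
  rw [sw_sw _ _ h₁ h₂]
  refine sw_congr fun a w => ?_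
  have h : Lin k (fun x : A ⊗[k] V => sw x F) := by fun_prop
  exact h.2 _ _

/-- The coaction on `h' ▷ v` leaves the second leg of `v⁽⁻¹⁾` for `h`, which is the order prescribed
by `⟨h h', a⟩ = ⟨h, a₂⟩⟨h', a₁⟩`. This makes `▷` a left action. -/
theorem act_mul (hδ : IsLeftCoaction δV) (h h' : H) (v : V) :
    P.act δV ((h * h') ⊗ₜ v) = P.act δV (h ⊗ₜ P.act δV (h' ⊗ₜ v)) := by
  rw [act_tmul _ _ h (P.act _ _), sw_coaction_act _ hδ _ _ (by fun_prop) (by fun_prop), act_tmul]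
  simp only [P.isWeakPairing.mul_left_eq, sw_smul, mul_smul]

theorem act_one (hδ : IsLeftCoaction δV) (v : V) : P.act δV (1 ⊗ₜ v) = v := by
  simp only [act_tmul, P.isWeakPairing.one_left]
  exact hδ.sw_counit v Lin.id

/-- Colinear maps are linear over `H`. -/
theorem map_act {φ : V →ₗ[k] U ⊗[k] W}
    (hφ : φ.lTensor A ∘ₗ δV = tensorCoaction δU δW ∘ₗ φ) (h : H) (v : V) :
    φ (P.act δV (h ⊗ₜ v)) = sw (comul (R := k) h) fun h₁ h₂ => sw (φ v) fun u w =>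
      P.act δU (h₂ ⊗ₜ u) ⊗ₜ P.act δW (h₁ ⊗ₜ w) := by
  have := sw_colinear hφ v (F := fun a u w => P.pair (h ⊗ₜ a) • (u ⊗ₜ[k] w)) (by fun_prop)
    (by fun_prop) (by fun_prop)
  simp only [← smul_sw, sw_tmul] at this
  rw [act_tmul, map_sw]
  simp only [map_smul, this, act_tmul, P.isWeakPairing.mul_right_eq]
  rw [sw_comm (comul h)]
  refine sw_congr fun u w => ?_
  simp only [sw_tmul_left, tmul_sw, TensorProduct.tmul_smul, sw_smul]
  rw [sw_comm (δU u), sw_comm (comul h)]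
  refine sw_congr fun b w' => ?_
  rw [sw_comm (δU u)]
  simp only [smul_sw, TensorProduct.smul_tmul', smul_smul]

/-- The pairing reverses products in its second variable, so `H` acts on products through the
opposite coproduct. This is why `H` enters the double with `Δ(h) = h₂ ⊗ h₁`. -/
theorem act_mul_right {D : Type*} [Ring D] [Algebra k D] {δD : D →ₗ[k] A ⊗[k] D}
    (hD : IsComoduleAlgebra δD) (h : H) (x y : D) : P.act δD (h ⊗ₜ (x * y)) =
      sw (comul (R := k) h) fun h₁ h₂ => P.act δD (h₂ ⊗ₜ x) * P.act δD (h₁ ⊗ₜ y) := by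
  simp only [act_tmul, hD.map_mul]
  rw [sw_mul_of_bilinear _ _ (by fun_prop) (by fun_prop)]
  simp only [P.isWeakPairing.mul_right_eq, sw_mul, mul_sw, sw_smul, smul_mul_smul_comm]
  rw [sw_comm (comul h), sw_comm (δD x)]
  refine sw_congr fun b w' => ?_
  rw [sw_comm (δD x)]
  simp only [mul_comm]

theorem act_one_right {D : Type*} [Ring D] [Algebra k D] {δD : D →ₗ[k] A ⊗[k] D}
    (hD : IsComoduleAlgebra δD) (h : H) : P.act δD (h ⊗ₜ 1) = counit (R := k) h • 1 := by
  rw [act_tmul, hD.map_one, Algebra.TensorProduct.one_def,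
    sw_pure _ _ (by fun_prop) (by fun_prop), P.isWeakPairing.one_right]

end Action

end WeakQuasitriangularPair

/-! ### The twisted coproduct and coaction with values in an arbitrary algebra, and their
multiplicativity. -/

section Twisted

open Coalgebra HopfAlgebra

variable {k A H : Type*} [Field k] [Ring A] [HopfAlgebra k A] [Ring H] [HopfAlgebra k H]

/-- A linear map which is a homomorphism of unital algebras. -/
structure IsAlgMap {U T : Type*} [Ring U] [Algebra k U] [Ring T] [Algebra k T]
    (f : U →ₗ[k] T) : Prop where
  map_mul : ∀ u v, f (u * v) = f u * f v
  map_one : f 1 = 1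

namespace WeakQuasitriangularPair

variable (P : WeakQuasitriangularPair k A H)

/-- The relation `f(h) g(v) = g(h₂ ▷ v) f(h₁)`. -/
def Commutes {V T : Type*} [AddCommGroup V] [Module k V] [Ring T] [Algebra k T]
    (δV : V →ₗ[k] A ⊗[k] V) (f : H →ₗ[k] T) (g : V →ₗ[k] T) : Prop :=
  ∀ h v, f h * g v = sw (comul (R := k) h) fun h₁ h₂ => g (P.act δV (h₂ ⊗ₜ v)) * f h₁

theorem middle_tmul {V W V' W' : Type*} [AddCommGroup V] [Module k V] [AddCommGroup W] [Module k W]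
    [AddCommGroup V'] [Module k V'] [AddCommGroup W'] [Module k W']
    (Ψ : W ⊗[k] V' →ₗ[k] V' ⊗[k] W) (v : V) (w : W) (v' : V') (w' : W') :
    middle Ψ ((v ⊗ₜ w) ⊗ₜ (v' ⊗ₜ w')) = sw (Ψ (w ⊗ₜ v')) fun x y => (v ⊗ₜ x) ⊗ₜ (y ⊗ₜ w') := by
  simp only [middle, LinearMap.comp_apply, LinearEquiv.coe_coe, TensorProduct.assoc_tmul,
    LinearMap.lTensor_tmul, TensorProduct.assoc_symm_tmul, LinearMap.rTensor_tmul]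
  conv_lhs => rw [← sw_tmul (Ψ _)]
  simp only [sw_tmul_left, map_sw, tmul_sw, TensorProduct.assoc_tmul,
    TensorProduct.assoc_symm_tmul]

theorem sw_map_act {U V W T : Type*} [AddCommGroup U] [Module k U] [AddCommGroup V] [Module k V]
    [AddCommGroup W] [Module k W] [AddCommGroup T] [Module k T]
    {δU : U →ₗ[k] A ⊗[k] U} {δV : V →ₗ[k] A ⊗[k] V} {δW : W →ₗ[k] A ⊗[k] W}
    {φ : V →ₗ[k] U ⊗[k] W} (hφ : φ.lTensor A ∘ₗ δV = tensorCoaction δU δW ∘ₗ φ) (h : H) (v : V)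
    {F : U → W → T} (h₁ : ∀ w, Lin k fun u => F u w) (h₂ : ∀ u, Lin k fun w => F u w) :
    sw (φ (P.act δV (h ⊗ₜ v))) F = sw (comul (R := k) h) fun h₁ h₂ => sw (φ v) fun u w =>
      F (P.act δU (h₂ ⊗ₜ u)) (P.act δW (h₁ ⊗ₜ w)) := by
  rw [P.map_act hφ, sw_sw _ _ h₁ h₂]
  refine sw_congr fun x y => ?_
  rw [sw_sw _ _ h₁ h₂]
  exact sw_congr fun u w => sw_pure _ _ h₁ h₂

theorem sw_act {V T : Type*} [AddCommGroup V] [Module k V] [AddCommGroup T] [Module k T]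
    {δV : V →ₗ[k] A ⊗[k] V} (h : H) (v : V) {F : V → T} (hF : Lin k F) :
    F (P.act δV (h ⊗ₜ v)) = sw (δV v) fun a w => P.pair (h ⊗ₜ a) • F w := by
  rw [act_tmul, hF.map_sw]
  exact sw_congr fun u w => hF.2 _ _

section Commutes

variable {V T : Type*} [AddCommGroup V] [Module k V] [Ring T] [Algebra k T]
  {δV : V →ₗ[k] A ⊗[k] V} {f : H →ₗ[k] T} {g : V →ₗ[k] T}
  {R : A →ₗc[k] H} {Rinv : A →ₗ[k] H}

theorem Commutes.inv_mul (hg : P.Commutes δV f g) (r : IsRMap P.pair R Rinv) (a : A) (v : V) :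
    f (Rinv a) * g v = sw (comul (R := k) a) fun a₁ a₂ =>
      g (P.act δV (Rinv a₁ ⊗ₜ v)) * f (Rinv a₂) := by
  rw [hg, r.sw_comul_inv a (by fun_prop) (by fun_prop)]

/-- Moving `f(R⁻*(a₂))` to the right lets `R⁻*` act on the element already acted on by `R`, and the
two actions cancel. Read from left to right, this removes a braiding at the cost of a reordering. -/
theorem Commutes.inv_mul_act (hg : P.Commutes δV f g) (hδ : IsLeftCoaction δV)
    (r : IsRMap P.pair R Rinv) (a : A) (v : V) :
    (sw (comul (R := k) a) fun a₁ a₂ => f (Rinv a₂) * g (P.act δV (R a₁ ⊗ₜ v))) =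
      g v * f (Rinv a) := by
  simp only [hg.inv_mul P r, ← P.act_mul hδ]
  rw [← sw_comul_coassoc a (by fun_prop) (by fun_prop) (by fun_prop)]
  have h (x y : A) : (sw (comul (R := k) x) fun u w =>
      g (P.act δV ((Rinv w * R u) ⊗ₜ v)) * f (Rinv y)) =
      counit (R := k) x • (g v * f (Rinv y)) := by
    simp only [← sw_mul, ← map_sw, ← sw_tmul_left, r.inv_mul]
    rw [← TensorProduct.smul_tmul', map_smul, P.act_one hδ, map_smul, smul_mul_assoc]
  simp only [h]
  exact sw_counit_left a (by fun_prop)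

/-- By the compatibility of `R` with `Rbar⁻*`, the pairing is the action of `Rbar⁻*(a₁)` on `v`; the
sum is then the commutation rule for `f(Rbar⁻*(a))`. -/
theorem Commutes.pair_R (hg : P.Commutes δV f g) (a : A) (v : V) :
    (sw (δV v) fun x v' => sw (comul (R := k) a) fun a₁ a₂ =>
      P.pair (P.R x ⊗ₜ a₁) • (g v' * f (P.Rbarinv a₂))) = f (P.Rbarinv a) * g v := by
  rw [hg.inv_mul P P.isRMap_bar, sw_comm]
  simp only [P.pair_R, act_tmul, map_sw, map_smul, sw_mul, smul_mul_assoc]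

/-- The dual move: `⟨R⁻*(x), a₁⟩ = ⟨Rbar(a₁), x⟩` turns the pairing into the action of `Rbar(a₁)`,
which `inv_mul_act` absorbs. -/
theorem Commutes.pair_Rinv (hg : P.Commutes δV f g) (hδ : IsLeftCoaction δV) (a : A) (v : V) :
    (sw (δV v) fun x v' => sw (comul (R := k) a) fun a₁ a₂ =>
      P.pair (P.Rinv x ⊗ₜ a₁) • (f (P.Rbarinv a₂) * g v')) = g v * f (P.Rbarinv a) := by
  rw [← hg.inv_mul_act P hδ P.isRMap_bar, sw_comm]
  simp only [← P.pair_Rbar, act_tmul, map_sw, map_smul, mul_sw, mul_smul_comm]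

end Commutes

section Comul

variable {T C : Type*} [Ring T] [Algebra k T] [Ring C] [Algebra k C] [Coalgebra k C]

/-- The map `c ↦ f(R⁻*(c₁⁽⁻¹⁾)) e(c₂) ⊗ c₁⁽⁰⁾`. -/
def comulIn (δC : C →ₗ[k] A ⊗[k] C) (f : H →ₗ[k] T) (e : C →ₗ[k] T) : C →ₗ[k] T ⊗[k] C :=
  (mulMap f e).rTensor C ∘ₗ P.twistComul δC

/-- The map `d ↦ g(d₋₁) f(Rbar⁻*(d₀⁽⁻¹⁾)) ⊗ d₀⁽⁰⁾`. -/
def coactIn {B D : Type*} [AddCommGroup B] [Module k B] [AddCommGroup D] [Module k D]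
    (δD : D →ₗ[k] A ⊗[k] D) (γ : D →ₗ[k] B ⊗[k] D) (g : B →ₗ[k] T) (f : H →ₗ[k] T) :
    D →ₗ[k] T ⊗[k] D :=
  (mulMap g f).rTensor D ∘ₗ P.twistCoaction δD γ

variable {δC : C →ₗ[k] A ⊗[k] C} {f : H →ₗ[k] T} {e : C →ₗ[k] T}

theorem comulIn_apply (c : C) : P.comulIn δC f e c =
    sw (comul (R := k) c) fun c₁ c₂ => sw (δC c₁) fun a c' => (f (P.Rinv a) * e c₂) ⊗ₜ c' := by
  simp only [comulIn, LinearMap.comp_apply, twistComul_apply, map_sw, LinearMap.rTensor_tmul,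
    mulMap_tmul]

theorem sw_comulIn {X : Type*} [AddCommGroup X] [Module k X] (c : C) {F : T → C → X}
    (h₁ : ∀ c, Lin k fun t => F t c) (h₂ : ∀ t, Lin k fun c => F t c) :
    sw (P.comulIn δC f e c) F = sw (comul (R := k) c) fun c₁ c₂ => sw (δC c₁) fun a c' =>
      F (f (P.Rinv a) * e c₂) c' := by
  rw [comulIn_apply, sw_sw _ _ h₁ h₂]
  refine sw_congr fun c₁ c₂ => ?_
  rw [sw_sw _ _ h₁ h₂]
  exact sw_congr fun a c' => sw_pure _ _ h₁ h₂

section CoactIn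

variable {B D : Type*} [AddCommGroup B] [Module k B] [AddCommGroup D] [Module k D]
    {δD : D →ₗ[k] A ⊗[k] D} {γ : D →ₗ[k] B ⊗[k] D} {g : B →ₗ[k] T}

theorem coactIn_apply (d : D) : P.coactIn δD γ g f d =
    sw (γ d) fun b d' => sw (δD d') fun a d'' => (g b * f (P.Rbarinv a)) ⊗ₜ d'' := by
  simp only [coactIn, LinearMap.comp_apply, twistCoaction_apply, map_sw, LinearMap.rTensor_tmul,
    mulMap_tmul]

theorem sw_coactIn {X : Type*} [AddCommGroup X] [Module k X] (d : D) {F : T → D → X}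
    (h₁ : ∀ d, Lin k fun t => F t d) (h₂ : ∀ t, Lin k fun d => F t d) :
    sw (P.coactIn δD γ g f d) F = sw (γ d) fun b d' => sw (δD d') fun a d'' =>
      F (g b * f (P.Rbarinv a)) d'' := by
  rw [coactIn_apply, sw_sw _ _ h₁ h₂]
  refine sw_congr fun c₁ c₂ => ?_
  rw [sw_sw _ _ h₁ h₂]
  exact sw_congr fun a c' => sw_pure _ _ h₁ h₂

end CoactIn

/-- The braiding of `x'` past `c` is the action of `R(c⁽⁻¹⁾)` on `x'`. In this form the twists can
cancel it; with `γ` the coproduct it also covers braided bialgebras. -/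
theorem sw_coaction_mul {B D X : Type*} [Ring B] [Algebra k B] [Ring D] [Algebra k D]
    [AddCommGroup X] [Module k X] {δB : B →ₗ[k] A ⊗[k] B} {δD : D →ₗ[k] A ⊗[k] D}
    {γ : D →ₗ[k] B ⊗[k] D}
    (hγ : γ ∘ₗ LinearMap.mul' k D = TensorProduct.map (LinearMap.mul' k B) (LinearMap.mul' k D) ∘ₗ
      middle (P.braiding δD δB) ∘ₗ TensorProduct.map γ γ) (x y : D) {F : B → D → X}
    (h₁ : ∀ d, Lin k fun b => F b d) (h₂ : ∀ b, Lin k fun d => F b d) :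
    sw (γ (x * y)) F = sw (γ x) fun b x' => sw (γ y) fun c y' => sw (δB c) fun a c' =>
      F (b * c') (P.act δD (P.R a ⊗ₜ x') * y') := by
  have := LinearMap.congr_fun hγ (x ⊗ₜ y)
  simp only [LinearMap.comp_apply, LinearMap.mul'_apply, TensorProduct.map_tmul] at this
  rw [this, ← LinearMap.comp_apply, map_tmul_eq_sw, sw_sw _ _ h₁ h₂]
  refine sw_congr fun b x' => ?_
  rw [sw_sw _ _ h₁ h₂]
  refine sw_congr fun c y' => ?_
  have hF : Lin k fun s : B ⊗[k] D => sw s fun c x => F (b * c) (x * y') := by fun_prop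
  simp only [LinearMap.comp_apply, middle_tmul, map_sw, TensorProduct.map_tmul,
    LinearMap.mul'_apply]
  rw [sw_sw _ _ h₁ h₂]
  simp only [sw_pure _ _ h₁ h₂]
  rw [braiding_tmul, hF.map_sw]
  have key (u : A) (w : D) : (sw (sw (δB c) fun b w' => P.pair (P.R b ⊗ₜ[k] u) • w' ⊗ₜ[k] w)
      fun c x => F (b * c) (x * y')) = sw (δB c) fun a c' => P.pair (P.R a ⊗ₜ u) •
        F (b * c') (w * y') := by
    rw [hF.map_sw]
    refine sw_congr fun a c' => ?_
    rw [hF.2, sw_pure _ _ (by fun_prop) (by fun_prop)]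
  simp only [key]
  rw [sw_comm]
  refine sw_congr fun a c' => ?_
  have hF' : Lin k fun x => F (b * c') (x * y') := by fun_prop
  rw [act_tmul, hF'.map_sw]
  exact sw_congr fun u w => (hF'.2 _ _).symm

section Multiplicative

/-- In `Δ(xy)` the braiding applies `R(b)` to `x₂`, where `b` is the coaction component of `y₁`.
Coassociativity of that coaction pairs `R(b₁)` with the twist `R⁻*(b₂)`, and `inv_mul_act` turns
`f(R⁻*(b₂)) e(R(b₁) ▷ x₂)` into `e(x₂) f(R⁻*(b))`, the order needed for an ordinary product. -/
theorem comulIn_mul (hC : IsBraidedBialgebra P δC) (hf : IsAlgMap f) (he : IsAlgMap e)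
    (hfe : P.Commutes δC f e) (x y : C) :
    P.comulIn δC f e (x * y) = P.comulIn δC f e x * P.comulIn δC f e y := by
  have hδ := hC.isComoduleAlgebra.isLeftCoaction
  calc P.comulIn δC f e (x * y)
      = sw (comul (R := k) x) fun x₁ x₂ => sw (comul (R := k) y) fun y₁ y₂ =>
          sw (δC y₁) fun b y₁' => sw (δC x₁) fun u x₁' => sw (δC y₁') fun w y' =>
            (f (P.Rinv u * P.Rinv w) * e (P.act δC (P.R b ⊗ₜ x₂) * y₂)) ⊗ₜ (x₁' * y') := by
        rw [comulIn_apply, P.sw_coaction_mul hC.comul_mul _ _ (by fun_prop) (by fun_prop)]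
        simp only [hC.isComoduleAlgebra.map_mul]
        refine sw_congr fun x₁ x₂ => sw_congr fun y₁ y₂ => sw_congr fun b y₁' => ?_
        rw [sw_mul_of_bilinear _ _ (by fun_prop) (by fun_prop)]
        simp only [P.isRMap.inv_map_mul]
    _ = sw (comul (R := k) x) fun x₁ x₂ => sw (comul (R := k) y) fun y₁ y₂ =>
          sw (δC x₁) fun u x₁' => sw (δC y₁) fun b y' => sw (comul (R := k) b) fun b₁ b₂ =>
            (f (P.Rinv u) * (f (P.Rinv b₂) * e (P.act δC (P.R b₁ ⊗ₜ x₂))) * e y₂) ⊗ₜ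
              (x₁' * y') := by
        refine sw_congr fun x₁ x₂ => sw_congr fun y₁ y₂ => ?_
        rw [sw_comm]
        refine sw_congr fun u x₁' => ?_
        rw [hδ.sw_coassoc y₁ (by fun_prop) (by fun_prop) (by fun_prop)]
        simp only [hf.map_mul, he.map_mul, mul_assoc]
    _ = sw (comul (R := k) x) fun x₁ x₂ => sw (comul (R := k) y) fun y₁ y₂ =>
          sw (δC x₁) fun u x₁' => sw (δC y₁) fun b y' =>
            (f (P.Rinv u) * e x₂ * (f (P.Rinv b) * e y₂)) ⊗ₜ (x₁' * y') := by
        simp only [← sw_tmul_left, ← sw_mul, ← mul_sw, hfe.inv_mul_act P hδ P.isRMap]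
        simp only [mul_assoc]
    _ = _ := by
        simp only [comulIn_apply, sw_mul]
        refine sw_congr fun x₁ x₂ => ?_
        rw [sw_comm]
        simp only [mul_sw, Algebra.TensorProduct.tmul_mul_tmul]

theorem comulIn_one (hC : IsBraidedBialgebra P δC) (hf : IsAlgMap f) (he : IsAlgMap e) :
    P.comulIn δC f e 1 = 1 := by
  rw [comulIn_apply, hC.comul_one, sw_pure _ _ (by fun_prop) (by fun_prop),
    hC.isComoduleAlgebra.map_one, Algebra.TensorProduct.one_def,
    sw_pure _ _ (by fun_prop) (by fun_prop), P.isRMap.inv_map_one, hf.map_one, he.map_one, one_mul,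
    Algebra.TensorProduct.one_def]

variable {B D : Type*} [Ring B] [Algebra k B] [Coalgebra k B] [Ring D] [Algebra k D]
  {δB : B →ₗ[k] A ⊗[k] B} {δD : D →ₗ[k] A ⊗[k] D} {γ : D →ₗ[k] B ⊗[k] D} {g : B →ₗ[k] T}

/-- Here the twist stands behind the braiding: coacting on `R(a) ▷ x'` produces `⟨R a, u₁⟩` next to
`f(Rbar⁻*(u₂))`, and `Commutes.pair_R` rewrites this as `f(Rbar⁻*(u))` standing before `g(c)`. -/
theorem coactIn_mul (hD : IsBraidedComoduleAlgebra P δB δD γ) (hf : IsAlgMap f) (hg : IsAlgMap g)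
    (hfg : P.Commutes δB f g) (x y : D) :
    P.coactIn δD γ g f (x * y) = P.coactIn δD γ g f x * P.coactIn δD γ g f y := by
  have hδ := hD.isComoduleAlgebra.isLeftCoaction
  calc P.coactIn δD γ g f (x * y)
      = sw (γ x) fun b x' => sw (γ y) fun c y' => sw (δB c) fun a c' =>
          sw (δD (P.act δD (P.R a ⊗ₜ x'))) fun u x' => sw (δD y') fun w y' =>
            (g b * g c' * (f (P.Rbarinv u) * f (P.Rbarinv w))) ⊗ₜ (x' * y') := by
        rw [coactIn_apply, P.sw_coaction_mul hD.coaction_mul _ _ (by fun_prop) (by fun_prop)]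
        simp only [hD.isComoduleAlgebra.map_mul]
        refine sw_congr fun b x' => sw_congr fun c y' => sw_congr fun a c' => ?_
        rw [sw_mul_of_bilinear _ _ (by fun_prop) (by fun_prop)]
        simp only [P.isRMap_bar.inv_map_mul, hf.map_mul, hg.map_mul]
    _ = sw (γ x) fun b x' => sw (γ y) fun c y' => sw (δD x') fun u x' => sw (δD y') fun w y' =>
          sw (δB c) fun a c' => sw (comul (R := k) u) fun u₁ u₂ =>
            (g b * (P.pair (P.R a ⊗ₜ u₁) • (g c' * f (P.Rbarinv u₂))) * f (P.Rbarinv w)) ⊗ₜ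
              (x' * y') := by
        refine sw_congr fun b x' => sw_congr fun c y' => ?_
        trans sw (δB c) fun a c' => sw (δD x') fun u x' => sw (comul (R := k) u) fun u₁ u₂ =>
          P.pair (P.R a ⊗ₜ u₁) • sw (δD y') fun w y' =>
            (g b * g c' * (f (P.Rbarinv u₂) * f (P.Rbarinv w))) ⊗ₜ (x' * y')
        · refine sw_congr fun a c' => ?_
          rw [P.sw_coaction_act hδ _ _ (by fun_prop) (by fun_prop)]
        rw [sw_comm]
        refine sw_congr fun u x' => ?_
        simp only [smul_sw, mul_smul_comm, smul_mul_assoc, TensorProduct.smul_tmul', mul_assoc]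
        rw [sw_comm (δD y')]
        refine sw_congr fun a c' => ?_
        rw [sw_comm]
    _ = sw (γ x) fun b x' => sw (γ y) fun c y' => sw (δD x') fun u x' => sw (δD y') fun w y' =>
            (g b * (f (P.Rbarinv u) * g c) * f (P.Rbarinv w)) ⊗ₜ (x' * y') := by
        simp only [← sw_tmul_left, ← sw_mul, ← mul_sw, hfg.pair_R P]
    _ = _ := by
        simp only [coactIn_apply, sw_mul]
        refine sw_congr fun x₁ x₂ => ?_
        rw [sw_comm]
        simp only [mul_sw, Algebra.TensorProduct.tmul_mul_tmul, mul_assoc]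

theorem coactIn_one (hD : IsBraidedComoduleAlgebra P δB δD γ) (hf : IsAlgMap f)
    (hg : IsAlgMap g) : P.coactIn δD γ g f 1 = 1 := by
  rw [coactIn_apply, hD.coaction_one, sw_pure _ _ (by fun_prop) (by fun_prop),
    hD.isComoduleAlgebra.map_one, Algebra.TensorProduct.one_def,
    sw_pure _ _ (by fun_prop) (by fun_prop), P.isRMap_bar.inv_map_one, hf.map_one, hg.map_one,
    one_mul, Algebra.TensorProduct.one_def]

end Multiplicative

end Comul

end WeakQuasitriangularPair

end Twisted

/-! ### Compatibility of the twisted maps with the action of `H`. -/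

section YetterDrinfeld

open Coalgebra HopfAlgebra

namespace WeakQuasitriangularPair

variable {k A H : Type*} [Field k] [Ring A] [HopfAlgebra k A] [Ring H] [HopfAlgebra k H]
  (P : WeakQuasitriangularPair k A H)
  {T C B D : Type*} [Ring T] [Algebra k T] [Ring C] [Algebra k C] [Coalgebra k C]
  [Ring B] [Algebra k B] [Coalgebra k B] [Ring D] [Algebra k D]
  {δC : C →ₗ[k] A ⊗[k] C} {δB : B →ₗ[k] A ⊗[k] B} {δD : D →ₗ[k] A ⊗[k] D}
  {γ : D →ₗ[k] B ⊗[k] D} {f : H →ₗ[k] T} {e : C →ₗ[k] T} {g : B →ₗ[k] T}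

/-- `f(h₂) c₋₁ ⊗ (h₁ ▷ c₀) = (h₂ ▷ c)₋₁ f(h₁) ⊗ (h₂ ▷ c)₀` for the map `comulIn`. -/
theorem comulIn_act (hC : IsBraidedBialgebra P δC) (hf : IsAlgMap f)
    (hfe : P.Commutes δC f e) (h : H) (c : C) :
    (sw (comul (R := k) h) fun h₁ h₂ => sw (P.comulIn δC f e c) fun t c' =>
      (f h₂ * t) ⊗ₜ[k] P.act δC (h₁ ⊗ₜ c')) =
    sw (comul (R := k) h) fun h₁ h₂ => sw (P.comulIn δC f e (P.act δC (h₂ ⊗ₜ c))) fun t c' =>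
      (t * f h₁) ⊗ₜ[k] c' := by
  have hδ := hC.isComoduleAlgebra.isLeftCoaction
  have left (h₁ h₂ : H) : (sw (P.comulIn δC f e c) fun t c' =>
      (f h₂ * t) ⊗ₜ[k] P.act δC (h₁ ⊗ₜ c')) =
      sw (comul (R := k) c) fun c₁ c₂ => sw (δC c₁) fun a c' => sw (comul (R := k) a) fun a₁ a₂ =>
        (f (P.pair (h₁ ⊗ₜ a₂) • (h₂ * P.Rinv a₁)) * e c₂) ⊗ₜ[k] c' := by
    rw [sw_comulIn _ _ (by fun_prop) (by fun_prop)]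
    refine sw_congr fun c₁ c₂ => ?_
    rw [hδ.sw_coassoc c₁ (by fun_prop) (by fun_prop) (by fun_prop)]
    refine sw_congr fun a c' => (P.sw_act h₁ c' (F := fun x => (f h₂ * (f (P.Rinv a) * e c₂)) ⊗ₜ[k] x)
      (by fun_prop)).trans (sw_congr fun b x => ?_)
    simp only [map_smul, hf.map_mul, smul_mul_assoc, TensorProduct.smul_tmul', mul_assoc]
  have right (h₁ h₂ : H) : (sw (P.comulIn δC f e (P.act δC (h₂ ⊗ₜ c))) fun t c' =>
      (t * f h₁) ⊗ₜ[k] c') = sw (comul (R := k) c) fun c₁ c₂ => sw (δC c₁) fun a c' =>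
        sw (comul (R := k) h₂) fun x₁ x₂ => sw (comul (R := k) a) fun a₁ a₂ => P.pair (x₂ ⊗ₜ a₁) •
          ((f (P.Rinv a₂) * e (P.act δC (x₁ ⊗ₜ c₂)) * f h₁) ⊗ₜ[k] c') := by
    rw [sw_comulIn _ _ (by fun_prop) (by fun_prop),
      P.sw_map_act hC.comul_colinear _ _ (by fun_prop) (by fun_prop), sw_comm]
    refine sw_congr fun c₁ c₂ => ?_
    rw [sw_comm (δC c₁)]
    refine sw_congr fun x₁ x₂ => ?_
    rw [P.sw_coaction_act hδ _ _ (by fun_prop) (by fun_prop)]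
  simp only [left, right]
  rw [sw_comm]
  conv_rhs => rw [sw_comm]
  refine sw_congr fun c₁ c₂ => ?_
  rw [sw_comm]
  conv_rhs => rw [sw_comm]
  refine sw_congr fun a c' => ?_
  rw [← sw_comul_coassoc h (by fun_prop) (by fun_prop) (by fun_prop)]
  -- Once both sides are expanded over `c` and its coaction, they differ by the commutation of `H`
  -- with `R⁻*`, and afterwards by moving `f` past `e`.
  simp only [← sw_tmul_left, ← sw_mul, ← map_sw, P.isRMap.inv_comm]
  simp only [sw_tmul_left, sw_mul, map_sw]
  refine sw_congr fun h₁ h₂ => ?_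
  rw [sw_comm]
  refine sw_congr fun a₁ a₂ => ?_
  simp only [map_smul, hf.map_mul, smul_mul_assoc, mul_assoc, hfe h₁ c₂, mul_sw, sw_tmul_left,
    smul_sw, TensorProduct.smul_tmul']

/-- The counterpart of `comulIn_act`. On the left `f(h₂)` is first moved past `g`; on the right the
coaction on `h₂ ▷ d` is expanded by colinearity. What remains to be compared is the commutation of
`H` with `Rbar⁻*`. -/
theorem coactIn_act (hD : IsBraidedComoduleAlgebra P δB δD γ) (hf : IsAlgMap f)
    (hfg : P.Commutes δB f g) (h : H) (d : D) :
    (sw (comul (R := k) h) fun h₁ h₂ => sw (P.coactIn δD γ g f d) fun t d' =>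
      (f h₂ * t) ⊗ₜ[k] P.act δD (h₁ ⊗ₜ d')) =
    sw (comul (R := k) h) fun h₁ h₂ => sw (P.coactIn δD γ g f (P.act δD (h₂ ⊗ₜ d))) fun t d' =>
      (t * f h₁) ⊗ₜ[k] d' := by
  have hδ := hD.isComoduleAlgebra.isLeftCoaction
  have left (h₁ h₂ : H) : (sw (P.coactIn δD γ g f d) fun t d' =>
      (f h₂ * t) ⊗ₜ[k] P.act δD (h₁ ⊗ₜ d')) =
      sw (comul (R := k) h₂) fun x₁ x₂ => sw (γ d) fun b d' => sw (δD d') fun a d' =>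
        sw (comul (R := k) a) fun a₁ a₂ =>
        (g (P.act δB (x₂ ⊗ₜ b)) * f (P.pair (h₁ ⊗ₜ a₂) • (x₁ * P.Rbarinv a₁))) ⊗ₜ[k] d' := by
    rw [sw_coactIn _ _ (by fun_prop) (by fun_prop), sw_comm]
    refine sw_congr fun b d' => ?_
    rw [sw_comm]
    have (a : A) (d'' : D) : (f h₂ * (g b * f (P.Rbarinv a))) ⊗ₜ[k] P.act δD (h₁ ⊗ₜ d'') =
        sw (δD d'') fun a' d'' => sw (comul (R := k) h₂) fun x₁ x₂ =>
          (g (P.act δB (x₂ ⊗ₜ b)) * f (P.pair (h₁ ⊗ₜ a') • (x₁ * P.Rbarinv a))) ⊗ₜ[k] d'' := by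
      refine (P.sw_act h₁ d'' (F := fun x => (f h₂ * (g b * f (P.Rbarinv a))) ⊗ₜ[k] x)
        (by fun_prop)).trans (sw_congr fun a' d'' => ?_)
      simp only [← mul_assoc, hfg h₂ b, map_smul, hf.map_mul, sw_mul, mul_smul_comm, sw_tmul_left,
        smul_sw, TensorProduct.smul_tmul']
    simp only [this]
    rw [← hδ.sw_coassoc d' (by fun_prop) (by fun_prop) (by fun_prop)]
    refine sw_congr fun a d'' => ?_
    rw [sw_comm]
  have right (h₁ h₂ : H) : (sw (P.coactIn δD γ g f (P.act δD (h₂ ⊗ₜ d))) fun t d' =>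
      (t * f h₁) ⊗ₜ[k] d') = sw (comul (R := k) h₂) fun x₁ x₂ => sw (γ d) fun b d' =>
        sw (δD d') fun a d' => sw (comul (R := k) a) fun a₁ a₂ => 
          (g (P.act δB (x₂ ⊗ₜ b)) * f (P.pair (x₁ ⊗ₜ a₁) • (P.Rbarinv a₂ * h₁))) ⊗ₜ[k] d' := by
    rw [sw_coactIn _ _ (by fun_prop) (by fun_prop),
      P.sw_map_act hD.colinear _ _ (by fun_prop) (by fun_prop)]
    refine sw_congr fun x₁ x₂ => sw_congr fun c₁ c₂ => ?_
    rw [P.sw_coaction_act hδ _ _ (by fun_prop) (by fun_prop)]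
    simp only [map_smul, hf.map_mul, mul_smul_comm, TensorProduct.smul_tmul', mul_assoc]
  simp only [left, right]
  rw [← sw_comul_coassoc h (by fun_prop) (by fun_prop) (by fun_prop),
    ← sw_comul_coassoc h (by fun_prop) (by fun_prop) (by fun_prop)]
  refine sw_congr fun y h₂ => ?_
  rw [sw_comm]
  conv_rhs => rw [sw_comm]
  refine sw_congr fun b d' => ?_
  rw [sw_comm]
  conv_rhs => rw [sw_comm]
  refine sw_congr fun a d' => ?_
  simp only [← sw_tmul_left, ← mul_sw, ← map_sw, P.isRMap_bar.inv_comm]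

end WeakQuasitriangularPair

end YetterDrinfeld

/-! ### Iterating the twisted maps, their counits and tensor products of targets. -/

section TensorProducts

open Coalgebra HopfAlgebra

namespace WeakQuasitriangularPair

variable {k A H : Type*} [Field k] [Ring A] [HopfAlgebra k A] [Ring H] [HopfAlgebra k H]
  (P : WeakQuasitriangularPair k A H)
  {T T' C B D : Type*} [Ring T] [Algebra k T] [Ring T'] [Algebra k T'] [Ring C] [Algebra k C]
  [Coalgebra k C] [Ring B] [Algebra k B] [Coalgebra k B] [Ring D] [Algebra k D]
  {δC : C →ₗ[k] A ⊗[k] C} {δB : B →ₗ[k] A ⊗[k] B} {δD : D →ₗ[k] A ⊗[k] D}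
  {γ : D →ₗ[k] B ⊗[k] D} {f : H →ₗ[k] T} {e : C →ₗ[k] T} {g : B →ₗ[k] T}
  {f' : H →ₗ[k] T'} {e' : C →ₗ[k] T'} {g' : B →ₗ[k] T'}

/-- The map `h ↦ f(h₂) ⊗ f'(h₁)`. -/
def _root_.BraidedDouble.comulH {V W : Type*} [AddCommGroup V] [Module k V] [AddCommGroup W]
    [Module k W] (f : H →ₗ[k] V) (f' : H →ₗ[k] W) : H →ₗ[k] V ⊗[k] W :=
  TensorProduct.map f f' ∘ₗ (TensorProduct.comm k H H).toLinearMap ∘ₗ comul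

theorem _root_.BraidedDouble.comulH_apply {V W : Type*} [AddCommGroup V] [Module k V]
    [AddCommGroup W] [Module k W] (f : H →ₗ[k] V) (f' : H →ₗ[k] W) (h : H) :
    comulH f f' h = sw (comul (R := k) h) fun h₁ h₂ => f h₂ ⊗ₜ f' h₁ := by
  simp only [comulH, LinearMap.comp_apply]
  conv_lhs => rw [← sw_tmul (comul h)]
  simp only [map_sw, LinearEquiv.coe_coe, TensorProduct.comm_tmul, TensorProduct.map_tmul]

theorem _root_.BraidedDouble.IsAlgMap.comulH (hf : IsAlgMap f) (hf' : IsAlgMap f') :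
    IsAlgMap (comulH f f') where
  map_mul x y := by
    simp only [comulH_apply, Bialgebra.comul_mul]
    rw [sw_mul_of_bilinear _ _ (by fun_prop) (by fun_prop)]
    simp only [sw_mul, mul_sw, hf.map_mul, hf'.map_mul, Algebra.TensorProduct.tmul_mul_tmul]
    rw [sw_comm]
  map_one := by
    rw [comulH_apply, Bialgebra.comul_one, Algebra.TensorProduct.one_def,
      sw_pure _ _ (by fun_prop) (by fun_prop), hf.map_one, hf'.map_one,
      Algebra.TensorProduct.one_def]

theorem comulH_inv (a : A) : comulH f f' (P.Rinv a) =
    sw (comul (R := k) a) fun a₁ a₂ => f (P.Rinv a₁) ⊗ₜ f' (P.Rinv a₂) := by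
  rw [comulH_apply, P.isRMap.sw_comul_inv _ (by fun_prop) (by fun_prop)]

theorem comulH_barinv (a : A) : comulH f f' (P.Rbarinv a) =
    sw (comul (R := k) a) fun a₁ a₂ => f (P.Rbarinv a₁) ⊗ₜ f' (P.Rbarinv a₂) := by
  rw [comulH_apply, P.isRMap_bar.sw_comul_inv _ (by fun_prop) (by fun_prop)]

/-- Coassociativity with two independent targets. Colinearity of the coproduct of `C` produces a
product in `A`, which `R⁻*` preserves; coassociativity of the `A`-coaction produces a coproduct in
`A`, which `R⁻*` reverses, as `comulH` requires. With both targets the double this is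
coassociativity on `C`; with one target `End D` it reorganises the cross relation. -/
theorem sw_comulIn_coassoc (hC : IsBraidedBialgebra P δC) (hf : IsAlgMap f) (c : C) :
    P.comulIn δC (comulH f f') (e'.lTensor T ∘ₗ P.comulIn δC f e) c =
      sw (P.comulIn δC f e c) fun t c' => sw (P.comulIn δC f' e' c') fun t' c'' =>
        (t ⊗ₜ t') ⊗ₜ c'' := by
  have hδ := hC.isComoduleAlgebra.isLeftCoaction
  rw [P.sw_comulIn _ (by fun_prop) (by fun_prop)]
  have right (c₁ c₂ : C) : (sw (δC c₁) fun a c' => sw (P.comulIn δC f' e' c') fun t' c'' =>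
        ((f (P.Rinv a) * e c₂) ⊗ₜ[k] t') ⊗ₜ[k] c'') =
      sw (comul (R := k) c₁) fun u w => sw (δC u) fun a u => sw (comul (R := k) a) fun a₁ a₂ =>
        sw (δC w) fun b w => ((f (P.Rinv a₁) * (f (P.Rinv b) * e c₂)) ⊗ₜ[k]
          (f' (P.Rinv a₂) * e' w)) ⊗ₜ[k] u := by
    trans sw (δC c₁) fun a c' => sw (comul (R := k) c') fun u w => sw (δC u) fun x u =>
        ((f (P.Rinv a) * e c₂) ⊗ₜ[k] (f' (P.Rinv x) * e' w)) ⊗ₜ[k] u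
    · refine sw_congr fun a c' => ?_
      rw [P.sw_comulIn _ (by fun_prop) (by fun_prop)]
    rw [sw_colinear hC.comul_colinear _ (by fun_prop) (by fun_prop) (by fun_prop)]
    refine sw_congr fun u w => ?_
    rw [hδ.sw_coassoc u (by fun_prop) (by fun_prop) (by fun_prop)]
    refine sw_congr fun a u => ?_
    rw [sw_comm]
    simp only [P.isRMap.inv_map_mul, hf.map_mul, mul_assoc]
  simp only [right]
  rw [sw_comul_coassoc c (by fun_prop) (by fun_prop) (by fun_prop), comulIn_apply]
  refine sw_congr fun u c₂ => ?_
  rw [sw_comm]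
  refine sw_congr fun a u => ?_
  rw [P.comulH_inv, LinearMap.comp_apply, comulIn_apply]
  simp only [map_sw, LinearMap.lTensor_tmul, sw_mul, mul_sw, sw_tmul_left,
    Algebra.TensorProduct.tmul_mul_tmul]
  refine sw_congr fun w c₂ => ?_
  rw [sw_comm]

/-- The same mechanism for `Rbar⁻*`, with colinearity and coassociativity of `γ` in place of those
of the coproduct. On `B` itself it is coassociativity, on `D` the coaction axiom. -/
theorem sw_coactIn_coassoc (hD : IsBraidedComoduleAlgebra P δB δD γ) (hf : IsAlgMap f) (d : D) :
    P.coactIn δD γ (g'.lTensor T ∘ₗ P.coactIn δB comul g f) (comulH f f') d =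
      sw (P.coactIn δD γ g f d) fun t d' => sw (P.coactIn δD γ g' f' d') fun t' d'' =>
        (t ⊗ₜ t') ⊗ₜ d'' := by
  have hδ := hD.isComoduleAlgebra.isLeftCoaction
  rw [P.sw_coactIn _ (by fun_prop) (by fun_prop)]
  have right (b : B) (d : D) : (sw (δD d) fun a d' => sw (P.coactIn δD γ g' f' d') fun t' d'' =>
        ((g b * f (P.Rbarinv a)) ⊗ₜ[k] t') ⊗ₜ[k] d'') =
      sw (γ d) fun y x => sw (δD x) fun a x => sw (comul (R := k) a) fun a₁ a₂ =>
        sw (δB y) fun z y => ((g b * f (P.Rbarinv z) * f (P.Rbarinv a₁)) ⊗ₜ[k]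
          (g' y * f' (P.Rbarinv a₂))) ⊗ₜ[k] x := by
    trans sw (δD d) fun a d' => sw (γ d') fun y x => sw (δD x) fun z x =>
        ((g b * f (P.Rbarinv a)) ⊗ₜ[k] (g' y * f' (P.Rbarinv z))) ⊗ₜ[k] x
    · refine sw_congr fun a c' => ?_
      rw [P.sw_coactIn _ (by fun_prop) (by fun_prop)]
    rw [sw_colinear hD.colinear _ (by fun_prop) (by fun_prop) (by fun_prop)]
    refine sw_congr fun y x => ?_
    rw [sw_comm, hδ.sw_coassoc x (by fun_prop) (by fun_prop) (by fun_prop)]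
    refine sw_congr fun a u => ?_
    rw [sw_comm]
    simp only [P.isRMap_bar.inv_map_mul, hf.map_mul, mul_assoc]
  simp only [right]
  rw [← hD.isLeftCoaction.sw_coassoc d (by fun_prop) (by fun_prop) (by fun_prop), coactIn_apply]
  refine sw_congr fun b d => ?_
  rw [sw_comm]
  refine sw_congr fun a d => ?_
  rw [P.comulH_barinv, LinearMap.comp_apply, coactIn_apply]
  simp only [map_sw, LinearMap.lTensor_tmul, sw_mul, mul_sw, sw_tmul_left,
    Algebra.TensorProduct.tmul_mul_tmul]
  rw [sw_comm]

theorem comulIn_counit (hC : IsBraidedBialgebra P δC) (c : C) :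
    P.comulIn δC (counit (R := k) (A := H)) (counit (R := k) (A := C)) c = 1 ⊗ₜ c := by
  have hδ := hC.isComoduleAlgebra.isLeftCoaction
  rw [comulIn_apply]
  simp only [P.isRMap.counit_inv]
  trans sw (comul (R := k) c) fun c₁ c₂ => counit (R := k) c₂ • (1 : k) ⊗ₜ[k] c₁
  · refine sw_congr fun c₁ c₂ => ?_
    rw [← hδ.sw_counit c₁ (F := fun x => counit (R := k) c₂ • (1 : k) ⊗ₜ[k] x) (by fun_prop)]
    refine sw_congr fun a c' => ?_
    simp only [TensorProduct.smul_tmul', smul_eq_mul, mul_one]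
  · rw [sw_counit_right c (by fun_prop)]

theorem coactIn_counit (hD : IsBraidedComoduleAlgebra P δB δD γ) (d : D) :
    P.coactIn δD γ (counit (R := k) (A := B)) (counit (R := k) (A := H)) d = 1 ⊗ₜ d := by
  have hδ := hD.isComoduleAlgebra.isLeftCoaction
  rw [coactIn_apply]
  simp only [P.isRMap_bar.counit_inv]
  trans sw (γ d) fun b d => counit (R := k) b • (1 : k) ⊗ₜ[k] d
  · refine sw_congr fun b d => ?_
    rw [← hδ.sw_counit d (F := fun x => counit (R := k) b • (1 : k) ⊗ₜ[k] x) (by fun_prop)]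
    refine sw_congr fun a d' => ?_
    simp only [TensorProduct.smul_tmul', smul_eq_mul, mul_one]
    rw [mul_comm]
  · rw [hD.isLeftCoaction.sw_counit d (by fun_prop)]

/-- The relation of `H` with a comodule passes to tensor products. -/
theorem commutes_comulH {V : Type*} [AddCommGroup V] [Module k V] {δV : V →ₗ[k] A ⊗[k] V}
    {Φ : V →ₗ[k] T ⊗[k] V} (hΦ : ∀ (h : H) (v : V),
      (sw (comul (R := k) h) fun h₁ h₂ => sw (Φ v) fun t v' =>
        (f h₂ * t) ⊗ₜ[k] P.act δV (h₁ ⊗ₜ v')) =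
      sw (comul (R := k) h) fun h₁ h₂ => sw (Φ (P.act δV (h₂ ⊗ₜ v))) fun t v' =>
        (t * f h₁) ⊗ₜ[k] v') {j : V →ₗ[k] T'} (hj : P.Commutes δV f' j) :
    P.Commutes δV (comulH f f') (j.lTensor T ∘ₗ Φ) := by
  intro h v
  have hΦ' (y x : H) : (sw (comul (R := k) y) fun h₁ h₂ => sw (Φ v) fun t v' =>
        (f h₂ * t) ⊗ₜ[k] (j (P.act δV (h₁ ⊗ₜ v')) * f' x)) =
      sw (comul (R := k) y) fun h₁ h₂ => sw (Φ (P.act δV (h₂ ⊗ₜ v))) fun t v' =>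
        (t * f h₁) ⊗ₜ[k] (j v' * f' x) := by
    have := congrArg ((LinearMap.mulRight k (f' x) ∘ₗ j).lTensor T) (hΦ y v)
    simpa only [map_sw, LinearMap.lTensor_tmul, LinearMap.comp_apply,
      LinearMap.mulRight_apply] using this
  have hL (v : V) : (j.lTensor T ∘ₗ Φ) v = sw (Φ v) fun t v' => t ⊗ₜ j v' := by
    rw [LinearMap.comp_apply, map_eq_sw]; rfl
  simp only [hL, comulH_apply]
  calc _ = sw (comul (R := k) h) fun h₁ h₂ => sw (comul (R := k) h₁) fun x₁ x₂ =>
        sw (Φ v) fun t v' => (f h₂ * t) ⊗ₜ[k] (j (P.act δV (x₂ ⊗ₜ v')) * f' x₁) := by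
        simp only [sw_mul, mul_sw, Algebra.TensorProduct.tmul_mul_tmul, hj _ _, tmul_sw]
        rw [sw_comm]
        refine sw_congr fun h₁ h₂ => ?_
        rw [sw_comm]
    _ = sw (comul (R := k) h) fun x y => sw (comul (R := k) y) fun h₁ h₂ =>
          sw (Φ (P.act δV (h₂ ⊗ₜ v))) fun t v' => (t * f h₁) ⊗ₜ[k] (j v' * f' x) := by
        rw [sw_comul_coassoc h (by fun_prop) (by fun_prop) (by fun_prop)]
        simp only [hΦ']
    _ = _ := by
        rw [← sw_comul_coassoc h (by fun_prop) (by fun_prop) (by fun_prop)]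
        simp only [sw_mul, mul_sw, Algebra.TensorProduct.tmul_mul_tmul]

/-! ## Naturality in the target algebra -/

theorem comulIn_comp (φ : T →ₐ[k] T') (c : C) :
    φ.toLinearMap.rTensor C (P.comulIn δC f e c) =
      P.comulIn δC (φ.toLinearMap ∘ₗ f) (φ.toLinearMap ∘ₗ e) c := by
  simp only [comulIn_apply, map_sw, LinearMap.rTensor_tmul, LinearMap.comp_apply,
    AlgHom.toLinearMap_apply, map_mul]

theorem coactIn_comp (φ : T →ₐ[k] T') (d : D) :
    φ.toLinearMap.rTensor D (P.coactIn δD γ g f d) =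
      P.coactIn δD γ (φ.toLinearMap ∘ₗ g) (φ.toLinearMap ∘ₗ f) d := by
  simp only [coactIn_apply, map_sw, LinearMap.rTensor_tmul, LinearMap.comp_apply,
    AlgHom.toLinearMap_apply, map_mul]

end WeakQuasitriangularPair

end TensorProducts

/-! ### The actions of `H` and `C` on `D` by operators. -/

section Operators

open Coalgebra HopfAlgebra

variable {k A H : Type*} [Field k] [Ring A] [HopfAlgebra k A] [Ring H] [HopfAlgebra k H]
  {P : WeakQuasitriangularPair k A H}
  {C B D X : Type*} [Ring C] [Algebra k C]
  [Coalgebra k C] [Ring B] [Algebra k B] [Coalgebra k B] [Ring D] [Algebra k D]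
  [AddCommGroup X] [Module k X]
  {δC : C →ₗ[k] A ⊗[k] C} {δB : B →ₗ[k] A ⊗[k] B} {δD : D →ₗ[k] A ⊗[k] D}
  {γ : D →ₗ[k] B ⊗[k] D} {ev : C ⊗[k] B →ₗ[k] k}

namespace IsBraidedWeakPairing

theorem sw_colinear (hev : IsBraidedWeakPairing δC δB ev) (c : C) (b : B) {G : A → X}
    (hG : Lin k G) : (sw (δC c) fun a c' => sw (δB b) fun x b' => ev (c' ⊗ₜ b') • G (a * x)) =
      ev (c ⊗ₜ b) • G 1 := by
  have := congrArg (fun t => sw t fun a r => r • G a) (LinearMap.congr_fun hev.colinear (c ⊗ₜ b))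
  simp only [LinearMap.comp_apply, tensorCoaction_tmul, map_sw, LinearMap.lTensor_tmul,
    TensorProduct.mk_apply] at this
  rw [sw_sw _ _ (by fun_prop) (by fun_prop), sw_pure _ _ (by fun_prop) (by fun_prop)] at this
  rw [← this]
  refine sw_congr fun a c' => ?_
  rw [sw_sw (δB b) _ (by fun_prop) (by fun_prop)]
  refine sw_congr fun x b' => ?_
  rw [sw_pure _ _ (by fun_prop) (by fun_prop)]

/-- `ev(c, b⁽⁰⁾) b⁽⁻¹⁾ = ev(c⁽⁰⁾, b) S(c⁽⁻¹⁾)`. -/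
theorem sw_antipode (hev : IsBraidedWeakPairing δC δB ev) (hC : IsLeftCoaction δC) (c : C) (b : B)
    {G : A → X} (hG : Lin k G) : (sw (δB b) fun x b' => ev (c ⊗ₜ b') • G x) =
      sw (δC c) fun a c' => ev (c' ⊗ₜ b) • G (antipode k a) := by
  -- A counit taken from the coaction on `c` is expanded as `S(a₁) a₂`; the factor `a₂ x` is then
  -- absorbed by the invariance of `ev`.
  calc (sw (δB b) fun x b' => ev (c ⊗ₜ b') • G x)
      = sw (δC c) fun a c' => sw (comul (R := k) a) fun a₁ a₂ => sw (δB b) fun x b' =>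
          ev (c' ⊗ₜ b') • G (antipode k a₁ * a₂ * x) := by
        rw [← hC.sw_counit c (F := fun c => sw (δB b) fun x b' => ev (c ⊗ₜ b') • G x)
          (by fun_prop)]
        refine sw_congr fun a c' => ?_
        rw [sw_comm, smul_sw]
        refine sw_congr fun x b' => ?_
        have hG' : Lin k fun y => ev (c' ⊗ₜ b') • G (y * x) := by fun_prop
        rw [← hG'.map_sw, sw_antipode_mul, hG'.2, one_mul]
    _ = _ := by
        rw [hC.sw_coassoc c (by fun_prop) (by fun_prop) (by fun_prop)]
        simp only [mul_assoc]
        refine sw_congr fun a c' => ?_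
        rw [hev.sw_colinear (G := fun y => G (antipode k a * y)) c' b (by fun_prop), mul_one]

/-- The pairing is invariant under `H`. -/
theorem sw_act (hev : IsBraidedWeakPairing δC δB ev) (h : H) (c : C) (b : B) :
    (sw (comul (R := k) h) fun h₁ h₂ => ev (P.act δC (h₂ ⊗ₜ c) ⊗ₜ P.act δB (h₁ ⊗ₜ b))) =
      counit (R := k) h * ev (c ⊗ₜ b) := by
  have := hev.sw_colinear c b (G := fun a => P.pair (h ⊗ₜ a)) (by fun_prop)
  rw [P.isWeakPairing.one_right, smul_eq_mul, mul_comm] at this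
  rw [← this]
  simp only [P.isWeakPairing.mul_right_eq, P.act_tmul, sw_tmul_left, tmul_sw, map_sw, map_smul,
    TensorProduct.tmul_smul, ← TensorProduct.smul_tmul', smul_sw, smul_eq_mul]
  simp only [mul_sw]
  rw [sw_comm (δC c)]
  conv_lhs => rw [sw_comm]
  refine sw_congr fun x b' => ?_
  rw [sw_comm]
  refine sw_congr fun a c' => sw_congr fun h₁ h₂ => ?_
  ring

end IsBraidedWeakPairing

namespace WeakQuasitriangularPair

variable (P)

/-- The action of `H` by endomorphisms. -/
def actEnd {V : Type*} [AddCommGroup V] [Module k V] (δV : V →ₗ[k] A ⊗[k] V) :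
    H →ₗ[k] Module.End k V :=
  TensorProduct.curry (P.act δV)

@[simp] theorem actEnd_apply {V : Type*} [AddCommGroup V] [Module k V] (δV : V →ₗ[k] A ⊗[k] V)
    (h : H) (v : V) : P.actEnd δV h v = P.act δV (h ⊗ₜ v) := rfl

/-- The action of `C` on a comodule over `B`, `c · d = ev(c, d₋₁) d₀`. -/
def _root_.BraidedDouble.pairEnd {B C D : Type*} [AddCommGroup B] [Module k B] [AddCommGroup C]
    [Module k C] [AddCommGroup D] [Module k D] (γ : D →ₗ[k] B ⊗[k] D) (ev : C ⊗[k] B →ₗ[k] k) :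
    C →ₗ[k] Module.End k D :=
  TensorProduct.curry ((TensorProduct.lid k D).toLinearMap ∘ₗ ev.rTensor D ∘ₗ
    (TensorProduct.assoc k C B D).symm.toLinearMap ∘ₗ γ.lTensor C)

theorem _root_.BraidedDouble.pairEnd_apply {B C D : Type*} [AddCommGroup B] [Module k B]
    [AddCommGroup C] [Module k C] [AddCommGroup D] [Module k D] (γ : D →ₗ[k] B ⊗[k] D)
    (ev : C ⊗[k] B →ₗ[k] k) (c : C) (d : D) :
    pairEnd γ ev c d = sw (γ d) fun b d' => ev (c ⊗ₜ b) • d' := by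
  simp only [pairEnd, TensorProduct.curry_apply, LinearMap.comp_apply, LinearMap.lTensor_tmul]
  conv_lhs => rw [← sw_tmul (γ d)]
  simp [tmul_sw, map_sw]

theorem _root_.BraidedDouble.sw_apply {U W V V' : Type*} [AddCommGroup U] [Module k U]
    [AddCommGroup W] [Module k W] [AddCommGroup V] [Module k V] [AddCommGroup V'] [Module k V']
    (t : U ⊗[k] W) (G : U → W → V →ₗ[k] V') (v : V) : (sw t G) v = sw t fun x y => G x y v :=
  LinearMap.sum_apply _ _ _

theorem isAlgMap_actEnd {V : Type*} [AddCommGroup V] [Module k V] {δV : V →ₗ[k] A ⊗[k] V}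
    (hδ : IsLeftCoaction δV) : IsAlgMap (P.actEnd δV) where
  map_mul x y := by ext v; simp [P.act_mul hδ]
  map_one := by ext v; simp [P.act_one hδ]

theorem _root_.BraidedDouble.isAlgMap_pairEnd (hγ : IsLeftCoaction γ) (hev : IsWeakPairing ev) :
    IsAlgMap (pairEnd γ ev) where
  map_mul x y := by
    ext d
    simp only [Module.End.mul_apply, pairEnd_apply, hev.mul_left_eq, sw_smul, map_sw, map_smul]
    rw [hγ.sw_coassoc d (F := fun b₁ b₂ d => (ev (y ⊗ₜ b₁) * ev (x ⊗ₜ b₂)) • d) (by fun_prop)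
      (by fun_prop) (by fun_prop)]
    simp only [smul_sw, smul_smul]
  map_one := by
    ext d
    simp only [pairEnd_apply, hev.one_left, Module.End.one_apply]
    exact hγ.sw_counit d Lin.id

/-- The rule `h ▷ (c · d) = (h₂ ▷ c) · (h₁ ▷ d)` is the colinearity of `γ` together with the
invariance of `ev` under `H`. It makes `End D` a legitimate target for `comulIn`. -/
theorem commutes_actEnd (hD : IsBraidedComoduleAlgebra P δB δD γ)
    (hev : IsBraidedWeakPairing δC δB ev) : P.Commutes δC (P.actEnd δD) (pairEnd γ ev) := by
  intro h c
  ext d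
  rw [sw_apply]
  simp only [Module.End.mul_apply, actEnd_apply]
  symm
  calc _ = sw (comul (R := k) h) fun h₁ h₂ => sw (comul (R := k) h₁) fun y₁ y₂ =>
        sw (γ d) fun b d' => ev (P.act δC (h₂ ⊗ₜ c) ⊗ₜ P.act δB (y₂ ⊗ₜ b)) •
          P.act δD (y₁ ⊗ₜ d') := by
        refine sw_congr fun h₁ h₂ => ?_
        rw [pairEnd_apply, P.sw_map_act hD.colinear _ _ (by fun_prop) (by fun_prop)]
    _ = sw (γ d) fun b d' => sw (comul (R := k) h) fun h₁ h₂ => sw (comul (R := k) h₂) fun y₁ y₂ =>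
        ev (P.act δC (y₂ ⊗ₜ c) ⊗ₜ P.act δB (y₁ ⊗ₜ b)) • P.act δD (h₁ ⊗ₜ d') := by
        rw [sw_comul_coassoc h (by fun_prop) (by fun_prop) (by fun_prop), sw_comm]
        refine sw_congr fun h₁ h₂ => ?_
        rw [sw_comm]
    _ = _ := by
        rw [pairEnd_apply, tmul_sw, map_sw]
        refine sw_congr fun b d' => ?_
        simp only [← sw_smul, hev.sw_act, mul_smul, TensorProduct.tmul_smul, map_smul]
        rw [sw_counit_right h (by fun_prop)]

/-- The exchange of `c` and `d` is an instance of the twisted coproduct, with operators on `D` as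
target. All results on `comulIn` thereby apply to the cross relation. -/
theorem crossMap_tmul (c : C) (d : D) : crossMap P δC δD γ ev (c ⊗ₜ d) =
    sw (P.comulIn δC (P.actEnd δD) (pairEnd γ ev) c) fun u c' => u d ⊗ₜ c' := by
  rw [P.sw_comulIn _ (by fun_prop) (by fun_prop)]
  simp only [crossMap, LinearMap.comp_apply, TensorProduct.map_tmul]
  rw [← LinearMap.comp_apply, map_tmul_eq_sw]
  refine sw_congr fun c₁ c₂ => ?_
  simp only [evMiddle, LinearMap.comp_apply, LinearEquiv.coe_coe, TensorProduct.assoc_tmul,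
    LinearMap.lTensor_tmul, TensorProduct.assoc_symm_tmul, LinearMap.rTensor_tmul,
    TensorProduct.lid_tmul, TensorProduct.tmul_smul, map_smul, invBraiding_tmul,
    Module.End.mul_apply, pairEnd_apply, actEnd_apply, map_sw, sw_tmul_left, smul_sw]
  simp only [TensorProduct.smul_tmul']
  rw [sw_comm]

/-- A twisted Leibniz rule: `C` acts on products through the same `End D`-valued twisted coproduct
that defines the cross relation. The braiding contributes `R` of the coaction component of `b'`;
colinearity of `ev` moves it to `c₁` at the price of an antipode, and `R ∘ S = R⁻*`. -/
theorem pairEnd_mul (hC : IsBraidedBialgebra P δC) (hD : IsBraidedComoduleAlgebra P δB δD γ)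
    (hev : IsBraidedWeakPairing δC δB ev) (c : C) (x y : D) :
    pairEnd γ ev c (x * y) = sw (P.comulIn δC (P.actEnd δD) (pairEnd γ ev) c) fun u c' =>
      u x * pairEnd γ ev c' y := by
  have hδ := hC.isComoduleAlgebra.isLeftCoaction
  rw [pairEnd_apply, P.sw_coaction_mul hD.coaction_mul _ _ (by fun_prop) (by fun_prop),
    P.sw_comulIn _ (by fun_prop) (by fun_prop), sw_comm]
  simp only [Module.End.mul_apply, pairEnd_apply _ _ _ y, mul_sw]
  trans sw (γ y) fun b' y' => sw (γ x) fun b x' => sw (comul (R := k) c) fun c₁ c₂ =>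
    sw (δC c₁) fun a c' => ev (c' ⊗ₜ b') • (ev (c₂ ⊗ₜ b) • (P.act δD (P.Rinv a ⊗ₜ x') * y'))
  · refine sw_congr fun b' y' => sw_congr fun b x' => ?_
    simp only [hev.isWeakPairing.mul_right_eq, mul_smul, sw_smul]
    rw [sw_comm]
    refine sw_congr fun c₁ c₂ => ?_
    simp only [P.isRMap.inv_eq]
    exact hev.sw_antipode hδ c₁ b' (G := fun a => ev (c₂ ⊗ₜ b) • (P.act δD (P.R a ⊗ₜ x') * y'))
      (by fun_prop)
  · trans sw (γ y) fun b' y' => sw (comul (R := k) c) fun c₁ c₂ => sw (δC c₁) fun a c' =>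
      sw (γ x) fun b x' => ev (c' ⊗ₜ b') • (ev (c₂ ⊗ₜ b) • (P.act δD (P.Rinv a ⊗ₜ x') * y'))
    · refine sw_congr fun b' y' => ?_
      rw [sw_comm]
      refine sw_congr fun c₁ c₂ => ?_
      rw [sw_comm]
    rw [sw_comm]
    refine sw_congr fun c₁ c₂ => ?_
    rw [sw_comm]
    refine sw_congr fun a c' => sw_congr fun b' y' => ?_
    rw [pairEnd_apply]
    simp only [map_sw, sw_mul, actEnd_apply, map_smul, smul_mul_assoc, mul_smul_comm, smul_sw]

end WeakQuasitriangularPair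

end Operators

/-! ### Compatibility of the twisted coaction with the cross relation. -/

section CrossRelation

open Coalgebra HopfAlgebra

namespace WeakQuasitriangularPair

variable {k A H : Type*} [Field k] [Ring A] [HopfAlgebra k A] [Ring H] [HopfAlgebra k H]
  (P : WeakQuasitriangularPair k A H)
  {T C B D : Type*} [Ring T] [Algebra k T] [Ring C] [Algebra k C]
  [Coalgebra k C] [Ring B] [Algebra k B] [Coalgebra k B] [Ring D] [Algebra k D]
  {δC : C →ₗ[k] A ⊗[k] C} {δB : B →ₗ[k] A ⊗[k] B} {δD : D →ₗ[k] A ⊗[k] D}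
  {γ : D →ₗ[k] B ⊗[k] D} {ev : C ⊗[k] B →ₗ[k] k} {f : H →ₗ[k] T} {e : C →ₗ[k] T}
  {g : B →ₗ[k] T}

theorem _root_.BraidedDouble.sw_rTensor {U U' W X : Type*} [AddCommGroup U] [Module k U]
    [AddCommGroup U'] [Module k U'] [AddCommGroup W] [Module k W] [AddCommGroup X] [Module k X]
    (L : U →ₗ[k] U') (t : U ⊗[k] W) {F : U' → W → X} (h₁ : ∀ w, Lin k fun u => F u w)
    (h₂ : ∀ u, Lin k fun w => F u w) : sw (L.rTensor W t) F = sw t fun u w => F (L u) w := by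
  rw [map_eq_sw, sw_sw _ _ h₁ h₂]
  exact sw_congr fun u w => sw_pure _ _ h₁ h₂

theorem _root_.BraidedDouble.sw_lTensor {U W W' X : Type*} [AddCommGroup U] [Module k U]
    [AddCommGroup W] [Module k W] [AddCommGroup W'] [Module k W'] [AddCommGroup X] [Module k X]
    (L : W →ₗ[k] W') (t : U ⊗[k] W) {F : U → W' → X} (h₁ : ∀ w, Lin k fun u => F u w)
    (h₂ : ∀ u, Lin k fun w => F u w) : sw (L.lTensor U t) F = sw t fun u w => F u (L w) := by
  rw [map_eq_sw, sw_sw _ _ h₁ h₂]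
  exact sw_congr fun u w => sw_pure _ _ h₁ h₂

theorem doubleCross_tmul (c : C) (b : B) : doubleCross P δC δB ev e f g (c ⊗ₜ b) =
    sw (P.comulIn δC f e c) fun t c' => sw (P.coactIn δB comul g f b) fun s b' =>
      ev (c' ⊗ₜ b') • (t * s) := by
  simp only [doubleCross, LinearMap.comp_apply, TensorProduct.map_tmul]
  rw [← LinearMap.comp_apply, ← LinearMap.comp_apply, map_tmul_eq_sw, comulIn,
    LinearMap.comp_apply, sw_rTensor _ _ (by fun_prop) (by fun_prop)]
  refine sw_congr fun t c' => ?_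
  rw [coactIn, LinearMap.comp_apply, sw_rTensor _ _ (by fun_prop) (by fun_prop)]
  refine sw_congr fun s b' => ?_
  simp [mulMap_tmul]

theorem mulMap_crossMap {X : Type*} [Ring X] [Algebra k X] (i : D →ₗ[k] X) (j : C →ₗ[k] X)
    (c : C) (d : D) : mulMap i j (crossMap P δC δD γ ev (c ⊗ₜ d)) =
      sw (P.comulIn δC (P.actEnd δD) (pairEnd γ ev) c) fun u c' => i (u d) * j c' := by
  simp only [crossMap_tmul, map_sw, mulMap_tmul]

theorem sw_coactIn_act {X : Type*} [AddCommGroup X] [Module k X]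
    (hD : IsBraidedComoduleAlgebra P δB δD γ) (h : H) (d : D) {F : T → D → X}
    (h₁ : ∀ d, Lin k fun t => F t d) (h₂ : ∀ t, Lin k fun d => F t d) :
    sw (P.coactIn δD γ g f (P.act δD (h ⊗ₜ d))) F = sw (comul (R := k) h) fun h₁ h₂ =>
      sw (γ d) fun q x => sw (δD x) fun z x' => sw (comul (R := k) z) fun z₁ z₂ =>
        P.pair (h₁ ⊗ₜ z₁) • F (g (P.act δB (h₂ ⊗ₜ q)) * f (P.Rbarinv z₂)) x' := by
  rw [P.sw_coactIn _ h₁ h₂, P.sw_map_act hD.colinear _ _ (by fun_prop) (by fun_prop)]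
  refine sw_congr fun x₁ x₂ => sw_congr fun q x => ?_
  rw [P.sw_coaction_act hD.isComoduleAlgebra.isLeftCoaction _ _ (by fun_prop) (by fun_prop)]

/-- The relation `c₋₁ d₋₁ ⊗ c₀ · d₀ = (c₋₁ · d)₋₁ c₀ ⊗ (c₋₁ · d)₀`. -/
theorem coactIn_pairEnd (hC : IsBraidedBialgebra P δC) (hD : IsBraidedComoduleAlgebra P δB δD γ)
    (hf : IsAlgMap f) (he : P.Commutes δC f e)
    (hx : ∀ c b, mulMap g e (crossMap P δC δB comul ev (c ⊗ₜ b)) =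
      doubleCross P δC δB ev e f g (c ⊗ₜ b)) (c : C) (d : D) :
    (sw (P.comulIn δC f e c) fun t c' => sw (P.coactIn δD γ g f d) fun s d' =>
      (t * s) ⊗ₜ[k] pairEnd γ ev c' d') =
    sw (P.comulIn δC (P.actEnd δD) (pairEnd γ ev) c) fun u c' =>
      sw (P.coactIn δD γ g f (u d)) fun s d' => (s * e c') ⊗ₜ[k] d' := by
  have hδ := hC.isComoduleAlgebra.isLeftCoaction
  have left (t : T) (c' : C) : (sw (P.coactIn δD γ g f d) fun s d' =>
      (t * s) ⊗ₜ[k] pairEnd γ ev c' d') = sw (γ d) fun q x => sw (δD x) fun z x' =>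
        ((sw (P.coactIn δB comul g f q) fun s y => ev (c' ⊗ₜ y) • (t * s)) *
          f (P.Rbarinv z)) ⊗ₜ[k] x' := by
    rw [P.sw_coactIn _ (by fun_prop) (by fun_prop)]
    trans sw (γ d) fun b x => sw (γ x) fun y x => sw (δB y) fun a y' => sw (δD x) fun z x' =>
      (ev (c' ⊗ₜ y') • (t * (g b * f (P.Rbarinv (a * z))))) ⊗ₜ[k] x'
    · refine sw_congr fun b x => ?_
      rw [← sw_colinear hD.colinear x (F := fun a y x' =>
        (ev (c' ⊗ₜ y) • (t * (g b * f (P.Rbarinv a)))) ⊗ₜ[k] x') (by fun_prop)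
        (by fun_prop) (by fun_prop)]
      simp only [pairEnd_apply, tmul_sw, TensorProduct.tmul_smul, TensorProduct.smul_tmul']
    rw [← hD.isLeftCoaction.sw_coassoc d (by fun_prop) (by fun_prop) (by fun_prop)]
    refine sw_congr fun q x => ?_
    simp only [P.sw_coactIn q (F := fun s y => ev (c' ⊗ₜ y) • (t * s)) (by fun_prop) (by fun_prop)]
    simp only [sw_mul, sw_tmul_left]
    conv_rhs => rw [sw_comm]
    refine sw_congr fun b y => ?_
    conv_rhs => rw [sw_comm]
    simp only [P.isRMap_bar.inv_map_mul, hf.map_mul, mul_assoc, smul_mul_assoc]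
  simp only [left]
  -- Coassociativity of `γ` collects all the factors involving `c` and the `B`-component `q` into
  -- one side of the relation of the double, followed by the remaining twist.
  trans sw (γ d) fun q x => sw (δD x) fun z x' =>
    (doubleCross P δC δB ev e f g (c ⊗ₜ q) * f (P.Rbarinv z)) ⊗ₜ[k] x'
  · rw [sw_comm]
    refine sw_congr fun q x => ?_
    rw [sw_comm]
    simp only [doubleCross_tmul, sw_mul, sw_tmul_left]
  -- This is the use of the defining relation of the double, at `c` and the `B`-component of `d`.
  simp only [← hx]
  have right (c₁ c₂ : C) : (sw (δC c₁) fun a c' => sw (P.coactIn δD γ g f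
      (P.act δD (P.Rinv a ⊗ₜ pairEnd γ ev c₂ d))) fun s d' => (s * e c') ⊗ₜ[k] d') =
      sw (γ d) fun q x => sw (δD x) fun z x' => ((sw (δC c₁) fun a c' =>
        g (P.act δB (P.Rinv a ⊗ₜ pairEnd comul ev c₂ q)) * e c') * f (P.Rbarinv z)) ⊗ₜ[k] x' := by
    trans sw (γ d) fun b d' => ev (c₂ ⊗ₜ b) • sw (δC c₁) fun a c' => sw (P.coactIn δD γ g f
      (P.act δD (P.Rinv a ⊗ₜ d'))) fun s d' => (s * e c') ⊗ₜ[k] d'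
    · have hL : Lin k fun d' => sw (δC c₁) fun a c' => sw (P.coactIn δD γ g f
        (P.act δD (P.Rinv a ⊗ₜ d'))) fun s d' => (s * e c') ⊗ₜ[k] d' := by fun_prop
      rw [pairEnd_apply, hL.map_sw]
      exact sw_congr fun _ _ => hL.2 _ _
    trans sw (γ d) fun b d' => ev (c₂ ⊗ₜ b) • sw (γ d') fun q x => sw (δD x) fun z x' =>
      ((sw (δC c₁) fun a c' => g (P.act δB (P.Rinv a ⊗ₜ q)) * e c') * f (P.Rbarinv z)) ⊗ₜ[k] x'
    · refine sw_congr fun b d' => congrArg _ ?_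
      trans sw (δC c₁) fun a c' => sw (comul (R := k) a) fun a₁ a₂ => sw (γ d') fun q x =>
        sw (δD x) fun z x' => sw (comul (R := k) z) fun z₁ z₂ => P.pair (P.Rinv a₂ ⊗ₜ z₁) •
          ((g (P.act δB (P.Rinv a₁ ⊗ₜ q)) * f (P.Rbarinv z₂) * e c') ⊗ₜ[k] x')
      · refine sw_congr fun a c' => ?_
        rw [P.sw_coactIn_act hD _ _ (by fun_prop) (by fun_prop),
          P.isRMap.sw_comul_inv _ (by fun_prop) (by fun_prop)]
      rw [hδ.sw_coassoc c₁ (by fun_prop) (by fun_prop) (by fun_prop)]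
      trans sw (δC c₁) fun a c' => sw (γ d') fun q x => sw (δD x) fun z x' =>
        (g (P.act δB (P.Rinv a ⊗ₜ q)) * (e c' * f (P.Rbarinv z))) ⊗ₜ[k] x'
      · refine sw_congr fun a c' => ?_
        rw [sw_comm]
        refine sw_congr fun q x => ?_
        rw [sw_comm]
        refine sw_congr fun z x' => ?_
        -- The coaction on `R⁻*(a) ▷ d'` leaves a factor `⟨R⁻*, z₁⟩` between the coaction components
        -- of `c'` and of `d'`. It serves to bring `e(c')` in front of `f(Rbar⁻*(z))`.
        simp only [← he.pair_Rinv P hδ, mul_sw, sw_tmul_left, mul_smul_comm,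
          TensorProduct.smul_tmul', mul_assoc]
      · rw [sw_comm]
        refine sw_congr fun q x => ?_
        rw [sw_comm]
        simp only [sw_mul, sw_tmul_left, mul_assoc]
    simp only [smul_sw]
    rw [← hD.isLeftCoaction.sw_coassoc d (by fun_prop) (by fun_prop) (by fun_prop)]
    refine sw_congr fun q x => ?_
    rw [sw_comm]
    refine sw_congr fun z x' => ?_
    have hL : Lin k fun q => ((sw (δC c₁) fun a c' => g (P.act δB (P.Rinv a ⊗ₜ q)) * e c') *
      f (P.Rbarinv z)) ⊗ₜ[k] x' := by fun_prop
    rw [pairEnd_apply, hL.map_sw]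
    exact sw_congr fun _ _ => (hL.2 _ _).symm
  rw [P.sw_comulIn _ (by fun_prop) (by fun_prop)]
  simp only [Module.End.mul_apply, actEnd_apply, right]
  rw [sw_comm]
  refine sw_congr fun q x => ?_
  rw [sw_comm]
  refine sw_congr fun z x' => ?_
  rw [mulMap_crossMap, P.sw_comulIn _ (by fun_prop) (by fun_prop)]
  simp only [Module.End.mul_apply, actEnd_apply, sw_mul, sw_tmul_left]

/-- The endomorphism-valued intertwining condition behind the compatibility of the coaction with
the cross relation: `w = ∑ t ⊗ u` and `w' = ∑ u' ⊗ t'` satisfy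
`t d₋₁ ⊗ u(d₀) = (u' d)₋₁ t' ⊗ (u' d)₀`. -/
def Intertwines (Φ : D →ₗ[k] T ⊗[k] D) (w : T ⊗[k] Module.End k D)
    (w' : Module.End k D ⊗[k] T) : Prop :=
  ∀ d, (sw w fun t u => sw (Φ d) fun s d' => (t * s) ⊗ₜ[k] u d') =
    sw w' fun u t => sw (Φ (u d)) fun s d' => (s * t) ⊗ₜ[k] d'

/-- The values of `comulIn` are products of a factor from `H` and a factor from `C`. Closure under
products allows the two to be intertwined separately. -/
theorem Intertwines.mul {Φ : D →ₗ[k] T ⊗[k] D} {w₁ w₂ : T ⊗[k] Module.End k D}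
    {w₁' w₂' : Module.End k D ⊗[k] T} (h₁ : Intertwines Φ w₁ w₁') (h₂ : Intertwines Φ w₂ w₂') :
    Intertwines Φ (w₁ * w₂) (w₁' * w₂') := by
  intro d
  calc _ = sw w₁ fun t₁ u₁ => sw w₂ fun t₂ u₂ => sw (Φ d) fun s d' =>
        (t₁ * (t₂ * s)) ⊗ₜ[k] u₁ (u₂ d') := by
        rw [sw_mul_of_bilinear _ _ (by fun_prop) (by fun_prop)]
        simp only [mul_assoc, Module.End.mul_apply]
    _ = sw w₁ fun t₁ u₁ => sw w₂' fun u₂ t₂ => sw (Φ (u₂ d)) fun s d' =>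
        (t₁ * (s * t₂)) ⊗ₜ[k] u₁ d' := by
        refine sw_congr fun t₁ u₁ => ?_
        have := congrArg (TensorProduct.map (LinearMap.mulLeft k t₁) u₁) (h₂ d)
        simpa only [map_sw, TensorProduct.map_tmul, LinearMap.mulLeft_apply] using this
    _ = sw w₂' fun u₂ t₂ => sw w₁' fun u₁ t₁ => sw (Φ (u₁ (u₂ d))) fun s d' =>
        (s * (t₁ * t₂)) ⊗ₜ[k] d' := by
        rw [sw_comm]
        refine sw_congr fun u₂ t₂ => ?_
        have := congrArg ((LinearMap.mulRight k t₂).rTensor D) (h₁ (u₂ d))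
        simpa only [map_sw, LinearMap.rTensor_tmul, LinearMap.mulRight_apply, mul_assoc] using this
    _ = _ := by
        rw [sw_mul_of_bilinear _ _ (by fun_prop) (by fun_prop), sw_comm]
        simp only [Module.End.mul_apply]

theorem intertwines_comulH (hD : IsBraidedComoduleAlgebra P δB δD γ)
    (hf : IsAlgMap f) (hg : P.Commutes δB f g) (h : H) : Intertwines (P.coactIn δD γ g f)
      (comulH f (P.actEnd δD) h) (comulH (P.actEnd δD) f h) := by
  intro d
  simp only [comulH_apply]
  rw [sw_sw _ _ (by fun_prop) (by fun_prop), sw_sw _ _ (by fun_prop) (by fun_prop)]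
  have h₁ (x y : H) : (sw (f y ⊗ₜ[k] P.actEnd δD x) fun t u => sw (P.coactIn δD γ g f d) fun s d' =>
      (t * s) ⊗ₜ[k] u d') = sw (P.coactIn δD γ g f d) fun s d' =>
      (f y * s) ⊗ₜ[k] P.act δD (x ⊗ₜ d') := sw_pure _ _ (by fun_prop) (by fun_prop)
  have h₂ (x y : H) : (sw (P.actEnd δD y ⊗ₜ[k] f x) fun u t => sw (P.coactIn δD γ g f (u d))
      fun s d' => (s * t) ⊗ₜ[k] d') = sw (P.coactIn δD γ g f (P.act δD (y ⊗ₜ d))) fun s d' =>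
      (s * f x) ⊗ₜ[k] d' := sw_pure _ _ (by fun_prop) (by fun_prop)
  simp only [h₁, h₂]
  exact P.coactIn_act hD hf hg h d

theorem intertwines_comulIn (hC : IsBraidedBialgebra P δC)
    (hD : IsBraidedComoduleAlgebra P δB δD γ) (hf : IsAlgMap f) (he : P.Commutes δC f e)
    (hx : ∀ c b, mulMap g e (crossMap P δC δB comul ev (c ⊗ₜ b)) =
      doubleCross P δC δB ev e f g (c ⊗ₜ b)) (c : C) : Intertwines (P.coactIn δD γ g f)
      ((pairEnd γ ev).lTensor T (P.comulIn δC f e c))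
      (e.lTensor _ (P.comulIn δC (P.actEnd δD) (pairEnd γ ev) c)) := by
  intro d
  rw [sw_lTensor _ _ (by fun_prop) (by fun_prop), sw_lTensor _ _ (by fun_prop) (by fun_prop)]
  exact P.coactIn_pairEnd hC hD hf he hx c d

theorem sw_comulIn_comulIn {T' Y : Type*} [Ring T'] [Algebra k T'] [AddCommGroup Y] [Module k Y]
    {f' : H →ₗ[k] T'} {e' : C →ₗ[k] T'} (hC : IsBraidedBialgebra P δC) (hf : IsAlgMap f) (c : C)
    {F : T ⊗[k] T' → C → Y} (h₁ : ∀ c, Lin k fun t => F t c) (h₂ : ∀ t, Lin k fun c => F t c) :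
    sw (P.comulIn δC (comulH f f') (e'.lTensor T ∘ₗ P.comulIn δC f e) c) F =
      sw (P.comulIn δC f e c) fun t c' => sw (P.comulIn δC f' e' c') fun t' c'' =>
        F (t ⊗ₜ t') c'' := by
  rw [P.sw_comulIn_coassoc hC hf, sw_sw _ _ h₁ h₂]
  refine sw_congr fun t c' => ?_
  rw [sw_sw _ _ h₁ h₂]
  exact sw_congr fun t' c'' => sw_pure _ _ h₁ h₂

theorem sw_coactIn_coactIn {T' Y : Type*} [Ring T'] [Algebra k T'] [AddCommGroup Y] [Module k Y]
    {f' : H →ₗ[k] T'} {g' : B →ₗ[k] T'} (hD : IsBraidedComoduleAlgebra P δB δD γ)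
    (hf : IsAlgMap f) (d : D) {F : T ⊗[k] T' → D → Y} (h₁ : ∀ d, Lin k fun t => F t d)
    (h₂ : ∀ t, Lin k fun d => F t d) :
    sw (P.coactIn δD γ (g'.lTensor T ∘ₗ P.coactIn δB comul g f) (comulH f f') d) F =
      sw (P.coactIn δD γ g f d) fun t d' => sw (P.coactIn δD γ g' f' d') fun t' d'' =>
        F (t ⊗ₜ t') d'' := by
  rw [P.sw_coactIn_coassoc hD hf, sw_sw _ _ h₁ h₂]
  refine sw_congr fun t c' => ?_
  rw [sw_sw _ _ h₁ h₂]
  exact sw_congr fun t' c'' => sw_pure _ _ h₁ h₂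

/-- On the left, the operators of the cross relation are applied before the coaction; on the right,
after it. By `sw_comulIn_comulIn` both sides are sums over a single `comulIn` of `c`, with targets
`End D ⊗ T` and `T ⊗ End D`. When `X` satisfies the cross relation, the right-hand side is the
product of the images of `c` and `d`. -/
theorem coactIn_crossMap {X : Type*} [Ring X] [Algebra k X] (i : D →ₗ[k] X) (j : C →ₗ[k] X)
    (hC : IsBraidedBialgebra P δC) (hD : IsBraidedComoduleAlgebra P δB δD γ)
    (hf : IsAlgMap f) (he : P.Commutes δC f e) (hg : P.Commutes δB f g)
    (hx : ∀ c b, mulMap g e (crossMap P δC δB comul ev (c ⊗ₜ b)) =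
      doubleCross P δC δB ev e f g (c ⊗ₜ b)) (c : C) (d : D) :
    mulMap (i.lTensor T ∘ₗ P.coactIn δD γ g f) (j.lTensor T ∘ₗ P.comulIn δC f e)
      (crossMap P δC δD γ ev (c ⊗ₜ d)) =
    sw (P.comulIn δC f e c) fun t c' => sw (P.coactIn δD γ g f d) fun s d' =>
      (t * s) ⊗ₜ mulMap i j (crossMap P δC δD γ ev (c' ⊗ₜ d')) := by
  have hf' := P.isAlgMap_actEnd hD.isComoduleAlgebra.isLeftCoaction
  have key (w : T ⊗[k] Module.End k D) (w' : Module.End k D ⊗[k] T)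
      (h : Intertwines (P.coactIn δD γ g f) w w') (c : C) :
      (sw w fun t u => sw (P.coactIn δD γ g f d) fun s d' => (t * s) ⊗ₜ[k] (i (u d') * j c)) =
      sw w' fun u t => sw (P.coactIn δD γ g f (u d)) fun s d' =>
        (s * t) ⊗ₜ[k] (i d' * j c) := by
    have := congrArg ((LinearMap.mulRight k (j c) ∘ₗ i).lTensor T) (h d)
    simpa only [map_sw, LinearMap.lTensor_tmul, LinearMap.comp_apply,
      LinearMap.mulRight_apply] using this
  calc _ = sw (P.comulIn δC (P.actEnd δD) (pairEnd γ ev) c) fun u c' =>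
        sw (P.comulIn δC f e c') fun t c'' => sw (P.coactIn δD γ g f (u d)) fun s d' =>
          (s * t) ⊗ₜ[k] (i d' * j c'') := by
        rw [mulMap_crossMap]
        refine sw_congr fun u c' => ?_
        rw [LinearMap.comp_apply, LinearMap.comp_apply, map_eq_sw, map_eq_sw (j.lTensor T)]
        simp only [sw_mul, mul_sw, LinearMap.lTensor_tmul, Algebra.TensorProduct.tmul_mul_tmul]
    _ = sw (P.comulIn δC (comulH (P.actEnd δD) f) (e.lTensor _ ∘ₗ P.comulIn δC (P.actEnd δD)
          (pairEnd γ ev)) c) fun w' c'' => sw w' fun u t =>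
          sw (P.coactIn δD γ g f (u d)) fun s d' => (s * t) ⊗ₜ[k] (i d' * j c'') := by
        rw [P.sw_comulIn_comulIn hC hf' _ (by fun_prop) (by fun_prop)]
        refine sw_congr fun u c' => sw_congr fun t c'' => ?_
        rw [sw_pure _ _ (by fun_prop) (by fun_prop)]
    _ = sw (P.comulIn δC (comulH f (P.actEnd δD)) ((pairEnd γ ev).lTensor T ∘ₗ
          P.comulIn δC f e) c) fun w c'' => sw w fun t u =>
          sw (P.coactIn δD γ g f d) fun s d' => (t * s) ⊗ₜ[k] (i (u d') * j c'') := by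
        rw [P.sw_comulIn _ (by fun_prop) (by fun_prop), P.sw_comulIn _ (by fun_prop) (by fun_prop)]
        refine sw_congr fun c₁ c₂ => sw_congr fun a c' => (key _ _ ?_ c').symm
        -- For fixed `c₁`, `c₂` and coaction component `a`, the two tensors are products of a value
        -- of `comulH` at `R⁻*(a)` and a factor from `c₂`.
        exact (P.intertwines_comulH hD hf hg _).mul (P.intertwines_comulIn hC hD hf he hx _)
    _ = _ := by
        rw [P.sw_comulIn_comulIn hC hf _ (by fun_prop) (by fun_prop)]
        refine sw_congr fun t c' => ?_
        simp only [mulMap_crossMap, tmul_sw]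
        rw [sw_comm]
        refine sw_congr fun u c'' => ?_
        rw [sw_pure _ _ (by fun_prop) (by fun_prop)]

end WeakQuasitriangularPair

end CrossRelation

/-! ### Representations of the presented algebras and their tensor products. -/

section Representations

open Coalgebra HopfAlgebra

variable {k A H B C D : Type*} [Field k] [Ring A] [HopfAlgebra k A] [Ring H] [HopfAlgebra k H]
  [Ring B] [Algebra k B] [Coalgebra k B] [Ring C] [Algebra k C] [Coalgebra k C]
  [Ring D] [Algebra k D]
  (P : WeakQuasitriangularPair k A H) (δB : B →ₗ[k] A ⊗[k] B) (δC : C →ₗ[k] A ⊗[k] C)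
  (δD : D →ₗ[k] A ⊗[k] D) (γ : D →ₗ[k] B ⊗[k] D) (ev : C ⊗[k] B →ₗ[k] k)
  {T X : Type*} [Ring T] [Algebra k T] [Ring X] [Algebra k X]

/-- Linear maps from `C`, `H`, `B` to an algebra satisfying the relations of the double. -/
structure IsDrinRep (e : C →ₗ[k] T) (f : H →ₗ[k] T) (g : B →ₗ[k] T) : Prop where
  algC : IsAlgMap e
  algH : IsAlgMap f
  algB : IsAlgMap g
  cross : ∀ c b, mulMap g e (crossMap P δC δB comul ev (c ⊗ₜ b)) =
    doubleCross P δC δB ev e f g (c ⊗ₜ b)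
  actB : P.Commutes δB f g
  actC : P.Commutes δC f e

/-- Linear maps from `D`, `C` to an algebra satisfying the relations of `D ⋊ ᶜᵒᵖC`. -/
structure IsCrossRep (i : D →ₗ[k] X) (j : C →ₗ[k] X) : Prop where
  algD : IsAlgMap i
  algC : IsAlgMap j
  cross : ∀ c d, j c * i d = mulMap i j (crossMap P δC δD γ ev (c ⊗ₜ d))

/-- Linear maps from `D`, `C`, `H` to an algebra satisfying the relations of
`D ⋊ ᶜᵒᵖC ⋊ H`. -/
structure IsIterRep (i : D →ₗ[k] X) (j : C →ₗ[k] X) (l : H →ₗ[k] X) : Prop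
    extends IsCrossRep P δC δD γ ev i j where
  algH : IsAlgMap l
  actD : P.Commutes δD l i
  actC : P.Commutes δC l j

variable {P δB δC δD γ ev}

/-- `B` coacts on itself, so the coproduct of the double on `B` is the case `D = B` of the results
on `coactIn`. -/
theorem IsBraidedBialgebra.isBraidedComoduleAlgebra (hB : IsBraidedBialgebra P δB) :
    IsBraidedComoduleAlgebra P δB δB comul where
  isComoduleAlgebra := hB.isComoduleAlgebra
  isLeftCoaction := isLeftCoaction_comul
  colinear := hB.comul_colinear
  coaction_mul := hB.comul_mul
  coaction_one := hB.comul_one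

theorem IsAlgMap.comp {U : Type*} [Ring U] [Algebra k U] {f : U →ₗ[k] T} (hf : IsAlgMap f)
    (φ : T →ₐ[k] X) : IsAlgMap (φ.toLinearMap ∘ₗ f) where
  map_mul u v := by simp [hf.map_mul]
  map_one := by simp [hf.map_one]

/-- The homomorphism with a given underlying linear map. -/
def IsAlgMap.toAlgHom {f : T →ₗ[k] X} (hf : IsAlgMap f) : T →ₐ[k] X :=
  AlgHom.ofLinearMap f hf.map_one hf.map_mul

theorem IsAlgMap.lTensor_comp {U V : Type*} [Ring U] [Algebra k U] [Ring V] [Algebra k V]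
    {j : V →ₗ[k] X} (hj : IsAlgMap j) {Φ : U →ₗ[k] T ⊗[k] V} (hΦ : IsAlgMap Φ) :
    IsAlgMap (j.lTensor T ∘ₗ Φ) :=
  hΦ.comp (Algebra.TensorProduct.map (AlgHom.id k T) hj.toAlgHom)

variable {e : C →ₗ[k] T} {f : H →ₗ[k] T} {g : B →ₗ[k] T}

theorem IsDrinRep.isAlgMap_comulIn (hT : IsDrinRep P δB δC ev e f g)
    (hC : IsBraidedBialgebra P δC) : IsAlgMap (P.comulIn δC f e) :=
  ⟨P.comulIn_mul hC hT.algH hT.algC hT.actC, P.comulIn_one hC hT.algH hT.algC⟩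

theorem IsDrinRep.isAlgMap_coactIn (hT : IsDrinRep P δB δC ev e f g)
    (hD : IsBraidedComoduleAlgebra P δB δD γ) : IsAlgMap (P.coactIn δD γ g f) :=
  ⟨P.coactIn_mul hD hT.algH hT.algB hT.actB, P.coactIn_one hD hT.algH hT.algB⟩

/-- The double acts on representations from the left: this is the existence of the coaction on the
cross product, stated before any quotient is formed. -/
theorem IsCrossRep.tensor {i : D →ₗ[k] X} {j : C →ₗ[k] X} (hX : IsCrossRep P δC δD γ ev i j)
    (hT : IsDrinRep P δB δC ev e f g) (hC : IsBraidedBialgebra P δC)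
    (hD : IsBraidedComoduleAlgebra P δB δD γ) :
    IsCrossRep P δC δD γ ev (i.lTensor T ∘ₗ P.coactIn δD γ g f)
      (j.lTensor T ∘ₗ P.comulIn δC f e) where
  algD := hX.algD.lTensor_comp (hT.isAlgMap_coactIn hD)
  algC := hX.algC.lTensor_comp (hT.isAlgMap_comulIn hC)
  cross c d := by
    rw [P.coactIn_crossMap i j hC hD hT.algH hT.actC hT.actB hT.cross, LinearMap.comp_apply,
      LinearMap.comp_apply, map_eq_sw, map_eq_sw (i.lTensor T)]
    simp only [← hX.cross, sw_mul, mul_sw, LinearMap.lTensor_tmul,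
      Algebra.TensorProduct.tmul_mul_tmul]
    rw [sw_comm]

theorem IsIterRep.tensor {i : D →ₗ[k] X} {j : C →ₗ[k] X} {l : H →ₗ[k] X}
    (hX : IsIterRep P δC δD γ ev i j l)
    (hT : IsDrinRep P δB δC ev e f g) (hC : IsBraidedBialgebra P δC)
    (hD : IsBraidedComoduleAlgebra P δB δD γ) :
    IsIterRep P δC δD γ ev (i.lTensor T ∘ₗ P.coactIn δD γ g f)
      (j.lTensor T ∘ₗ P.comulIn δC f e) (comulH f l) where
  toIsCrossRep := hX.toIsCrossRep.tensor hT hC hD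
  algH := hT.algH.comulH hX.algH
  actD := P.commutes_comulH (P.coactIn_act hD hT.algH hT.actB) hX.actD
  actC := P.commutes_comulH (P.comulIn_act hC hT.algH hT.actC) hX.actC

/-- The relation of the double is used twice: in `T`, to move the operators past the twisted
coaction (`coactIn_crossMap` with `D = B`), and in `X`, to replace the inner exchange by
`doubleCross`. Coassociativity of both twisted maps then assembles `doubleCross` in `T ⊗ X`. -/
theorem IsDrinRep.tensor {e' : C →ₗ[k] X} {f' : H →ₗ[k] X} {g' : B →ₗ[k] X}
    (hT : IsDrinRep P δB δC ev e f g) (hX : IsDrinRep P δB δC ev e' f' g')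
    (hB : IsBraidedBialgebra P δB) (hC : IsBraidedBialgebra P δC) :
    IsDrinRep P δB δC ev (e'.lTensor T ∘ₗ P.comulIn δC f e) (comulH f f')
      (g'.lTensor T ∘ₗ P.coactIn δB comul g f) where
  algC := hX.algC.lTensor_comp (hT.isAlgMap_comulIn hC)
  algH := hT.algH.comulH hX.algH
  algB := hX.algB.lTensor_comp (hT.isAlgMap_coactIn hB.isBraidedComoduleAlgebra)
  actB := P.commutes_comulH (P.coactIn_act hB.isBraidedComoduleAlgebra hT.algH hT.actB) hX.actB
  actC := P.commutes_comulH (P.comulIn_act hC hT.algH hT.actC) hX.actC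
  cross c b := by
    have hB' := hB.isBraidedComoduleAlgebra
    rw [P.coactIn_crossMap g' e' hC hB' hT.algH hT.actC hT.actB hT.cross, P.doubleCross_tmul,
      P.sw_comulIn_comulIn hC hT.algH _ (by fun_prop) (by fun_prop)]
    refine sw_congr fun t c' => ?_
    simp only [hX.cross, P.doubleCross_tmul, tmul_sw]
    rw [sw_comm]
    refine sw_congr fun t' c'' => ?_
    rw [P.sw_coactIn_coactIn hB' hT.algH _ (by fun_prop) (by fun_prop)]
    simp only [TensorProduct.tmul_smul, Algebra.TensorProduct.tmul_mul_tmul]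

/-! ## The counit -/

theorem IsBraidedBialgebra.sw_counit_coaction {Y : Type*} [AddCommGroup Y] [Module k Y]
    (hB : IsBraidedBialgebra P δB) (b : B) {F : A → Y} (hF : Lin k F) :
    (sw (δB b) fun a b' => counit (R := k) b' • F a) = counit (R := k) b • F 1 := by
  have := congrArg (fun t => sw t fun a r => r • F a) (LinearMap.congr_fun hB.counit_colinear b)
  simp only [LinearMap.comp_apply, TensorProduct.mk_apply] at this
  rw [sw_lTensor _ _ (by fun_prop) (by fun_prop), sw_pure _ _ (by fun_prop) (by fun_prop)] at this
  exact this

theorem IsBraidedBialgebra.counit_act (hB : IsBraidedBialgebra P δB) (h : H) (b : B) :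
    counit (R := k) (P.act δB (h ⊗ₜ b)) = counit (R := k) h * counit (R := k) b := by
  rw [P.act_tmul, map_sw, ← P.isWeakPairing.one_right, mul_comm, ← smul_eq_mul,
    ← hB.sw_counit_coaction b (F := fun a => P.pair (h ⊗ₜ a)) (by fun_prop)]
  refine sw_congr fun a b' => ?_
  rw [map_smul, smul_eq_mul, smul_eq_mul, mul_comm]

theorem IsBraidedBialgebra.isAlgMap_counit (hB : IsBraidedBialgebra P δB) :
    IsAlgMap (counit (R := k) (A := B)) :=
  ⟨hB.counit_mul, hB.counit_one⟩

theorem IsBraidedBialgebra.commutes_counit (hB : IsBraidedBialgebra P δB) :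
    P.Commutes δB (counit (R := k) (A := H)) (counit (R := k) (A := B)) := by
  intro h b
  simp only [hB.counit_act]
  rw [← sw_counit_left (k := k) h (F := fun h => counit (R := k) h * counit (R := k) b) (by fun_prop)]
  refine sw_congr fun h₁ h₂ => ?_
  rw [smul_eq_mul, mul_comm]

/-- With target `k` the twists disappear, and both sides of the cross relation reduce to `ev(c, b)`.
-/
theorem isDrinRep_counit (hB : IsBraidedBialgebra P δB) (hC : IsBraidedBialgebra P δC) :
    IsDrinRep P δB δC ev (counit (R := k) (A := C)) (counit (R := k) (A := H))
      (counit (R := k) (A := B)) where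
  algC := hC.isAlgMap_counit
  algH := ⟨Bialgebra.counit_mul, Bialgebra.counit_one⟩
  algB := hB.isAlgMap_counit
  actB := hB.commutes_counit
  actC := hC.commutes_counit
  cross c b := by
    have hδ := hC.isComoduleAlgebra.isLeftCoaction
    rw [P.doubleCross_tmul, P.comulIn_counit hC, sw_pure _ _ (by fun_prop) (by fun_prop),
      P.coactIn_counit hB.isBraidedComoduleAlgebra, sw_pure _ _ (by fun_prop) (by fun_prop),
      P.mulMap_crossMap, P.sw_comulIn _ (by fun_prop) (by fun_prop)]
    have h₁ (c : C) : counit (R := k) (pairEnd comul ev c b) = ev (c ⊗ₜ b) := by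
      rw [pairEnd_apply, map_sw, ← sw_counit_right (k := k) b (F := fun b => ev (c ⊗ₜ b)) (by fun_prop)]
      refine sw_congr fun b₁ b₂ => ?_
      rw [map_smul, smul_eq_mul, smul_eq_mul, mul_comm]
    simp only [Module.End.mul_apply, P.actEnd_apply, hB.counit_act, h₁, P.isRMap.counit_inv]
    rw [mul_one, smul_eq_mul, mul_one, ← sw_counit_left (k := k) c (F := fun c => ev (c ⊗ₜ b)) (by fun_prop)]
    refine sw_congr fun c₁ c₂ => ?_
    rw [smul_eq_mul, mul_comm, ← smul_eq_mul, ← hδ.sw_counit c₁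
      (F := fun c₁ => ev (c₂ ⊗ₜ b) • counit (R := k) c₁) (by fun_prop)]
    refine sw_congr fun a c' => ?_
    simp only [smul_eq_mul, mul_assoc]

end Representations

/-! ### Universal properties of the three presented algebras. -/

section Presentations

open Coalgebra HopfAlgebra

variable {k A H B C D : Type*} [Field k] [Ring A] [HopfAlgebra k A] [Ring H] [HopfAlgebra k H]
  [Ring B] [Algebra k B] [Coalgebra k B] [Ring C] [Algebra k C] [Coalgebra k C]
  [Ring D] [Algebra k D]
  (P : WeakQuasitriangularPair k A H) (δB : B →ₗ[k] A ⊗[k] B) (δC : C →ₗ[k] A ⊗[k] C)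
  (δD : D →ₗ[k] A ⊗[k] D) (γ : D →ₗ[k] B ⊗[k] D) (ev : C ⊗[k] B →ₗ[k] k)
  {T X : Type*} [Ring T] [Algebra k T] [Ring X] [Algebra k X]

theorem map_mulMap {U V : Type*} [AddCommGroup U] [Module k U] [AddCommGroup V] [Module k V]
    (φ : T →ₐ[k] X) (f : U →ₗ[k] T) (g : V →ₗ[k] T) (t : U ⊗[k] V) :
    φ (mulMap f g t) = mulMap (φ.toLinearMap ∘ₗ f) (φ.toLinearMap ∘ₗ g) t := by
  rw [map_eq_sw (mulMap f g) t,
    map_eq_sw (mulMap (φ.toLinearMap ∘ₗ f) (φ.toLinearMap ∘ₗ g)) t, map_sw]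
  simp only [mulMap_tmul, map_mul, LinearMap.comp_apply, AlgHom.toLinearMap_apply]

theorem map_doubleCross (φ : T →ₐ[k] X) (e : C →ₗ[k] T) (f : H →ₗ[k] T) (g : B →ₗ[k] T)
    (t : C ⊗[k] B) : φ (doubleCross P δC δB ev e f g t) = doubleCross P δC δB ev
      (φ.toLinearMap ∘ₗ e) (φ.toLinearMap ∘ₗ f) (φ.toLinearMap ∘ₗ g) t := by
  rw [map_eq_sw (doubleCross P δC δB ev e f g) t, map_eq_sw (doubleCross P δC δB ev
    (φ.toLinearMap ∘ₗ e) (φ.toLinearMap ∘ₗ f) (φ.toLinearMap ∘ₗ g)) t, map_sw]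
  refine sw_congr fun c b => ?_
  rw [P.doubleCross_tmul, P.doubleCross_tmul, ← P.comulIn_comp,
    sw_rTensor _ _ (by fun_prop) (by fun_prop), map_sw]
  refine sw_congr fun t c' => ?_
  rw [← P.coactIn_comp, sw_rTensor _ _ (by fun_prop) (by fun_prop), map_sw]
  simp

theorem algRel_map {U : Type*} [Ring U] [Algebra k U] {f : U →ₗ[k] T} {φ : T →ₐ[k] X}
    (h : IsAlgMap (φ.toLinearMap ∘ₗ f)) {x y : T} (hxy : AlgRel f x y) : φ x = φ y := by
  cases hxy with
  | mul u v => simpa using h.map_mul u v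
  | one => simpa using h.map_one

theorem isAlgMap_of_algRel {U : Type*} [Ring U] [Algebra k U] {f : U →ₗ[k] T} {φ : T →ₐ[k] X}
    (h : ∀ x y, AlgRel f x y → φ x = φ y) : IsAlgMap (φ.toLinearMap ∘ₗ f) where
  map_mul u v := by simpa using h _ _ (AlgRel.mul u v)
  map_one := by simpa using h _ _ AlgRel.one

theorem commutes_iff {V : Type*} [AddCommGroup V] [Module k V] {δV : V →ₗ[k] A ⊗[k] V}
    {f : H →ₗ[k] T} {g : V →ₗ[k] T} : P.Commutes δV f g ↔
      ∀ t, mulMap f g t = mulMap g f (P.actSwap δV t) := by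
  have h (h : H) (v : V) : mulMap g f (P.actSwap δV (h ⊗ₜ v)) =
      sw (comul (R := k) h) fun h₁ h₂ => g (P.act δV (h₂ ⊗ₜ v)) * f h₁ := by
    rw [P.actSwap_tmul, map_sw]
    simp only [mulMap_tmul]
  constructor
  · intro hc t
    have : mulMap f g = mulMap g f ∘ₗ P.actSwap δV :=
      TensorProduct.ext' fun x v => by rw [mulMap_tmul, LinearMap.comp_apply, h, hc]
    exact LinearMap.congr_fun this t
  · intro hc x v
    rw [← h, ← hc, mulMap_tmul]

section FreeLift

variable {U V W : Type*} [AddCommGroup U] [Module k U] [AddCommGroup V] [Module k V]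
  [AddCommGroup W] [Module k W] (a : U →ₗ[k] T) (b : V →ₗ[k] T) (c : W →ₗ[k] T)

/-- The homomorphism from the tensor algebra on `U ⊕ V ⊕ W` extending three linear maps. -/
def freeLift : Free₃ k U V W →ₐ[k] T := TensorAlgebra.lift k (a.coprod (b.coprod c))

theorem freeLift_gen₁ : (freeLift a b c).toLinearMap ∘ₗ gen₁ k U V W = a := by
  ext u; simp [freeLift, gen₁]

theorem freeLift_gen₂ : (freeLift a b c).toLinearMap ∘ₗ gen₂ k U V W = b := by
  ext u; simp [freeLift, gen₂]

theorem freeLift_gen₃ : (freeLift a b c).toLinearMap ∘ₗ gen₃ k U V W = c := by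
  ext u; simp [freeLift, gen₃]

theorem free_hom_ext {T : Type*} [Semiring T] [Algebra k T] {φ ψ : Free₃ k U V W →ₐ[k] T} (h₁ : ∀ u, φ (gen₁ k U V W u) = ψ (gen₁ k U V W u))
    (h₂ : ∀ u, φ (gen₂ k U V W u) = ψ (gen₂ k U V W u))
    (h₃ : ∀ u, φ (gen₃ k U V W u) = ψ (gen₃ k U V W u)) : φ = ψ := by
  refine TensorAlgebra.hom_ext (LinearMap.prod_ext ?_ (LinearMap.prod_ext ?_ ?_))
  · ext u; exact h₁ u
  · ext u; exact h₂ u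
  · ext u; exact h₃ u

end FreeLift

namespace Drin

theorem isDrinRep : IsDrinRep P δB δC ev (ofC P δB δC ev) (ofH P δB δC ev) (ofB P δB δC ev) where
  algC := isAlgMap_of_algRel fun _ _ h => RingQuot.mkAlgHom_rel k (.algC h)
  algH := isAlgMap_of_algRel fun _ _ h => RingQuot.mkAlgHom_rel k (.algH h)
  algB := isAlgMap_of_algRel fun _ _ h => RingQuot.mkAlgHom_rel k (.algB h)
  cross c b := by
    have := RingQuot.mkAlgHom_rel k (DrinRel.cross (P := P) (δB := δB) (δC := δC) (ev := ev) (c ⊗ₜ b))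
    rw [map_mulMap, map_doubleCross] at this
    exact this
  actB := (commutes_iff P).2 fun t => by
    have := RingQuot.mkAlgHom_rel k (DrinRel.actB (P := P) (δB := δB) (δC := δC) (ev := ev) t)
    rw [map_mulMap, map_mulMap] at this
    exact this
  actC := (commutes_iff P).2 fun t => by
    have := RingQuot.mkAlgHom_rel k (DrinRel.actC (P := P) (δB := δB) (δC := δC) (ev := ev) t)
    rw [map_mulMap, map_mulMap] at this
    exact this

variable {P δB δC ev} {e : C →ₗ[k] T} {f : H →ₗ[k] T} {g : B →ₗ[k] T}

/-- The universal property of the double. -/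
def lift (h : IsDrinRep P δB δC ev e f g) : Drin P δB δC ev →ₐ[k] T :=
  RingQuot.liftAlgHom k ⟨freeLift e f g, by
    intro x y hxy
    cases hxy with
    | algC h' => exact algRel_map (by rw [freeLift_gen₁]; exact h.algC) h'
    | algH h' => exact algRel_map (by rw [freeLift_gen₂]; exact h.algH) h'
    | algB h' => exact algRel_map (by rw [freeLift_gen₃]; exact h.algB) h'
    | cross t =>
      rw [map_mulMap, map_doubleCross, freeLift_gen₁, freeLift_gen₂, freeLift_gen₃]
      have : mulMap g e ∘ₗ crossMap P δC δB comul ev = doubleCross P δC δB ev e f g :=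
        TensorProduct.ext' fun c b => h.cross c b
      exact LinearMap.congr_fun this t
    | actB t => rw [map_mulMap, map_mulMap, freeLift_gen₂, freeLift_gen₃]
                exact (commutes_iff P).1 h.actB t
    | actC t => rw [map_mulMap, map_mulMap, freeLift_gen₂, freeLift_gen₁]
                exact (commutes_iff P).1 h.actC t⟩

theorem lift_comp_mk (h : IsDrinRep P δB δC ev e f g) (x : Free₃ k C H B) :
    lift h (Drin.mk P δB δC ev x) = freeLift e f g x :=
  RingQuot.liftAlgHom_mkAlgHom_apply _ _ _ _

theorem lift_ofC (h : IsDrinRep P δB δC ev e f g) (c : C) : lift h (ofC P δB δC ev c) = e c :=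
  (lift_comp_mk h _).trans (LinearMap.congr_fun (freeLift_gen₁ e f g) c)

theorem lift_ofH (h : IsDrinRep P δB δC ev e f g) (c : H) : lift h (ofH P δB δC ev c) = f c :=
  (lift_comp_mk h _).trans (LinearMap.congr_fun (freeLift_gen₂ e f g) c)

theorem lift_ofB (h : IsDrinRep P δB δC ev e f g) (c : B) : lift h (ofB P δB δC ev c) = g c :=
  (lift_comp_mk h _).trans (LinearMap.congr_fun (freeLift_gen₃ e f g) c)

theorem hom_ext {T : Type*} [Semiring T] [Algebra k T] {φ ψ : Drin P δB δC ev →ₐ[k] T}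
    (hC : ∀ c, φ (ofC P δB δC ev c) = ψ (ofC P δB δC ev c))
    (hH : ∀ c, φ (ofH P δB δC ev c) = ψ (ofH P δB δC ev c))
    (hB : ∀ c, φ (ofB P δB δC ev c) = ψ (ofB P δB δC ev c)) : φ = ψ :=
  RingQuot.ringQuot_ext' _ _ _ (free_hom_ext hC hH hB)

end Drin

namespace Cross

theorem isCrossRep : IsCrossRep P δC δD γ ev (ofD P δC δD γ ev) (ofC P δC δD γ ev) where
  algD := isAlgMap_of_algRel fun _ _ h => RingQuot.mkAlgHom_rel k (.algD h)
  algC := isAlgMap_of_algRel fun _ _ h => RingQuot.mkAlgHom_rel k (.algC h)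
  cross c d := by
    have := RingQuot.mkAlgHom_rel k
      (CrossRel.cross (P := P) (δC := δC) (δD := δD) (γ := γ) (ev := ev) (c ⊗ₜ d))
    rw [map_mulMap, map_mulMap, mulMap_tmul] at this
    exact this

variable {P δC δD γ ev} {i : D →ₗ[k] X} {j : C →ₗ[k] X}

/-- The universal property of the cross product. -/
def lift (h : IsCrossRep P δC δD γ ev i j) : Cross P δC δD γ ev →ₐ[k] X :=
  RingQuot.liftAlgHom k ⟨TensorAlgebra.lift k (i.coprod j), by
    have hD : (TensorAlgebra.lift k (i.coprod j)).toLinearMap ∘ₗ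
        (TensorAlgebra.ι k ∘ₗ LinearMap.inl k D C) = i := by ext; simp
    have hC : (TensorAlgebra.lift k (i.coprod j)).toLinearMap ∘ₗ
        (TensorAlgebra.ι k ∘ₗ LinearMap.inr k D C) = j := by ext; simp
    intro x y hxy
    cases hxy with
    | algD h' => exact algRel_map (by rw [hD]; exact h.algD) h'
    | algC h' => exact algRel_map (by rw [hC]; exact h.algC) h'
    | cross t =>
      rw [map_mulMap, map_mulMap, hD, hC]
      have : mulMap j i = mulMap i j ∘ₗ crossMap P δC δD γ ev :=
        TensorProduct.ext' fun c d => by rw [mulMap_tmul]; exact h.cross c d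
      exact LinearMap.congr_fun this t⟩

theorem lift_ofD (h : IsCrossRep P δC δD γ ev i j) (d : D) :
    lift h (ofD P δC δD γ ev d) = i d :=
  (RingQuot.liftAlgHom_mkAlgHom_apply _ _ _ _).trans (by simp)

theorem lift_ofC (h : IsCrossRep P δC δD γ ev i j) (c : C) :
    lift h (ofC P δC δD γ ev c) = j c :=
  (RingQuot.liftAlgHom_mkAlgHom_apply _ _ _ _).trans (by simp)

theorem hom_ext {X : Type*} [Semiring X] [Algebra k X] {φ ψ : Cross P δC δD γ ev →ₐ[k] X}
    (hD : ∀ c, φ (ofD P δC δD γ ev c) = ψ (ofD P δC δD γ ev c))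
    (hC : ∀ c, φ (ofC P δC δD γ ev c) = ψ (ofC P δC δD γ ev c)) : φ = ψ := by
  refine RingQuot.ringQuot_ext' _ _ _ (TensorAlgebra.hom_ext (LinearMap.prod_ext ?_ ?_))
  · ext u; exact hD u
  · ext u; exact hC u

end Cross

namespace IterCross

theorem isIterRep : IsIterRep P δC δD γ ev (ofD P δC δD γ ev) (ofC P δC δD γ ev)
    (ofH P δC δD γ ev) where
  algD := isAlgMap_of_algRel fun _ _ h => RingQuot.mkAlgHom_rel k (.algD h)
  algC := isAlgMap_of_algRel fun _ _ h => RingQuot.mkAlgHom_rel k (.algC h)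
  algH := isAlgMap_of_algRel fun _ _ h => RingQuot.mkAlgHom_rel k (.algH h)
  cross c d := by
    have := RingQuot.mkAlgHom_rel k
      (IterCrossRel.cross (P := P) (δC := δC) (δD := δD) (γ := γ) (ev := ev) (c ⊗ₜ d))
    rw [map_mulMap, map_mulMap, mulMap_tmul] at this
    exact this
  actD := (commutes_iff P).2 fun t => by
    have := RingQuot.mkAlgHom_rel k
      (IterCrossRel.actD (P := P) (δC := δC) (δD := δD) (γ := γ) (ev := ev) t)
    rw [map_mulMap, map_mulMap] at this
    exact this
  actC := (commutes_iff P).2 fun t => by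
    have := RingQuot.mkAlgHom_rel k
      (IterCrossRel.actC (P := P) (δC := δC) (δD := δD) (γ := γ) (ev := ev) t)
    rw [map_mulMap, map_mulMap] at this
    exact this

variable {P δC δD γ ev} {i : D →ₗ[k] X} {j : C →ₗ[k] X} {l : H →ₗ[k] X}

/-- The universal property of the iterated cross product. -/
def lift (h : IsIterRep P δC δD γ ev i j l) : IterCross P δC δD γ ev →ₐ[k] X :=
  RingQuot.liftAlgHom k ⟨freeLift i j l, by
    intro x y hxy
    cases hxy with
    | algD h' => exact algRel_map (by rw [freeLift_gen₁]; exact h.algD) h'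
    | algC h' => exact algRel_map (by rw [freeLift_gen₂]; exact h.algC) h'
    | algH h' => exact algRel_map (by rw [freeLift_gen₃]; exact h.algH) h'
    | cross t =>
      rw [map_mulMap, map_mulMap, freeLift_gen₁, freeLift_gen₂]
      have : mulMap j i = mulMap i j ∘ₗ crossMap P δC δD γ ev :=
        TensorProduct.ext' fun c d => by rw [mulMap_tmul]; exact h.cross c d
      exact LinearMap.congr_fun this t
    | actD t => rw [map_mulMap, map_mulMap, freeLift_gen₁, freeLift_gen₃]
                exact (commutes_iff P).1 h.actD t
    | actC t => rw [map_mulMap, map_mulMap, freeLift_gen₂, freeLift_gen₃]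
                exact (commutes_iff P).1 h.actC t⟩

theorem lift_comp_mk (h : IsIterRep P δC δD γ ev i j l) (x : Free₃ k D C H) :
    lift h (IterCross.mk P δC δD γ ev x) = freeLift i j l x :=
  RingQuot.liftAlgHom_mkAlgHom_apply _ _ _ _

theorem lift_ofD (h : IsIterRep P δC δD γ ev i j l) (d : D) :
    lift h (ofD P δC δD γ ev d) = i d :=
  (lift_comp_mk h _).trans (LinearMap.congr_fun (freeLift_gen₁ i j l) d)

theorem lift_ofC (h : IsIterRep P δC δD γ ev i j l) (c : C) :
    lift h (ofC P δC δD γ ev c) = j c :=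
  (lift_comp_mk h _).trans (LinearMap.congr_fun (freeLift_gen₂ i j l) c)

theorem lift_ofH (h : IsIterRep P δC δD γ ev i j l) (x : H) :
    lift h (ofH P δC δD γ ev x) = l x :=
  (lift_comp_mk h _).trans (LinearMap.congr_fun (freeLift_gen₃ i j l) x)

theorem hom_ext {X : Type*} [Semiring X] [Algebra k X] {φ ψ : IterCross P δC δD γ ev →ₐ[k] X}
    (hD : ∀ c, φ (ofD P δC δD γ ev c) = ψ (ofD P δC δD γ ev c))
    (hC : ∀ c, φ (ofC P δC δD γ ev c) = ψ (ofC P δC δD γ ev c))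
    (hH : ∀ c, φ (ofH P δC δD γ ev c) = ψ (ofH P δC δD γ ev c)) : φ = ψ :=
  RingQuot.ringQuot_ext' _ _ _ (free_hom_ext hD hC hH)

end IterCross

end Presentations

/-! ### The bialgebra structure on the double and the coactions on the cross products. -/

section Coproduct

open Coalgebra HopfAlgebra

section Generators

variable {k T X V H : Type*} [Field k] [Ring T] [Algebra k T] [Ring X] [Algebra k X]
  [AddCommGroup V] [Module k V] [Ring H] [HopfAlgebra k H]

/-- `Φ` is the coaction with its last leg still in `V`, so it can be iterated before `j` is applied;
coassociativity at this level passes to `X` without `j` being injective. -/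
theorem coassoc_of_generator {Δ : T →ₐ[k] T ⊗[k] T} {ψ : X →ₐ[k] T ⊗[k] X} {j : V →ₗ[k] X}
    {Φ : V →ₗ[k] T ⊗[k] V} (hψ : ∀ v, ψ (j v) = j.lTensor T (Φ v)) (v : V)
    (hΦ : Δ.toLinearMap.rTensor V (Φ v) = sw (Φ v) fun t v' => sw (Φ v') fun t' v'' =>
      (t ⊗ₜ t') ⊗ₜ v'') :
    (Algebra.TensorProduct.assoc k k k T T X)
        (Algebra.TensorProduct.map Δ (AlgHom.id k X) (ψ (j v))) =
      Algebra.TensorProduct.map (AlgHom.id k T) ψ (ψ (j v)) := by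
  rw [map_eq_sw] at hΦ
  have := congrArg (fun t => TensorProduct.assoc k T T X (j.lTensor (T ⊗[k] T) t)) hΦ
  simp only [map_sw, LinearMap.rTensor_tmul, LinearMap.lTensor_tmul,
    TensorProduct.assoc_tmul, AlgHom.toLinearMap_apply] at this
  rw [hψ, map_eq_sw]
  simp only [map_sw, LinearMap.lTensor_tmul, Algebra.TensorProduct.map_tmul, hψ, AlgHom.id_apply]
  refine this.trans (sw_congr fun t v' => ?_)
  rw [map_eq_sw (j.lTensor T)]
  simp only [tmul_sw, LinearMap.lTensor_tmul]

theorem counit_of_generator {ε : T →ₐ[k] k} {ψ : X →ₐ[k] T ⊗[k] X} {j : V →ₗ[k] X}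
    {Φ : V →ₗ[k] T ⊗[k] V} (hψ : ∀ v, ψ (j v) = j.lTensor T (Φ v)) (v : V)
    (hΦ : ε.toLinearMap.rTensor V (Φ v) = 1 ⊗ₜ v) :
    Algebra.TensorProduct.map ε (AlgHom.id k X) (ψ (j v)) = 1 ⊗ₜ j v := by
  have := congrArg (j.lTensor k) hΦ
  rw [← sw_tmul (Φ v)] at this
  rw [hψ, ← sw_tmul (Φ v)]
  simpa only [map_sw, LinearMap.rTensor_tmul, LinearMap.lTensor_tmul, AlgHom.id_apply,
    AlgHom.toLinearMap_apply,
    Algebra.TensorProduct.map_tmul] using this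

theorem lTensor_comulH (f : H →ₗ[k] T) (l : H →ₗ[k] X) (h : H) :
    l.lTensor T (comulH f LinearMap.id h) = comulH f l h := by
  simp only [comulH_apply, map_sw, LinearMap.lTensor_tmul, LinearMap.id_apply]

theorem rTensor_comulH {f : H →ₗ[k] T} {Δ : T →ₐ[k] T ⊗[k] T} (hΔ : ∀ h, Δ (f h) = comulH f f h)
    (h : H) : Δ.toLinearMap.rTensor H (comulH f LinearMap.id h) =
      sw (comulH f LinearMap.id h) fun t x => sw (comulH f LinearMap.id x) fun t' y =>
        (t ⊗ₜ t') ⊗ₜ y := by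
  simp only [comulH_apply]
  rw [sw_sw _ _ (by fun_prop) (by fun_prop)]
  have (x y : H) : (sw (f y ⊗ₜ[k] LinearMap.id (R := k) x) fun t x => sw (sw (comul (R := k) x) fun h₁ h₂ =>
      f h₂ ⊗ₜ[k] LinearMap.id (R := k) h₁) fun t' y => (t ⊗ₜ[k] t') ⊗ₜ[k] y) =
      sw (comul (R := k) x) fun h₁ h₂ => (f y ⊗ₜ[k] f h₂) ⊗ₜ[k] h₁ := by
    rw [sw_pure _ _ (by fun_prop) (by fun_prop), sw_sw _ _ (by fun_prop) (by fun_prop)]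
    exact sw_congr fun u w => sw_pure _ _ (by fun_prop) (by fun_prop)
  simp only [this]
  rw [sw_comul_coassoc h (by fun_prop) (by fun_prop) (by fun_prop)]
  simp only [map_sw, LinearMap.rTensor_tmul, AlgHom.toLinearMap_apply, hΔ, comulH_apply,
    sw_tmul_left, LinearMap.id_apply]

theorem rTensor_comulH_counit {f : H →ₗ[k] T} {ε : T →ₐ[k] k}
    (hε : ∀ h, ε (f h) = counit (R := k) h) (h : H) :
    ε.toLinearMap.rTensor H (comulH f LinearMap.id h) = 1 ⊗ₜ h := by
  simp only [comulH_apply, map_sw, LinearMap.rTensor_tmul, AlgHom.toLinearMap_apply, hε,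
    LinearMap.id_apply]
  rw [← sw_counit_right h (F := fun h => (1 : k) ⊗ₜ[k] h) (by fun_prop)]
  refine sw_congr fun x y => ?_
  rw [TensorProduct.smul_tmul', smul_eq_mul, mul_one]

theorem lTensor_comulH_counit (f : H →ₗ[k] T) (h : H) :
    (counit (R := k) (A := H)).lTensor T (comulH f LinearMap.id h) = f h ⊗ₜ 1 := by
  simp only [comulH_apply, map_sw, LinearMap.lTensor_tmul, LinearMap.id_apply]
  rw [← sw_counit_left h (F := fun h => f h ⊗ₜ[k] (1 : k)) (by fun_prop)]
  refine sw_congr fun x y => ?_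
  rw [← TensorProduct.tmul_smul, smul_eq_mul, mul_one]

theorem right_counit_of_generator {ε : X →ₐ[k] k} {ψ : X →ₐ[k] T ⊗[k] X} {j : V →ₗ[k] X}
    {Φ : V →ₗ[k] T ⊗[k] V} (hψ : ∀ v, ψ (j v) = j.lTensor T (Φ v)) (v : V)
    {ε' : V →ₗ[k] k} (hε : ∀ v, ε (j v) = ε' v) {t : T} (hΦ : ε'.lTensor T (Φ v) = t ⊗ₜ 1) :
    Algebra.TensorProduct.map (AlgHom.id k T) ε (ψ (j v)) = t ⊗ₜ 1 := by
  rw [← sw_tmul (Φ v)] at hΦ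
  rw [hψ, ← sw_tmul (Φ v)]
  simpa only [map_sw, LinearMap.lTensor_tmul, AlgHom.id_apply,
    Algebra.TensorProduct.map_tmul, hε] using hΦ

end Generators

variable {k A H B C D : Type*} [Field k] [Ring A] [HopfAlgebra k A] [Ring H] [HopfAlgebra k H]
  [Ring B] [Algebra k B] [Coalgebra k B] [Ring C] [Algebra k C] [Coalgebra k C]
  [Ring D] [Algebra k D]
  {P : WeakQuasitriangularPair k A H} {δB : B →ₗ[k] A ⊗[k] B} {δC : C →ₗ[k] A ⊗[k] C}
  {δD : D →ₗ[k] A ⊗[k] D} {γ : D →ₗ[k] B ⊗[k] D} {ev : C ⊗[k] B →ₗ[k] k}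
  {T : Type*} [Ring T] [Algebra k T]

/-- Colinearity of the counit replaces the coaction component by `1`, and `R⁻*(1) = 1` removes the
twist. -/
theorem lTensor_comulIn_counit (hC : IsBraidedBialgebra P δC) {f : H →ₗ[k] T} {e : C →ₗ[k] T}
    (hf : IsAlgMap f) (c : C) :
    (counit (R := k) (A := C)).lTensor T (P.comulIn δC f e c) = e c ⊗ₜ 1 := by
  simp only [P.comulIn_apply, map_sw, LinearMap.lTensor_tmul]
  rw [← sw_counit_left c (F := fun c => e c ⊗ₜ[k] (1 : k)) (by fun_prop)]
  refine sw_congr fun c₁ c₂ => ?_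
  have := hC.sw_counit_coaction c₁ (F := fun a => (f (P.Rinv a) * e c₂) ⊗ₜ[k] (1 : k))
    (by fun_prop)
  simpa only [P.isRMap.inv_map_one, hf.map_one, one_mul, ← TensorProduct.tmul_smul, smul_eq_mul,
    mul_one] using this

theorem lTensor_coactIn_counit (hB : IsBraidedBialgebra P δB) {f : H →ₗ[k] T} {g : B →ₗ[k] T}
    (hf : IsAlgMap f) (b : B) :
    (counit (R := k) (A := B)).lTensor T (P.coactIn δB comul g f b) = g b ⊗ₜ 1 := by
  simp only [P.coactIn_apply, map_sw, LinearMap.lTensor_tmul]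
  rw [← sw_counit_right b (F := fun c => g c ⊗ₜ[k] (1 : k)) (by fun_prop)]
  refine sw_congr fun b₁ b₂ => ?_
  have := hB.sw_counit_coaction b₂ (F := fun a => (g b₁ * f (P.Rbarinv a)) ⊗ₜ[k] (1 : k))
    (by fun_prop)
  simpa only [P.isRMap_bar.inv_map_one, hf.map_one, mul_one, ← TensorProduct.tmul_smul,
    smul_eq_mul] using this

/-- By naturality, applying `Δ` to the first leg gives `comulIn` with target `T ⊗ T`. The two
hypotheses identify its maps with those of `sw_comulIn_coassoc`. -/
theorem rTensor_comulIn (hC : IsBraidedBialgebra P δC) {f : H →ₗ[k] T} {e : C →ₗ[k] T}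
    (hf : IsAlgMap f) {Δ : T →ₐ[k] T ⊗[k] T} (h₁ : ∀ h, Δ (f h) = comulH f f h)
    (h₂ : ∀ c, Δ (e c) = e.lTensor T (P.comulIn δC f e c)) (c : C) :
    Δ.toLinearMap.rTensor C (P.comulIn δC f e c) =
      sw (P.comulIn δC f e c) fun t v' => sw (P.comulIn δC f e v') fun t' v'' =>
        (t ⊗ₜ t') ⊗ₜ v'' := by
  rw [P.comulIn_comp, ← P.sw_comulIn_coassoc hC hf]
  congr 2
  · ext h; exact h₁ h
  · ext c; exact h₂ c

theorem rTensor_coactIn (hD : IsBraidedComoduleAlgebra P δB δD γ) {f : H →ₗ[k] T}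
    {g : B →ₗ[k] T} (hf : IsAlgMap f) {Δ : T →ₐ[k] T ⊗[k] T} (h₁ : ∀ h, Δ (f h) = comulH f f h)
    (h₂ : ∀ b, Δ (g b) = g.lTensor T (P.coactIn δB comul g f b)) (d : D) :
    Δ.toLinearMap.rTensor D (P.coactIn δD γ g f d) =
      sw (P.coactIn δD γ g f d) fun t v' => sw (P.coactIn δD γ g f v') fun t' v'' =>
        (t ⊗ₜ t') ⊗ₜ v'' := by
  rw [P.coactIn_comp, ← P.sw_coactIn_coassoc hD hf]
  congr 2
  · ext b; exact h₂ b
  · ext h; exact h₁ h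

theorem rTensor_comulIn_counit (hC : IsBraidedBialgebra P δC) {f : H →ₗ[k] T} {e : C →ₗ[k] T}
    {ε : T →ₐ[k] k} (h₁ : ∀ h, ε (f h) = counit (R := k) h)
    (h₂ : ∀ c, ε (e c) = counit (R := k) c) (c : C) :
    ε.toLinearMap.rTensor C (P.comulIn δC f e c) = 1 ⊗ₜ c := by
  rw [P.comulIn_comp, ← P.comulIn_counit hC]
  congr 2
  · ext h; exact h₁ h
  · ext c; exact h₂ c

theorem rTensor_coactIn_counit (hD : IsBraidedComoduleAlgebra P δB δD γ) {f : H →ₗ[k] T}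
    {g : B →ₗ[k] T} {ε : T →ₐ[k] k} (h₁ : ∀ h, ε (f h) = counit (R := k) h)
    (h₂ : ∀ b, ε (g b) = counit (R := k) b) (d : D) :
    ε.toLinearMap.rTensor D (P.coactIn δD γ g f d) = 1 ⊗ₜ d := by
  rw [P.coactIn_comp, ← P.coactIn_counit hD]
  congr 2
  · ext b; exact h₂ b
  · ext h; exact h₁ h

namespace Drin

/-- The coproduct of the double. -/
def comulHom (ev : C ⊗[k] B →ₗ[k] k) (hB : IsBraidedBialgebra P δB) (hC : IsBraidedBialgebra P δC) :
    Drin P δB δC ev →ₐ[k] Drin P δB δC ev ⊗[k] Drin P δB δC ev :=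
  lift ((isDrinRep P δB δC ev).tensor (isDrinRep P δB δC ev) hB hC)

/-- The counit of the double. -/
def counitHom (ev : C ⊗[k] B →ₗ[k] k) (hB : IsBraidedBialgebra P δB)
    (hC : IsBraidedBialgebra P δC) : Drin P δB δC ev →ₐ[k] k :=
  lift (isDrinRep_counit hB hC)

variable (ev) (hB : IsBraidedBialgebra P δB) (hC : IsBraidedBialgebra P δC)

theorem comulHom_ofC (c : C) : comulHom ev hB hC (ofC P δB δC ev c) =
    (ofC P δB δC ev).lTensor _ (P.comulIn δC (ofH P δB δC ev) (ofC P δB δC ev) c) :=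
  lift_ofC _ c

theorem comulHom_ofH (h : H) : comulHom ev hB hC (ofH P δB δC ev h) =
    comulH (ofH P δB δC ev) (ofH P δB δC ev) h :=
  lift_ofH _ h

theorem comulHom_ofB (b : B) : comulHom ev hB hC (ofB P δB δC ev b) =
    (ofB P δB δC ev).lTensor _ (P.coactIn δB comul (ofB P δB δC ev) (ofH P δB δC ev) b) :=
  lift_ofB _ b

theorem counitHom_ofC (c : C) : counitHom ev hB hC (ofC P δB δC ev c) = counit (R := k) c :=
  lift_ofC _ c

theorem counitHom_ofH (h : H) : counitHom ev hB hC (ofH P δB δC ev h) = counit (R := k) h :=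
  lift_ofH _ h

theorem counitHom_ofB (b : B) : counitHom ev hB hC (ofB P δB δC ev b) = counit (R := k) b :=
  lift_ofB _ b

/-- The bialgebra structure of the double. -/
abbrev bialgebra : Bialgebra k (Drin P δB δC ev) :=
  Bialgebra.ofAlgHom (comulHom ev hB hC) (counitHom ev hB hC)
    (hom_ext
      (fun c => coassoc_of_generator (comulHom_ofC ev hB hC) c
        (rTensor_comulIn hC (isDrinRep P δB δC ev).algH
          (comulHom_ofH ev hB hC) (comulHom_ofC ev hB hC) c))
      (fun h => coassoc_of_generator
        (fun h => (comulHom_ofH ev hB hC h).trans (lTensor_comulH _ _ h).symm) h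
        (rTensor_comulH (comulHom_ofH ev hB hC) h))
      (fun b => coassoc_of_generator (comulHom_ofB ev hB hC) b
        (rTensor_coactIn hB.isBraidedComoduleAlgebra (isDrinRep P δB δC ev).algH
          (comulHom_ofH ev hB hC) (comulHom_ofB ev hB hC) b)))
    (hom_ext
      (fun c => counit_of_generator (comulHom_ofC ev hB hC) c
        (rTensor_comulIn_counit hC
          (counitHom_ofH ev hB hC) (counitHom_ofC ev hB hC) c))
      (fun h => counit_of_generator
        (fun h => (comulHom_ofH ev hB hC h).trans (lTensor_comulH _ _ h).symm) h
        (rTensor_comulH_counit (counitHom_ofH ev hB hC) h))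
      (fun b => counit_of_generator (comulHom_ofB ev hB hC) b
        (rTensor_coactIn_counit hB.isBraidedComoduleAlgebra
          (counitHom_ofH ev hB hC) (counitHom_ofB ev hB hC) b)))
    (hom_ext
      (fun c => right_counit_of_generator (comulHom_ofC ev hB hC) c (counitHom_ofC ev hB hC)
        (lTensor_comulIn_counit hC (isDrinRep P δB δC ev).algH c))
      (fun h => right_counit_of_generator
        (fun h => (comulHom_ofH ev hB hC h).trans (lTensor_comulH _ _ h).symm) h
        (counitHom_ofH ev hB hC) (lTensor_comulH_counit _ h))
      (fun b => right_counit_of_generator (comulHom_ofB ev hB hC) b (counitHom_ofB ev hB hC)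
        (lTensor_coactIn_counit hB (isDrinRep P δB δC ev).algH b)))

end Drin

theorem map_twistComul {U : Type*} [AddCommGroup U] [Module k U] (f : H →ₗ[k] T) (e : C →ₗ[k] T)
    (j : C →ₗ[k] U) (c : C) : TensorProduct.map (mulMap f e) j (P.twistComul δC c) =
      j.lTensor T (P.comulIn δC f e c) := by
  rw [WeakQuasitriangularPair.comulIn, LinearMap.comp_apply, ← LinearMap.comp_apply (j.lTensor T),
    LinearMap.lTensor_comp_rTensor]

theorem map_twistCoaction {U V E : Type*} [AddCommGroup U] [Module k U] [AddCommGroup V]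
    [Module k V] [AddCommGroup E] [Module k E] {δ : V →ₗ[k] A ⊗[k] V} {ρ : V →ₗ[k] E ⊗[k] V}
    (g : E →ₗ[k] T) (f : H →ₗ[k] T) (i : V →ₗ[k] U) (v : V) :
    TensorProduct.map (mulMap g f) i (P.twistCoaction δ ρ v) =
      i.lTensor T (P.coactIn δ ρ g f v) := by
  rw [WeakQuasitriangularPair.coactIn, LinearMap.comp_apply, ← LinearMap.comp_apply (i.lTensor T),
    LinearMap.lTensor_comp_rTensor]

theorem isDrinBialgebra (hB : IsBraidedBialgebra P δB) (hC : IsBraidedBialgebra P δC) :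
    @IsDrinBialgebra _ _ _ _ _ _ _ _ _ _ _ _ _ _ _ _ P δB δC ev
      (Drin.bialgebra ev hB hC).toCoalgebra :=
  letI := (Drin.bialgebra ev hB hC).toCoalgebra
  { comul_mul := map_mul (Drin.comulHom ev hB hC)
    comul_one := map_one (Drin.comulHom ev hB hC)
    counit_mul := map_mul (Drin.counitHom ev hB hC)
    counit_one := map_one (Drin.counitHom ev hB hC)
    comul_ofH := Drin.comulHom_ofH ev hB hC
    comul_ofB := fun b => (Drin.comulHom_ofB ev hB hC b).trans (map_twistCoaction _ _ _ b).symm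
    comul_ofC := fun c => (Drin.comulHom_ofC ev hB hC c).trans (map_twistComul _ _ _ c).symm
    counit_ofH := Drin.counitHom_ofH ev hB hC
    counit_ofB := Drin.counitHom_ofB ev hB hC
    counit_ofC := Drin.counitHom_ofC ev hB hC }

/-- A homomorphism satisfying the axioms of a coaction of the double. -/
theorem isLeftCoaction_of_algHom {X : Type*} [Ring X] [Algebra k X] (hB : IsBraidedBialgebra P δB)
    (hC : IsBraidedBialgebra P δC) {ψ : X →ₐ[k] Drin P δB δC ev ⊗[k] X}
    (h₁ : (Algebra.TensorProduct.assoc k k k _ _ X).toAlgHom.comp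
      ((Algebra.TensorProduct.map (Drin.comulHom ev hB hC) (.id k X)).comp ψ) =
        (Algebra.TensorProduct.map (.id k _) ψ).comp ψ)
    (h₂ : (Algebra.TensorProduct.map (Drin.counitHom ev hB hC) (.id k X)).comp ψ =
      (Algebra.TensorProduct.lid k X).symm.toAlgHom) :
    letI := (Drin.bialgebra ev hB hC).toCoalgebra
    IsLeftCoaction ψ.toLinearMap := by
  let _ := (Drin.bialgebra ev hB hC).toCoalgebra
  refine ⟨congrArg AlgHom.toLinearMap h₁, LinearMap.ext fun x => ?_⟩
  exact (congrArg (Algebra.TensorProduct.lid k X) (AlgHom.congr_fun h₂ x)).trans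
    (AlgEquiv.apply_symm_apply _ x)

section Coaction

variable (ev) (hB : IsBraidedBialgebra P δB) (hC : IsBraidedBialgebra P δC)
  (hD : IsBraidedComoduleAlgebra P δB δD γ)

namespace IterCross

/-- The coaction of the double on `D ⋊ ᶜᵒᵖC ⋊ H`. -/
def coaction (hC : IsBraidedBialgebra P δC) (hD : IsBraidedComoduleAlgebra P δB δD γ) :
    IterCross P δC δD γ ev →ₐ[k] Drin P δB δC ev ⊗[k] IterCross P δC δD γ ev :=
  lift ((isIterRep P δC δD γ ev).tensor (Drin.isDrinRep P δB δC ev) hC hD)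

theorem coaction_ofD (d : D) : coaction ev hC hD (ofD P δC δD γ ev d) =
    (ofD P δC δD γ ev).lTensor _
      (P.coactIn δD γ (Drin.ofB P δB δC ev) (Drin.ofH P δB δC ev) d) :=
  lift_ofD _ d

theorem coaction_ofC (c : C) : coaction ev hC hD (ofC P δC δD γ ev c) =
    (ofC P δC δD γ ev).lTensor _
      (P.comulIn δC (Drin.ofH P δB δC ev) (Drin.ofC P δB δC ev) c) :=
  lift_ofC _ c

theorem coaction_ofH (h : H) : coaction ev hC hD (ofH P δC δD γ ev h) =
    comulH (Drin.ofH P δB δC ev) (ofH P δC δD γ ev) h :=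
  lift_ofH _ h

theorem isLeftCoaction_coaction : letI := (Drin.bialgebra ev hB hC).toCoalgebra
    IsLeftCoaction (coaction ev hC hD).toLinearMap :=
  isLeftCoaction_of_algHom hB hC
    (hom_ext
      (fun d => coassoc_of_generator (coaction_ofD ev hC hD) d
        (rTensor_coactIn hD (Drin.isDrinRep P δB δC ev).algH
          (Drin.comulHom_ofH ev hB hC) (Drin.comulHom_ofB ev hB hC) d))
      (fun c => coassoc_of_generator (coaction_ofC ev hC hD) c
        (rTensor_comulIn hC (Drin.isDrinRep P δB δC ev).algH
          (Drin.comulHom_ofH ev hB hC) (Drin.comulHom_ofC ev hB hC) c))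
      (fun h => coassoc_of_generator
        (fun h => (coaction_ofH ev hC hD h).trans (lTensor_comulH _ _ h).symm) h
        (rTensor_comulH (Drin.comulHom_ofH ev hB hC) h)))
    (hom_ext
      (fun d => counit_of_generator (coaction_ofD ev hC hD) d
        (rTensor_coactIn_counit hD
          (Drin.counitHom_ofH ev hB hC) (Drin.counitHom_ofB ev hB hC) d))
      (fun c => counit_of_generator (coaction_ofC ev hC hD) c
        (rTensor_comulIn_counit hC
          (Drin.counitHom_ofH ev hB hC) (Drin.counitHom_ofC ev hB hC) c))
      (fun h => counit_of_generator
        (fun h => (coaction_ofH ev hC hD h).trans (lTensor_comulH _ _ h).symm) h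
        (rTensor_comulH_counit (Drin.counitHom_ofH ev hB hC) h)))

end IterCross

namespace Cross

/-- The coaction of the double on `D ⋊ ᶜᵒᵖC`. -/
def coaction (hC : IsBraidedBialgebra P δC) (hD : IsBraidedComoduleAlgebra P δB δD γ) :
    Cross P δC δD γ ev →ₐ[k] Drin P δB δC ev ⊗[k] Cross P δC δD γ ev :=
  lift ((isCrossRep P δC δD γ ev).tensor (Drin.isDrinRep P δB δC ev) hC hD)

theorem coaction_ofD (d : D) : coaction ev hC hD (ofD P δC δD γ ev d) =
    (ofD P δC δD γ ev).lTensor _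
      (P.coactIn δD γ (Drin.ofB P δB δC ev) (Drin.ofH P δB δC ev) d) :=
  lift_ofD _ d

theorem coaction_ofC (c : C) : coaction ev hC hD (ofC P δC δD γ ev c) =
    (ofC P δC δD γ ev).lTensor _
      (P.comulIn δC (Drin.ofH P δB δC ev) (Drin.ofC P δB δC ev) c) :=
  lift_ofC _ c

theorem isLeftCoaction_coaction : letI := (Drin.bialgebra ev hB hC).toCoalgebra
    IsLeftCoaction (coaction ev hC hD).toLinearMap :=
  isLeftCoaction_of_algHom hB hC
    (hom_ext
      (fun d => coassoc_of_generator (coaction_ofD ev hC hD) d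
        (rTensor_coactIn hD (Drin.isDrinRep P δB δC ev).algH
          (Drin.comulHom_ofH ev hB hC) (Drin.comulHom_ofB ev hB hC) d))
      (fun c => coassoc_of_generator (coaction_ofC ev hC hD) c
        (rTensor_comulIn hC (Drin.isDrinRep P δB δC ev).algH
          (Drin.comulHom_ofH ev hB hC) (Drin.comulHom_ofC ev hB hC) c)))
    (hom_ext
      (fun d => counit_of_generator (coaction_ofD ev hC hD) d
        (rTensor_coactIn_counit hD
          (Drin.counitHom_ofH ev hB hC) (Drin.counitHom_ofB ev hB hC) d))
      (fun c => counit_of_generator (coaction_ofC ev hC hD) c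
        (rTensor_comulIn_counit hC
          (Drin.counitHom_ofH ev hB hC) (Drin.counitHom_ofC ev hB hC) c)))

variable (P δC δD γ)

/-- The homomorphism `D ⋊ ᶜᵒᵖC → D ⋊ ᶜᵒᵖC ⋊ H`. -/
def toIterCross : Cross P δC δD γ ev →ₐ[k] IterCross P δC δD γ ev :=
  lift (IterCross.isIterRep P δC δD γ ev).toIsCrossRep

theorem toIterCross_ofD (d : D) : toIterCross P δC δD γ ev (ofD P δC δD γ ev d) =
    IterCross.ofD P δC δD γ ev d :=
  lift_ofD _ d

theorem toIterCross_ofC (c : C) : toIterCross P δC δD γ ev (ofC P δC δD γ ev c) =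
    IterCross.ofC P δC δD γ ev c :=
  lift_ofC _ c

variable {P δC δD γ}

/-- The coaction on the smaller algebra is built from its own universal property. It is the
restriction because both homomorphisms follow the same formulas on `D` and `C`. -/
theorem coaction_toIterCross : (IterCross.coaction ev hC hD).comp (toIterCross P δC δD γ ev) =
    (Algebra.TensorProduct.map (.id k _) (toIterCross P δC δD γ ev)).comp
      (coaction ev hC hD) := by
  refine hom_ext (fun d => ?_) fun c => ?_
  · simp only [AlgHom.comp_apply, toIterCross_ofD, IterCross.coaction_ofD, coaction_ofD]
    rw [map_eq_sw, map_eq_sw ((ofD P δC δD γ ev).lTensor _)]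
    simp only [map_sw, LinearMap.lTensor_tmul, Algebra.TensorProduct.map_tmul, toIterCross_ofD,
      AlgHom.id_apply]
  · simp only [AlgHom.comp_apply, toIterCross_ofC, IterCross.coaction_ofC, coaction_ofC]
    rw [map_eq_sw, map_eq_sw ((ofC P δC δD γ ev).lTensor _)]
    simp only [map_sw, LinearMap.lTensor_tmul, Algebra.TensorProduct.map_tmul, toIterCross_ofC,
      AlgHom.id_apply]

end Cross

end Coaction

end Coproduct

/-! ### Bijectivity of the multiplication maps. -/

section Bases

open Coalgebra HopfAlgebra

variable {k A H B C D : Type*} [Field k] [Ring A] [HopfAlgebra k A] [Ring H] [HopfAlgebra k H]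
  [Ring B] [Algebra k B] [Coalgebra k B] [Ring C] [Algebra k C] [Coalgebra k C]
  [Ring D] [Algebra k D]
  {P : WeakQuasitriangularPair k A H} {δB : B →ₗ[k] A ⊗[k] B} {δC : C →ₗ[k] A ⊗[k] C}
  {δD : D →ₗ[k] A ⊗[k] D} {γ : D →ₗ[k] B ⊗[k] D} {ev : C ⊗[k] B →ₗ[k] k}

/-! ## The regular representations -/

/-- The algebra of operators on `D`. -/
def Op (k D : Type*) [Field k] [Ring D] [Algebra k D] : Type _ := Module.End k D

instance (k D : Type*) [Field k] [Ring D] [Algebra k D] : Ring (Op k D) :=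
  inferInstanceAs (Ring (Module.End k D))

instance (k D : Type*) [Field k] [Ring D] [Algebra k D] : Algebra k (Op k D) :=
  inferInstanceAs (Algebra k (Module.End k D))

namespace Op

def toEnd : Op k D →ₐ[k] Module.End k D := AlgHom.id k (Module.End k D)

theorem ext {u v : Op k D} (h : ∀ x, toEnd u x = toEnd v x) : u = v :=
  LinearMap.ext (M := D) h

/-- The left multiplications. -/
def mulLeft : D →ₗ[k] Op k D := LinearMap.mul k D

theorem toEnd_mulLeft (d x : D) : toEnd (mulLeft (k := k) d) x = d * x := rfl

theorem isAlgMap_mulLeft : IsAlgMap (mulLeft (k := k) (D := D)) where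
  map_mul x y := ext fun z => by simp [toEnd_mulLeft, mul_assoc]
  map_one := ext fun z => by simp [toEnd_mulLeft]

variable (P δD) in
/-- The action of `H`. -/
def act : H →ₗ[k] Op k D := P.actEnd δD

theorem toEnd_act (h : H) (x : D) : toEnd (act P δD h) x = P.act δD (h ⊗ₜ x) := rfl

variable (γ ev) in
/-- The action of `C`. -/
def pair : C →ₗ[k] Op k D := pairEnd γ ev

theorem toEnd_pair (c : C) : toEnd (pair γ ev c) = pairEnd γ ev c := rfl

theorem isAlgMap_act (hD : IsComoduleAlgebra δD) : IsAlgMap (act P δD) :=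
  ⟨(P.isAlgMap_actEnd hD.isLeftCoaction).map_mul, (P.isAlgMap_actEnd hD.isLeftCoaction).map_one⟩

theorem isAlgMap_pair (hD : IsBraidedComoduleAlgebra P δB δD γ) (hev : IsWeakPairing ev) :
    IsAlgMap (pair γ ev) :=
  ⟨(isAlgMap_pairEnd hD.isLeftCoaction hev).map_mul,
    (isAlgMap_pairEnd hD.isLeftCoaction hev).map_one⟩

theorem commutes_act (hD : IsBraidedComoduleAlgebra P δB δD γ)
    (hev : IsBraidedWeakPairing δC δB ev) : P.Commutes δC (act P δD) (pair γ ev) :=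
  P.commutes_actEnd hD hev

theorem commutes_mulLeft (hD : IsComoduleAlgebra δD) :
    P.Commutes δD (act P δD) (mulLeft (k := k) (D := D)) := by
  intro h d
  refine ext fun x => ?_
  rw [map_sw, sw_apply]
  simp only [map_mul, Module.End.mul_apply, toEnd_mulLeft, toEnd_act, P.act_mul_right hD]

theorem sw_comulIn_actEnd {Z : Type*} [AddCommGroup Z] [Module k Z] (c : C)
    {F : Module.End k D → C → Z} (h₁ : ∀ c, Lin k fun t => F t c)
    (h₂ : ∀ t, Lin k fun c => F t c) :
    sw (P.comulIn δC (P.actEnd δD) (pairEnd γ ev) c) F =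
      sw (P.comulIn δC (act P δD) (pair γ ev) c) fun u c' => F (toEnd u) c' := by
  rw [P.sw_comulIn _ h₁ h₂, P.sw_comulIn _ (by fun_prop) (by fun_prop)]
  rfl

/-- The tensor `w` describes the action of the operator `u` on products. -/
def ActsVia (u : Op k D) (w : Op k D ⊗[k] Op k D) : Prop :=
  ∀ d, u * mulLeft d = sw w fun v v' => mulLeft (toEnd v d) * v'

/-- As with `Intertwines.mul`, multiplicativity lets the factors of `comulIn` coming from `H` and
from `C` be treated separately. -/
theorem ActsVia.mul {u₁ u₂ : Op k D} {w₁ w₂ : Op k D ⊗[k] Op k D}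
    (h₁ : ActsVia u₁ w₁) (h₂ : ActsVia u₂ w₂) : ActsVia (u₁ * u₂) (w₁ * w₂) := by
  intro d
  rw [sw_mul_of_bilinear _ _ (by fun_prop) (by fun_prop), sw_comm, mul_assoc, h₂, mul_sw]
  refine sw_congr fun v v' => ?_
  rw [← mul_assoc, h₁, sw_mul]
  simp only [map_mul, Module.End.mul_apply, mul_assoc]

theorem actsVia_act (hD : IsComoduleAlgebra δD) (h : H) :
    ActsVia (act P δD h) (comulH (act P δD) (act P δD) h) := by
  intro d
  rw [commutes_mulLeft hD, comulH_apply, sw_sw _ _ (by fun_prop) (by fun_prop)]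
  refine sw_congr fun h₁ h₂ => ?_
  rw [sw_pure _ _ (by fun_prop) (by fun_prop), toEnd_act]

theorem actsVia_pair (hC : IsBraidedBialgebra P δC) (hD : IsBraidedComoduleAlgebra P δB δD γ)
    (hev : IsBraidedWeakPairing δC δB ev) (c : C) : ActsVia (pair γ ev c)
      ((pair γ ev).lTensor _ (P.comulIn δC (act P δD) (pair γ ev) c)) := by
  intro d
  rw [sw_lTensor _ _ (by fun_prop) (by fun_prop)]
  refine ext fun x => ?_
  rw [map_sw, sw_apply]
  simp only [map_mul, Module.End.mul_apply, toEnd_mulLeft, toEnd_pair]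
  rw [P.pairEnd_mul hC hD hev, sw_comulIn_actEnd _ (by fun_prop) (by fun_prop)]

end Op

section Regular

variable {E : Type*} [Ring E] [Algebra k E]

variable (k D E) in
/-- The map `d ↦ L_d ⊗ 1`, where `L_d` is the left multiplication by `d`. -/
def regular : D →ₗ[k] Op k D ⊗[k] E :=
  (TensorProduct.mk k _ E).flip 1 ∘ₗ Op.mulLeft

theorem regular_apply (d : D) : regular k D E d = Op.mulLeft d ⊗ₜ 1 := rfl

theorem isAlgMap_regular : IsAlgMap (regular k D E) where
  map_mul x y := by
    simp only [regular_apply, Algebra.TensorProduct.tmul_mul_tmul, mul_one,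
      Op.isAlgMap_mulLeft.map_mul]
  map_one := by
    simp only [regular_apply, Op.isAlgMap_mulLeft.map_one, Algebra.TensorProduct.one_def]

theorem commutes_regular (hD : IsComoduleAlgebra δD) (l : H →ₗ[k] E) :
    P.Commutes δD (comulH (Op.act P δD) l) (regular k D E) := by
  intro h d
  simp only [comulH_apply, regular_apply, sw_mul, mul_sw, Algebra.TensorProduct.tmul_mul_tmul,
    Op.commutes_mulLeft hD _ _, sw_tmul_left, mul_one, one_mul]
  rw [sw_comul_coassoc h (by fun_prop) (by fun_prop) (by fun_prop)]

variable (P δC δD γ ev) in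
/-- The action of `C` on `D ⊗ E` for a map `j : C → E`. -/
def regularC (j : C →ₗ[k] E) : C →ₗ[k] Op k D ⊗[k] E :=
  j.lTensor _ ∘ₗ P.comulIn δC (Op.act P δD) (Op.pair γ ev)

theorem regularC_apply (j : C →ₗ[k] E) (c : C) : regularC P δC δD γ ev j c =
    sw (P.comulIn δC (Op.act P δD) (Op.pair γ ev) c) fun u c' => u ⊗ₜ j c' := by
  rw [regularC, LinearMap.comp_apply, map_eq_sw]
  rfl

/-- Past a left multiplication, an operator obeys the Leibniz rules of `H` and `C`. Since these are
given by the same twisted coproduct, their iteration is the cross relation by coassociativity. -/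
theorem isCrossRep_regular (hC : IsBraidedBialgebra P δC)
    (hD : IsBraidedComoduleAlgebra P δB δD γ) (hev : IsBraidedWeakPairing δC δB ev)
    {j : C →ₗ[k] E} (hj : IsAlgMap j) :
    IsCrossRep P δC δD γ ev (regular k D E) (regularC P δC δD γ ev j) where
  algD := isAlgMap_regular
  algC := by
    have h₁ := Op.isAlgMap_act (P := P) hD.isComoduleAlgebra
    have h₂ := Op.isAlgMap_pair hD hev.isWeakPairing
    exact hj.lTensor_comp ⟨P.comulIn_mul hC h₁ h₂ (Op.commutes_act hD hev),
      P.comulIn_one hC h₁ h₂⟩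
  cross c d := by
    rw [P.mulMap_crossMap, Op.sw_comulIn_actEnd _ (by fun_prop) (by fun_prop)]
    simp only [regularC_apply, regular_apply, sw_mul, mul_sw, mul_one, one_mul,
      Algebra.TensorProduct.tmul_mul_tmul]
    trans sw (P.comulIn δC (comulH (Op.act P δD) (Op.act P δD)) ((Op.pair γ ev).lTensor _ ∘ₗ
      P.comulIn δC (Op.act P δD) (Op.pair γ ev)) c) fun w c' =>
        sw w fun v v' => (Op.mulLeft (Op.toEnd v d) * v') ⊗ₜ[k] j c'
    · rw [P.sw_comulIn _ (by fun_prop) (by fun_prop), P.sw_comulIn _ (by fun_prop) (by fun_prop)]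
      refine sw_congr fun c₁ c₂ => sw_congr fun a c' => ?_
      rw [(Op.actsVia_act hD.isComoduleAlgebra _).mul (Op.actsVia_pair hC hD hev _),
        sw_tmul_left]
      rfl
    · rw [P.sw_comulIn_comulIn hC (Op.isAlgMap_act hD.isComoduleAlgebra) _
        (by fun_prop) (by fun_prop)]
      refine sw_congr fun u c' => sw_congr fun v c'' => ?_
      rw [sw_pure _ _ (by fun_prop) (by fun_prop)]

theorem isIterRep_regular (hC : IsBraidedBialgebra P δC)
    (hD : IsBraidedComoduleAlgebra P δB δD γ) (hev : IsBraidedWeakPairing δC δB ev)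
    {j : C →ₗ[k] E} (hj : IsAlgMap j) {l : H →ₗ[k] E} (hl : IsAlgMap l)
    (hjl : P.Commutes δC l j) :
    IsIterRep P δC δD γ ev (regular k D E) (regularC P δC δD γ ev j)
      (comulH (Op.act P δD) l) where
  toIsCrossRep := isCrossRep_regular hC hD hev hj
  algH := (Op.isAlgMap_act hD.isComoduleAlgebra).comulH hl
  actD := commutes_regular hD.isComoduleAlgebra l
  actC := P.commutes_comulH (P.comulIn_act hC
    (Op.isAlgMap_act hD.isComoduleAlgebra) (Op.commutes_act hD hev)) hjl

variable (k D E) in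
/-- Evaluation of operators at `1`. -/
def evalOne : Op k D ⊗[k] E →ₗ[k] D ⊗[k] E :=
  (LinearMap.applyₗ (1 : D) ∘ₗ Op.toEnd.toLinearMap).rTensor E

theorem evalOne_tmul (u : Op k D) (x : E) : evalOne k D E (u ⊗ₜ x) = Op.toEnd u 1 ⊗ₜ x := rfl

/-- `H` acts on `1` through its counit, so evaluating at `1` leaves of `h` only its image in `E`. -/
theorem evalOne_regular_mul (hD : IsComoduleAlgebra δD) (d : D) (w : Op k D ⊗[k] E)
    (l : H →ₗ[k] E) (h : H) : evalOne k D E (regular k D E d * w * comulH (Op.act P δD) l h) =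
      TensorProduct.map (LinearMap.mulLeft k d) (LinearMap.mulRight k (l h)) (evalOne k D E w) := by
  rw [comulH_apply]
  conv_lhs => rw [← sw_tmul w]
  conv_rhs => rw [← sw_tmul w]
  simp only [regular_apply, sw_mul, mul_sw, map_sw, Algebra.TensorProduct.tmul_mul_tmul,
    evalOne_tmul, map_mul, Module.End.mul_apply, Op.toEnd_mulLeft, Op.toEnd_act,
    P.act_one_right hD, map_smul, one_mul, LinearMap.mulLeft_apply, TensorProduct.map_tmul,
    LinearMap.mulRight_apply]
  rw [sw_comm]
  refine sw_congr fun u x => ?_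
  simp only [← TensorProduct.smul_tmul']
  rw [sw_counit_right h (F := fun h => (d * Op.toEnd u 1) ⊗ₜ[k] (x * l h)) (by fun_prop)]

/-- Both `c · 1` and `h ▷ 1` are given by counits, so nothing of the twisted coproduct survives
evaluation except the last leg. -/
theorem evalOne_regularC (hC : IsBraidedBialgebra P δC)
    (hD : IsBraidedComoduleAlgebra P δB δD γ) (hev : IsWeakPairing ev)
    (j : C →ₗ[k] E) (c : C) : evalOne k D E (regularC P δC δD γ ev j c) = 1 ⊗ₜ j c := by
  have h₁ (c : C) : pairEnd γ ev c 1 = counit (R := k) c • 1 := by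
    rw [pairEnd_apply, hD.coaction_one, sw_pure _ _ (by fun_prop) (by fun_prop), hev.one_right]
  rw [regularC, LinearMap.comp_apply, P.comulIn_apply]
  simp only [map_sw, LinearMap.lTensor_tmul, evalOne_tmul, map_mul, Module.End.mul_apply,
    Op.toEnd_pair, h₁, map_smul, Op.toEnd_act, P.act_one_right hD.isComoduleAlgebra,
    P.isRMap.counit_inv]
  rw [← sw_counit_right c (F := fun c => (1 : D) ⊗ₜ[k] j c) (by fun_prop)]
  refine sw_congr fun c₁ c₂ => ?_
  rw [← hC.isComoduleAlgebra.isLeftCoaction.sw_counit c₁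
    (F := fun c => counit (R := k) c₂ • (1 : D) ⊗ₜ[k] j c) (by fun_prop)]
  refine sw_congr fun a c' => ?_
  rw [smul_comm]
  rfl

end Regular

/-! ## Spanning -/

section Spanning

variable {X : Type*} [Ring X] [Algebra k X] {i : D →ₗ[k] X} {j : C →ₗ[k] X} {l : H →ₗ[k] X}

/-- The subalgebra of the elements mapping a subspace to itself by left multiplication. -/
def leftStabilizer (S : Submodule k X) : Subalgebra k X where
  carrier := {y | ∀ s ∈ S, y * s ∈ S}
  mul_mem' ha hb s hs := by rw [mul_assoc]; exact ha _ (hb s hs)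
  add_mem' ha hb s hs := by rw [add_mul]; exact S.add_mem (ha s hs) (hb s hs)
  algebraMap_mem' r s hs := by rw [← Algebra.smul_def]; exact S.smul_mem r hs

theorem mem_leftStabilizer_range {U V : Type*} [AddCommGroup U] [Module k U] [AddCommGroup V]
    [Module k V] {f : U →ₗ[k] X} {g : V →ₗ[k] X} {y : X}
    (h : ∀ u v, y * (f u * g v) ∈ LinearMap.range (mulMap f g)) :
    y ∈ leftStabilizer (LinearMap.range (mulMap f g)) := by
  rintro _ ⟨t, rfl⟩
  rw [map_eq_sw, mul_sw]
  refine Submodule.sum_mem _ fun p _ => ?_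
  simpa only [mulMap_tmul] using h p.1 p.2

theorem sw_mem {U V : Type*} [AddCommGroup U] [Module k U] [AddCommGroup V]
    [Module k V] {t : U ⊗[k] V} {F : U → V → X} {S : Submodule k X} (h : ∀ u v, F u v ∈ S) :
    sw t F ∈ S :=
  Submodule.sum_mem _ fun p _ => h p.1 p.2

theorem mul_mem_range {U V : Type*} [AddCommGroup U] [Module k U] [AddCommGroup V]
    [Module k V] (f : U →ₗ[k] X) (g : V →ₗ[k] X) (u : U) (v : V) :
    f u * g v ∈ LinearMap.range (mulMap f g) :=
  ⟨u ⊗ₜ v, mulMap_tmul f g u v⟩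

theorem IsCrossRep.mem_leftStabilizer_D (h : IsCrossRep P δC δD γ ev i j) (d : D) :
    i d ∈ leftStabilizer (LinearMap.range (mulMap i j)) :=
  mem_leftStabilizer_range fun u v => by
    rw [← mul_assoc, ← h.algD.map_mul]
    exact mul_mem_range i j _ _

theorem IsCrossRep.mem_leftStabilizer_C (h : IsCrossRep P δC δD γ ev i j) (c : C) :
    j c ∈ leftStabilizer (LinearMap.range (mulMap i j)) :=
  mem_leftStabilizer_range fun u v => by
    rw [← mul_assoc, h.cross, P.mulMap_crossMap, sw_mul]
    refine sw_mem fun w c' => ?_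
    rw [mul_assoc, ← h.algC.map_mul]
    exact mul_mem_range i j _ _

theorem one_mem_range (hi : IsAlgMap i) (hj : IsAlgMap j) :
    1 ∈ LinearMap.range (mulMap i j) := by
  simpa only [hi.map_one, hj.map_one, mul_one] using mul_mem_range i j 1 1

theorem mem_leftStabilizer_mulMap {y : X}
    (h : y ∈ leftStabilizer (LinearMap.range (mulMap i j))) :
    y ∈ leftStabilizer (LinearMap.range (mulMap (mulMap i j) l)) :=
  mem_leftStabilizer_range fun t v => by
    obtain ⟨s, hs⟩ := h _ ⟨t, rfl⟩
    rw [← mul_assoc, ← hs]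
    exact mul_mem_range (mulMap i j) l _ _

/-- An element of `H` is carried to the right past `D` and then past `C`, and merges with the last
factor. -/
theorem IsIterRep.mem_leftStabilizer_H (h : IsIterRep P δC δD γ ev i j l) (x : H) :
    l x ∈ leftStabilizer (LinearMap.range (mulMap (mulMap i j) l)) :=
  mem_leftStabilizer_range fun t y => by
    rw [map_eq_sw, sw_mul, mul_sw]
    refine sw_mem fun d c => ?_
    rw [mulMap_tmul, ← mul_assoc, ← mul_assoc, h.actD, sw_mul, sw_mul]
    refine sw_mem fun h₁ h₂ => ?_
    rw [mul_assoc _ _ (j c), h.actC, mul_sw, sw_mul]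
    refine sw_mem fun x₁ x₂ => ?_
    rw [← mul_assoc, ← mulMap_tmul, mul_assoc, ← h.algH.map_mul]
    exact mul_mem_range (mulMap i j) l _ _

end Spanning

theorem Cross.eq_top {K : Subalgebra k (Cross P δC δD γ ev)}
    (hD : ∀ d, ofD P δC δD γ ev d ∈ K) (hC : ∀ c, ofC P δC δD γ ev c ∈ K) : K = ⊤ := by
  refine eq_top_iff.2 fun x _ => ?_
  obtain ⟨x, rfl⟩ := RingQuot.mkAlgHom_surjective k (CrossRel P δC δD γ ev) x
  induction x using TensorAlgebra.induction with
  | algebraMap r => rw [AlgHom.commutes]; exact K.algebraMap_mem r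
  | mul a b ha hb => rw [map_mul]; exact K.mul_mem (ha trivial) (hb trivial)
  | add a b ha hb => rw [map_add]; exact K.add_mem (ha trivial) (hb trivial)
  | ι p =>
    have : TensorAlgebra.ι k p = TensorAlgebra.ι k (LinearMap.inl k D C p.1) +
        TensorAlgebra.ι k (LinearMap.inr k D C p.2) := by rw [← map_add]; simp
    rw [this, map_add]
    exact K.add_mem (hD p.1) (hC p.2)

theorem IterCross.eq_top {K : Subalgebra k (IterCross P δC δD γ ev)}
    (hD : ∀ d, ofD P δC δD γ ev d ∈ K) (hC : ∀ c, ofC P δC δD γ ev c ∈ K)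
    (hH : ∀ h, ofH P δC δD γ ev h ∈ K) : K = ⊤ := by
  refine eq_top_iff.2 fun x _ => ?_
  obtain ⟨x, rfl⟩ := RingQuot.mkAlgHom_surjective k (IterCrossRel P δC δD γ ev) x
  induction x using TensorAlgebra.induction with
  | algebraMap r => rw [AlgHom.commutes]; exact K.algebraMap_mem r
  | mul a b ha hb => rw [map_mul]; exact K.mul_mem (ha trivial) (hb trivial)
  | add a b ha hb => rw [map_add]; exact K.add_mem (ha trivial) (hb trivial)
  | ι p =>
    have : TensorAlgebra.ι k p = gen₁ k D C H p.1 + (gen₂ k D C H p.2.1 +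
        gen₃ k D C H p.2.2) := by
      simp only [gen₁, gen₂, gen₃, LinearMap.comp_apply]
      rw [← map_add, ← map_add]; simp
    rw [this, map_add, map_add]
    exact K.add_mem (hD p.1) (K.add_mem (hC p.2.1) (hH p.2.2))

theorem Cross.mulMap_bijective (hC : IsBraidedBialgebra P δC)
    (hD : IsBraidedComoduleAlgebra P δB δD γ) (hev : IsBraidedWeakPairing δC δB ev) :
    Function.Bijective (mulMap (ofD P δC δD γ ev) (ofC P δC δD γ ev)) := by
  constructor
  · have hj : IsAlgMap (LinearMap.id : C →ₗ[k] C) := ⟨fun _ _ => rfl, rfl⟩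
    let φ := lift (isCrossRep_regular hC hD hev hj)
    have : (evalOne k D C ∘ₗ φ.toLinearMap) ∘ₗ mulMap (ofD P δC δD γ ev) (ofC P δC δD γ ev) =
        LinearMap.id := by
      refine TensorProduct.ext' fun d c => ?_
      -- There is no factor from `H` here, so the trivial map through the counit at `1` is inserted;
      -- its image under `comulH` is the unit.
      have h := evalOne_regular_mul (P := P) hD.isComoduleAlgebra d
        (regularC P δC δD γ ev LinearMap.id c) (Algebra.linearMap k C ∘ₗ counit) 1
      have h₁ : comulH (Op.act P δD) (Algebra.linearMap k C ∘ₗ counit) 1 = 1 := by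
        rw [comulH_apply, Bialgebra.comul_one, Algebra.TensorProduct.one_def,
          sw_pure _ _ (by fun_prop) (by fun_prop),
          (Op.isAlgMap_act hD.isComoduleAlgebra).map_one,
          Algebra.TensorProduct.one_def]
        simp
      rw [h₁, mul_one, evalOne_regularC hC hD hev.isWeakPairing] at h
      simp only [LinearMap.comp_apply, mulMap_tmul, AlgHom.toLinearMap_apply, map_mul, φ, lift_ofD,
        lift_ofC, h]
      simp
    exact LinearMap.injective_of_comp_eq_id _ _ this
  · have h := isCrossRep P δC δD γ ev
    -- The stabilizer of the image is a subalgebra containing the generators, hence everything;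
    -- applied to `1`, which lies in the image, it gives surjectivity.
    have htop := eq_top h.mem_leftStabilizer_D h.mem_leftStabilizer_C
    intro x
    have hx : x ∈ leftStabilizer (LinearMap.range
      (mulMap (ofD P δC δD γ ev) (ofC P δC δD γ ev))) := htop ▸ Algebra.mem_top
    simpa using hx 1 (one_mem_range h.algD h.algC)

theorem IterCross.mulMap_bijective (hC : IsBraidedBialgebra P δC)
    (hD : IsBraidedComoduleAlgebra P δB δD γ) (hev : IsBraidedWeakPairing δC δB ev) :
    Function.Bijective (mulMap (mulMap (ofD P δC δD γ ev) (ofC P δC δD γ ev))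
      (ofH P δC δD γ ev)) := by
  have hcC := hC.isComoduleAlgebra
  constructor
  · have hl : IsAlgMap (LinearMap.id : H →ₗ[k] H) := ⟨fun _ _ => rfl, rfl⟩
    -- The target is `Op k D ⊗ (Op k C ⊗ H)`, the second factor being the regular representation of
    -- `C` and `H`. Two evaluations at `1`, in `D` and in `C`, recover `d ⊗ c ⊗ h`.
    let φ := lift (isIterRep_regular hC hD hev (isAlgMap_regular (k := k) (D := C) (E := H))
      ((Op.isAlgMap_act hcC).comulH hl) (commutes_regular hcC LinearMap.id))
    have : ((TensorProduct.assoc k D C H).symm.toLinearMap ∘ₗ (evalOne k C H).lTensor D ∘ₗ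
        evalOne k D _ ∘ₗ φ.toLinearMap) ∘ₗ
        mulMap (mulMap (ofD P δC δD γ ev) (ofC P δC δD γ ev)) (ofH P δC δD γ ev) =
        LinearMap.id := by
      refine TensorProduct.ext_threefold fun d c h => ?_
      have h₁ := evalOne_regular_mul hcC c 1 (LinearMap.id : H →ₗ[k] H) h (P := P)
      rw [mul_one, Algebra.TensorProduct.one_def, evalOne_tmul] at h₁
      simp only [LinearMap.comp_apply, mulMap_tmul, AlgHom.toLinearMap_apply, map_mul, φ, lift_ofD,
        lift_ofC, lift_ofH]
      rw [evalOne_regular_mul hD.isComoduleAlgebra, evalOne_regularC hC hD hev.isWeakPairing,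
        TensorProduct.map_tmul, LinearMap.lTensor_tmul, LinearMap.mulRight_apply, h₁]
      simp
    exact LinearMap.injective_of_comp_eq_id _ _ this
  · have h := isIterRep P δC δD γ ev
    have htop := eq_top (fun d => mem_leftStabilizer_mulMap (h.mem_leftStabilizer_D d))
      (fun c => mem_leftStabilizer_mulMap (h.mem_leftStabilizer_C c)) h.mem_leftStabilizer_H
    intro x
    have hx : x ∈ leftStabilizer (LinearMap.range (mulMap
      (mulMap (ofD P δC δD γ ev) (ofC P δC δD γ ev)) (ofH P δC δD γ ev))) :=
        htop ▸ Algebra.mem_top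
    obtain ⟨t, ht⟩ := one_mem_range h.algD h.algC
    have h₁ := mul_mem_range (mulMap (ofD P δC δD γ ev) (ofC P δC δD γ ev)) (ofH P δC δD γ ev) t 1
    rw [ht, h.algH.map_one, mul_one] at h₁
    simpa using hx 1 h₁

/-- In terms of the two multiplication bijections the map is `t ↦ t ⊗ 1`, which the counit of `H`
splits. -/
theorem Cross.toIterCross_injective (hC : IsBraidedBialgebra P δC)
    (hD : IsBraidedComoduleAlgebra P δB δD γ) (hev : IsBraidedWeakPairing δC δB ev) :
    Function.Injective (toIterCross P δC δD γ ev) := by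
  have hf : (toIterCross P δC δD γ ev).toLinearMap ∘ₗ
      mulMap (ofD P δC δD γ ev) (ofC P δC δD γ ev) =
      mulMap (mulMap (IterCross.ofD P δC δD γ ev) (IterCross.ofC P δC δD γ ev))
        (IterCross.ofH P δC δD γ ev) ∘ₗ (TensorProduct.mk k (D ⊗[k] C) H).flip 1 := by
    refine TensorProduct.ext' fun d c => ?_
    simp only [LinearMap.comp_apply, mulMap_tmul, AlgHom.toLinearMap_apply, map_mul,
      toIterCross_ofD, toIterCross_ofC, LinearMap.flip_apply, TensorProduct.mk_apply,
      (IterCross.isIterRep P δC δD γ ev).algH.map_one, mul_one]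
  have hmk : Function.Injective ((TensorProduct.mk k (D ⊗[k] C) H).flip 1) := by
    refine Function.LeftInverse.injective
      (g := TensorProduct.rid k _ ∘ (counit (R := k) (A := H)).lTensor (D ⊗[k] C)) fun t => ?_
    simp
  have hinj : Function.Injective
      (toIterCross P δC δD γ ev ∘ mulMap (ofD P δC δD γ ev) (ofC P δC δD γ ev)) := by
    have := (IterCross.mulMap_bijective hC hD hev).1.comp hmk
    rwa [← LinearMap.coe_comp, ← hf] at this
  exact (Function.Injective.of_comp_iff' _ (Cross.mulMap_bijective hC hD hev)).1 hinj

end Bases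

end BraidedDouble

end

theorem corollary3p19 {k A H B C D : Type*} [Field k]
    [Ring A] [HopfAlgebra k A] [Ring H] [HopfAlgebra k H]
    [Ring B] [Algebra k B] [Coalgebra k B] [Ring C] [Algebra k C] [Coalgebra k C]
    [Ring D] [Algebra k D]
    (P : BraidedDouble.WeakQuasitriangularPair k A H)
    (δB : B →ₗ[k] A ⊗[k] B) (hB : BraidedDouble.IsBraidedBialgebra P δB)
    (δC : C →ₗ[k] A ⊗[k] C) (hC : BraidedDouble.IsBraidedBialgebra P δC)
    (ev : C ⊗[k] B →ₗ[k] k) (hev : BraidedDouble.IsBraidedWeakPairing δC δB ev)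
    (δD : D →ₗ[k] A ⊗[k] D) (γ : D →ₗ[k] B ⊗[k] D)
    (hD : BraidedDouble.IsBraidedComoduleAlgebra P δB δD γ) :
    -- the two cross products live on the tensor products of their factors
    Function.Bijective (BraidedDouble.mulMap (BraidedDouble.Cross.ofD P δC δD γ ev)
      (BraidedDouble.Cross.ofC P δC δD γ ev)) ∧
    Function.Bijective (BraidedDouble.mulMap (BraidedDouble.mulMap
      (BraidedDouble.IterCross.ofD P δC δD γ ev) (BraidedDouble.IterCross.ofC P δC δD γ ev))
      (BraidedDouble.IterCross.ofH P δC δD γ ev)) ∧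
    -- the double is a bialgebra with the prescribed coproduct and counit
    ∃ _ : Coalgebra k (BraidedDouble.Drin P δB δC ev),
      BraidedDouble.IsDrinBialgebra P δB δC ev ∧
      -- the coaction on `D ⋊ ᶜᵒᵖC ⋊ H`
      ∃ δ : BraidedDouble.IterCross P δC δD γ ev →ₐ[k]
          BraidedDouble.Drin P δB δC ev ⊗[k] BraidedDouble.IterCross P δC δD γ ev,
        BraidedDouble.IsLeftCoaction δ.toLinearMap ∧
        (∀ d : D, δ (BraidedDouble.IterCross.ofD P δC δD γ ev d) =
          TensorProduct.map
            (BraidedDouble.mulMap (BraidedDouble.Drin.ofB P δB δC ev)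
              (BraidedDouble.Drin.ofH P δB δC ev))
            (BraidedDouble.IterCross.ofD P δC δD γ ev) (P.twistCoaction δD γ d)) ∧
        (∀ c : C, δ (BraidedDouble.IterCross.ofC P δC δD γ ev c) =
          TensorProduct.map
            (BraidedDouble.mulMap (BraidedDouble.Drin.ofH P δB δC ev)
              (BraidedDouble.Drin.ofC P δB δC ev))
            (BraidedDouble.IterCross.ofC P δC δD γ ev) (P.twistComul δC c)) ∧
        (∀ h : H, δ (BraidedDouble.IterCross.ofH P δC δD γ ev h) =
          TensorProduct.map (BraidedDouble.Drin.ofH P δB δC ev)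
            (BraidedDouble.IterCross.ofH P δC δD γ ev)
            (TensorProduct.comm k H H (Coalgebra.comul (R := k) h))) ∧
        -- `D ⋊ ᶜᵒᵖC` is a comodule subalgebra
        ∃ (ι : BraidedDouble.Cross P δC δD γ ev →ₐ[k] BraidedDouble.IterCross P δC δD γ ev)
          (δ' : BraidedDouble.Cross P δC δD γ ev →ₐ[k]
            BraidedDouble.Drin P δB δC ev ⊗[k] BraidedDouble.Cross P δC δD γ ev),
          Function.Injective ι ∧
          (∀ d : D, ι (BraidedDouble.Cross.ofD P δC δD γ ev d) =
            BraidedDouble.IterCross.ofD P δC δD γ ev d) ∧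
          (∀ c : C, ι (BraidedDouble.Cross.ofC P δC δD γ ev c) =
            BraidedDouble.IterCross.ofC P δC δD γ ev c) ∧
          BraidedDouble.IsLeftCoaction δ'.toLinearMap ∧
          δ.toLinearMap ∘ₗ ι.toLinearMap =
            ι.toLinearMap.lTensor (BraidedDouble.Drin P δB δC ev) ∘ₗ δ'.toLinearMap := by
  refine ⟨BraidedDouble.Cross.mulMap_bijective hC hD hev,
    BraidedDouble.IterCross.mulMap_bijective hC hD hev,
    (BraidedDouble.Drin.bialgebra ev hB hC).toCoalgebra, BraidedDouble.isDrinBialgebra hB hC,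
    BraidedDouble.IterCross.coaction ev hC hD,
    BraidedDouble.IterCross.isLeftCoaction_coaction ev hB hC hD, fun d => ?_, fun c => ?_,
    BraidedDouble.IterCross.coaction_ofH ev hC hD, BraidedDouble.Cross.toIterCross P δC δD γ ev,
    BraidedDouble.Cross.coaction ev hC hD, BraidedDouble.Cross.toIterCross_injective hC hD hev,
    BraidedDouble.Cross.toIterCross_ofD P δC δD γ ev,
    BraidedDouble.Cross.toIterCross_ofC P δC δD γ ev,
    BraidedDouble.Cross.isLeftCoaction_coaction ev hB hC hD,
    congrArg AlgHom.toLinearMap (BraidedDouble.Cross.coaction_toIterCross ev hC hD)⟩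
  · rw [BraidedDouble.IterCross.coaction_ofD, BraidedDouble.map_twistCoaction]
  · rw [BraidedDouble.IterCross.coaction_ofC, BraidedDouble.map_twistComul]
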